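/- **Setting.** $N$ agents have linear time-varying dynamics $x^i_{k+1}=A^i_kx^i_k+B^i_ku^i_k+C^i_kd^i_k$ (plus zero-mean noise, which does not enter the constraints below) over a horizon $T$, with $x^i_0=\bar x^i_0+\bar d^i_0$ and with state, input, disturbance and position dimensions $n_x,n_u,n_d,m$. Each agent has exactly $n_{\rm inter}$ neighbors $\mathcal N_i$, and there are $n_{\rm obs}$ obstacles. The disturbance $\zeta^i=[\bar d^i_0;d^i_0;\dots;d^i_{T-1}]\in\mathbb R^{n_x+Tn_d}$ lies in $\{\Gamma_iz:\langle S_iz,z\rangle\le\tau^i\}$ with $\Gamma_i$ square, $S_i\succ0$, $\tau^i>0$. The policies are $u^i_k=\bar u^i_k+\sum_{\ell=\max(0,k-\gamma_h+1)}^kK^i_{k,\ell}\delta^i_\ell$ ($\delta^i$ the deviation from the disturbance-free state). Write $x^i=G^i_0x^i_0+G^i_uu^i+G^i_\zeta\zeta^i$ (apart from the noise) for the stacked dynamics, $\mu^i=G^i_0\bar x^i_0+G^i_u\bar u^i$, $M_i=(G^i_uK^i+I)G^i_\zeta$ and $\sigma_i(a)=(\tau^i)^{1/2}\|\Gamma_i^{\rm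 T}M_i^{\rm T}a\|_{S_i^{-1}}$; let $p^i_k=H_iP_k\mu^i\in\mathbb R^m$ be the mean position and $h^i_{k,r}{}^{\rm T}$ the $r$-th row of $H_iP_k$. The transformed multi-agent problem with the reformulated constraints (deterministic uncertainty only) is to minimize $\sum_i\big(\bar u^{i\,\rm T}R_{\bar u}\bar u^i+\|R_KK^i\|_F^2\big)$, with $R_{\bar u}\succ0$ and $R_K$ invertible, over $\bar u^i,K^i$, deviation bounds $\mu^i_{d,k}\in\mathbb R^m$ and slacks $\tilde c$, subject to, for all $i$, $k=0,\dots,T$, obstacles $o$ and $j\in\mathcal N_i$: $a^{\rm T}\mu^i+\sigma_i(a)\le b$ and $\bar a^{\rm T}\mu^i=\bar b,\ \sigma_i(\bar a)\le\epsilon$ for given finite lists of robust linear mean constraints (the equality constraints on $\bar u^i$ being linearly independent); $(\mu^i_{d,k})_r\ge\sigma_i(h^i_{k,r})$; $\|\mu^i_{d,k}\|_2\le\tilde c_{i,k,o}-c_{i,o}$ and $\|p^i_k-b_{i,o}\|_2\ge\tilde c_{i,k,o}$; $\|\mu^i_{d,k}+\mu^j_{d,k}\|_2\le\tilde c_{ij,k}-c_{ij}$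 and $\|p^i_k-p^j_k\|_2\ge\tilde c_{ij,k}$. All $c\ge0$. *Centralized approach:* starting from a strictly feasible point, $L_{\rm Lin}$ outer loops; in each, the nonconvex constraints (the last inequality of each of the two collision-avoidance groups) are linearized at the previous solution and $L_{\rm IP}$ iterations of the interior-point method (logarithmic barrier with a given sequence of barrier parameters, one damped Newton step $x+d/(1+\delta)$ per iteration, $d$ the Newton direction and $\delta$ the Newton decrement) are made. *Distributed approach:* $L_{\rm ADMM}$ iterations of consensus ADMM. Each agent keeps copies of the mean positions and deviation bounds of its neighbors, makes $L_{\rm IP}$ such interior-point iterations on its own subproblem (its cost and constraints plus the augmented Lagrangian terms, nonconvex constraints linearized at its previous iterate), then makes the closed-form averaging update of its global variables and the update of its dual variables. All agents work in parallel, each with the data that it holds or receives; the cost is counted per agent. *Cost:* the number of operations $+,-,\times,/,\sqrt{\ }$ on real numbers of a straight-line program that computes the iterates from the constant coefficients of the second-order cone form (including the Hessian matrices of the agents' costs and their inverses), the algorithm parameters and the initial values; the one-time preprocessing that produces these coefficients is not counted. **Statement.** Fix $m$ and $\kappa$. Let $T,n_x,n_u,n_d,\gamma_h\ge1$, $n_{\rm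 inter}+n_{\rm obs}\ge1$, $n_x\le\kappa Tn_d$, and let each agent have at most $\kappa T$ robust linear mean constraints. There is a constant $C$ depending only on $m$ and $\kappa$ such that the following hold. 1. The iterates of the centralized approach can be computed at cost at most $$C\,L_{\rm Lin}L_{\rm IP}N^3T^4(n_{\rm inter}+n_{\rm obs})^3n_u^2n_x^2n_d\gamma_h^2 ,$$ which is cubic in the number of agents. 2. If each agent is a neighbor of at most $\kappa n_{\rm inter}$ agents and $L_{\rm IP}\ge1$, the iterates of the distributed algorithm can be computed at (parallel) cost at most $$C\,L_{\rm ADMM}L_{\rm IP}T^4(n_{\rm inter}+n_{\rm obs})^3n_u^2n_x^2n_d\gamma_h^2 ,$$ with no dependence on $N$. -/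

import Mathlib

open scoped Matrix

namespace RobustMAS

noncomputable section

/-! ### Cost model: straight-line real arithmetic

The cost of a computation is the number of arithmetic operations `+`, `-`, `*`, `/`, `√` on real
numbers. Intermediate results are functions of the problem instance, which ranges over `D`. Division
and square root may be used only where they are legitimate on every instance. -/

/-- `OneOp S f`: one operation on members of `S` or real constants gives `f`. -/
inductive OneOp {D : Type} (S : Set (D → ℝ)) : (D → ℝ) → Prop
  | add (f g : D → ℝ) (hf : f ∈ S ∪ Set.range (Function.const D))
      (hg : g ∈ S ∪ Set.range (Function.const D)) : OneOp S (fun s => f s + g s)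
  | sub (f g : D → ℝ) (hf : f ∈ S ∪ Set.range (Function.const D))
      (hg : g ∈ S ∪ Set.range (Function.const D)) : OneOp S (fun s => f s - g s)
  | mul (f g : D → ℝ) (hf : f ∈ S ∪ Set.range (Function.const D))
      (hg : g ∈ S ∪ Set.range (Function.const D)) : OneOp S (fun s => f s * g s)
  | div (f g : D → ℝ) (hf : f ∈ S ∪ Set.range (Function.const D))
      (hg : g ∈ S ∪ Set.range (Function.const D)) (h0 : ∀ s, g s ≠ 0) :
      OneOp S (fun s => f s / g s)
  | sqrt (f : D → ℝ) (hf : f ∈ S ∪ Set.range (Function.const D)) (h0 : ∀ s, 0 ≤ f s) :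
      OneOp S (fun s => √(f s))

/-- `Computes S k F`: a straight-line program of `k` operations computes all members of `F` from
the inputs `S` (and real constants). -/
inductive Computes {D : Type} : Set (D → ℝ) → ℕ → Set (D → ℝ) → Prop
  | done {S F : Set (D → ℝ)} (h : F ⊆ S ∪ Set.range (Function.const D)) : Computes S 0 F
  | step {S F : Set (D → ℝ)} {k : ℕ} {f : D → ℝ} (hf : OneOp S f)
      (hk : Computes (insert f S) k F) : Computes S (k + 1) F

/-! ### Conic programs and the interior-point (log-barrier, damped Newton) method -/

/-- The coefficient of the variable `v` in an affine function. -/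
def slope {V : Type} [DecidableEq V] (f : (V → ℝ) → ℝ) (v : V) : ℝ := f (Pi.single v 1) - f 0

/-- The partial derivative at `x` of a function that is a polynomial of degree at most two
(the central difference is then exact). -/
def quadGrad {V : Type} [DecidableEq V] (f : (V → ℝ) → ℝ) (x : V → ℝ) (v : V) : ℝ :=
  (f (x + Pi.single v 1) - f (x - Pi.single v 1)) / 2

/-- The (constant) Hessian matrix of a function that is a polynomial of degree at most two. -/
def quadHess {V : Type} [DecidableEq V] (f : (V → ℝ) → ℝ) : Matrix V V ℝ :=
  fun u v => f (Pi.single u 1 + Pi.single v 1) - f (Pi.single u 1) - f (Pi.single v 1) + f 0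

/-- A second-order cone constraint `‖(body r x)_r‖₂ ≤ top x`, with affine `top` and `body r`. -/
structure SOC (V R : Type) where
  top : (V → ℝ) → ℝ
  body : R → (V → ℝ) → ℝ

namespace SOC

variable {V R : Type} [DecidableEq V] [Fintype R]

/-- `top² - ‖body‖²`; the barrier of the constraint is `-log` of this. -/
def gap (c : SOC V R) (x : V → ℝ) : ℝ := c.top x ^ 2 - ∑ r, c.body r x ^ 2

/-- Strict satisfaction. -/
def Interior (c : SOC V R) (x : V → ℝ) : Prop := 0 < c.top x ∧ 0 < c.gap x

/-- Half the gradient of `gap`. -/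
def halfGrad (c : SOC V R) (x : V → ℝ) (v : V) : ℝ :=
  c.top x * slope c.top v - ∑ r, c.body r x * slope (c.body r) v

/-- Gradient of `-log gap`. -/
def grad (c : SOC V R) (x : V → ℝ) (v : V) : ℝ := -(2 / c.gap x) * c.halfGrad x v

/-- Hessian of `-log gap`. -/
def hess (c : SOC V R) (x : V → ℝ) : Matrix V V ℝ := fun u v =>
  4 / c.gap x ^ 2 * (c.halfGrad x u * c.halfGrad x v)
    + 2 / c.gap x * (∑ r, slope (c.body r) u * slope (c.body r) v - slope c.top u * slope c.top v)

end SOC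

/-- Minimize a convex quadratic `obj` subject to affine constraints `lin l x ≥ 0` and `eqn e x = 0`
and two families of second-order cone constraints, with `R₁`- and `R₂`-indexed bodies. -/
structure ConicProgram (V L E B₁ R₁ B₂ R₂ : Type) where
  obj : (V → ℝ) → ℝ
  lin : L → (V → ℝ) → ℝ
  eqn : E → (V → ℝ) → ℝ
  soc₁ : B₁ → SOC V R₁
  soc₂ : B₂ → SOC V R₂

namespace ConicProgram

variable {V L E B₁ R₁ B₂ R₂ : Type} [Fintype V] [DecidableEq V] [Fintype L] [Fintype E]
  [DecidableEq E] [Fintype B₁] [Fintype R₁] [Fintype B₂] [Fintype R₂]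

/-- Gradient of `t * obj - ∑ log lin - ∑ log gap`. -/
def grad (P : ConicProgram V L E B₁ R₁ B₂ R₂) (t : ℝ) (x : V → ℝ) (v : V) : ℝ :=
  t * quadGrad P.obj x v - ∑ l, slope (P.lin l) v / P.lin l x
    + ∑ b, (P.soc₁ b).grad x v + ∑ b, (P.soc₂ b).grad x v

/-- Hessian of `t * obj - ∑ log lin - ∑ log gap`. -/
def hess (P : ConicProgram V L E B₁ R₁ B₂ R₂) (t : ℝ) (x : V → ℝ) : Matrix V V ℝ := fun u v =>
  t * quadHess P.obj u v + ∑ l, slope (P.lin l) u * slope (P.lin l) v / P.lin l x ^ 2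
    + ∑ b, (P.soc₁ b).hess x u v + ∑ b, (P.soc₂ b).hess x u v

/-- Matrix of the equality constraints. -/
def eqMat (P : ConicProgram V L E B₁ R₁ B₂ R₂) : Matrix E V ℝ := fun e v => slope (P.eqn e) v

/-- Matrix of the Newton (KKT) system. -/
def kkt (P : ConicProgram V L E B₁ R₁ B₂ R₂) (t : ℝ) (x : V → ℝ) : Matrix (V ⊕ E) (V ⊕ E) ℝ :=
  Matrix.fromBlocks (P.hess t x) P.eqMatᵀ P.eqMat 0

/-- The Newton direction: `H d + Aᵀ y = -g`, `A d = 0`. -/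
def newtonDir (P : ConicProgram V L E B₁ R₁ B₂ R₂) (t : ℝ) (x : V → ℝ) (v : V) : ℝ :=
  ((P.kkt t x)⁻¹ *ᵥ Sum.elim (fun u => -P.grad t x u) (fun _ : E => 0)) (Sum.inl v)

/-- One interior-point iteration: the damped Newton step `x + d / (1 + δ)`, where
`δ = √(dᵀ H d) = √(-gᵀ d)` is the Newton decrement. -/
def newtonStep (P : ConicProgram V L E B₁ R₁ B₂ R₂) (t : ℝ) (x : V → ℝ) : V → ℝ := fun v =>
  x v + P.newtonDir t x v / (1 + √(-(P.grad t x ⬝ᵥ P.newtonDir t x)))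

/-- The iterates of the interior-point method with barrier parameters `t 0, t 1, …`. -/
def ipm (P : ConicProgram V L E B₁ R₁ B₂ R₂) (t : ℕ → ℝ) (x : V → ℝ) : ℕ → V → ℝ
  | 0 => x
  | j + 1 => P.newtonStep (t j) (ipm P t x j)

end ConicProgram

/-! ### The agents -/

/-- The sizes: `N` agents, horizon `T`, state, input and disturbance dimensions `nx`, `nu`, `nd`,
position dimension `m`, `nobs` obstacles, `ninter` neighbors per agent, feedback history length
`γ`, and the numbers `nlin` and `ntight` of robust linear mean constraints per agent of the one-sided
form and of the decoupled form. -/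
structure Dims where
  N : ℕ
  T : ℕ
  nx : ℕ
  nu : ℕ
  nd : ℕ
  m : ℕ
  nobs : ℕ
  ninter : ℕ
  γ : ℕ
  nlin : ℕ
  ntight : ℕ

namespace Dims

/-- Times `0, …, T`. -/
abbrev Time (d : Dims) : Type := Fin (d.T + 1)

/-- Coordinates of a stacked state sequence `[x_0; …; x_T]`. -/
abbrev St (d : Dims) : Type := d.Time × Fin d.nx

/-- Coordinates of a stacked input sequence `[u_0; …; u_{T-1}]`. -/
abbrev Inp (d : Dims) : Type := Fin d.T × Fin d.nu

/-- Coordinates of `ζ = [d̄_0; d_0; …; d_{T-1}]`. -/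
abbrev Zeta (d : Dims) : Type := Fin d.nx ⊕ (Fin d.T × Fin d.nd)

/-- Pairs `(k, ℓ)` with `k - γ + 1 ≤ ℓ ≤ k`, for which there is a gain `K_{k,ℓ}`. -/
abbrev Window (d : Dims) : Type :=
  {q : Fin d.T × d.Time // q.2.val ≤ q.1.val ∧ q.1.val < q.2.val + d.γ}

/-- Coordinates of the control parameters `(ū, K)` of one agent. -/
abbrev Ctrl (d : Dims) : Type := d.Inp ⊕ (d.Window × Fin d.nu × Fin d.nx)

end Dims

/-- Data of one agent. The dynamics of the mean are `x_{k+1} = A_k x_k + B_k u_k + C_k d_k`,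
`x_0 = x0 + d̄_0`; the uncertainty set is `{Γ z | ⟨S z, z⟩ ≤ τ}`, and `W` is a factor of `S⁻¹`. -/
structure Agent (d : Dims) where
  A : Fin d.T → Matrix (Fin d.nx) (Fin d.nx) ℝ
  B : Fin d.T → Matrix (Fin d.nx) (Fin d.nu) ℝ
  C : Fin d.T → Matrix (Fin d.nx) (Fin d.nd) ℝ
  x0 : Fin d.nx → ℝ
  Γ : Matrix d.Zeta d.Zeta ℝ
  S : Matrix d.Zeta d.Zeta ℝ
  W : Matrix d.Zeta d.Zeta ℝ
  τ : ℝ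
  /-- cost weights -/
  Ru : Matrix d.Inp d.Inp ℝ
  RK : Matrix d.Inp d.Inp ℝ
  /-- robust constraints `aLinᵀ E[x] ≤ bLin` -/
  aLin : Fin d.nlin → d.St → ℝ
  bLin : Fin d.nlin → ℝ
  /-- robust constraints `aTightᵀ μ = bTight` with uncertain part at most `ε` -/
  aTight : Fin d.ntight → d.St → ℝ
  bTight : Fin d.ntight → ℝ
  ε : Fin d.ntight → ℝ
  /-- the matrix that extracts the position from the state -/
  H : Matrix (Fin d.m) (Fin d.nx) ℝ
  /-- obstacle centers and safety distances -/
  center : Fin d.nobs → Fin d.m → ℝ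
  cObs : Fin d.nobs → ℝ

namespace Agent

variable {d : Dims}

/-- `trans k ℓ = A_{k-1} ⋯ A_ℓ` for `ℓ ≤ k ≤ T`. -/
def trans (a : Agent d) : ℕ → ℕ → Matrix (Fin d.nx) (Fin d.nx) ℝ
  | 0, _ => 1
  | k + 1, l => if h : l ≤ k ∧ k < d.T then a.A ⟨k, h.2⟩ * trans a k l else 1

def G0 (a : Agent d) : Matrix d.St (Fin d.nx) ℝ := fun p q => a.trans p.1 0 p.2 q

def Gu (a : Agent d) : Matrix d.St d.Inp ℝ := fun p q =>
  if q.1.val < p.1.val then (a.trans p.1 (q.1 + 1) * a.B q.1) p.2 q.2 else 0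

def Gζ (a : Agent d) : Matrix d.St d.Zeta ℝ := fun p z =>
  match z with
  | Sum.inl q => a.trans p.1 0 p.2 q
  | Sum.inr q => if q.1.val < p.1.val then (a.trans p.1 (q.1 + 1) * a.C q.1) p.2 q.2 else 0

end Agent

variable {d : Dims}

/-- The feed-forward part `ū` of the control parameters. -/
def feedForward (c : d.Ctrl → ℝ) : d.Inp → ℝ := fun q => c (Sum.inl q)

/-- The feedback matrix `K` of the control parameters. -/
def gainMat (c : d.Ctrl → ℝ) : Matrix d.Inp d.St ℝ := fun p q =>
  if h : q.1.val ≤ p.1.val ∧ p.1.val < q.1.val + d.γ then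
    c (Sum.inr (⟨(p.1, q.1), h⟩, p.2, q.2)) else 0

namespace Agent

/-- The disturbance-free mean `μ = G₀ x̄₀ + G_u ū`. -/
def mean (a : Agent d) (c : d.Ctrl → ℝ) : d.St → ℝ := a.G0 *ᵥ a.x0 + a.Gu *ᵥ feedForward c

/-- `M = (G_u K + I) G_ζ`. -/
def M (a : Agent d) (c : d.Ctrl → ℝ) : Matrix d.St d.Zeta ℝ := (a.Gu * gainMat c + 1) * a.Gζ

/-- A vector whose Euclidean norm is `√τ ‖Γᵀ Mᵀ v‖_{S⁻¹}`. -/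
def dev (a : Agent d) (v : d.St → ℝ) (c : d.Ctrl → ℝ) : d.Zeta → ℝ :=
  √a.τ • (a.W *ᵥ (a.Γᵀ *ᵥ ((a.M c)ᵀ *ᵥ v)))

/-- The `r`-th row of `H P_k`, where `P_k` extracts `x_k` from the state sequence. -/
def posRow (a : Agent d) (k : d.Time) (r : Fin d.m) : d.St → ℝ :=
  fun q => if q.1 = k then a.H r q.2 else 0

/-- The disturbance-free mean position at time `k`. -/
def pos (a : Agent d) (c : d.Ctrl → ℝ) (k : d.Time) : Fin d.m → ℝ :=
  fun r => a.posRow k r ⬝ᵥ a.mean c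

/-- The cost `ūᵀ R_u ū + ‖R_K K‖_F²`. -/
def cost (a : Agent d) (c : d.Ctrl → ℝ) : ℝ :=
  feedForward c ⬝ᵥ (a.Ru *ᵥ feedForward c) + ∑ p, ∑ q, (a.RK * gainMat c) p q ^ 2

/-- Standing assumptions on the data of an agent. -/
structure Valid (a : Agent d) : Prop where
  S_pos : a.S.PosDef
  W_factor : a.Wᵀ * a.W = a.S⁻¹
  τ_pos : 0 < a.τ
  Ru_pos : a.Ru.PosDef
  RK_inv : IsUnit a.RK.det
  cObs_nonneg : ∀ o, 0 ≤ a.cObs o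
  eq_indep : LinearIndependent ℝ (fun r => a.aTight r ᵥ* a.Gu)

/-- The constant coefficients of the second-order cone form of the constraints of an agent: scalars,
coefficients of the affine functions of the control parameters that occur, and the Hessian
matrix of the cost with its inverse. -/
def coefficients (d : Dims) : Set (Agent d → ℝ) :=
  Set.range (fun (q : d.Ctrl × d.Ctrl) a => quadHess a.cost q.1 q.2)
  ∪ Set.range (fun (q : d.Ctrl × d.Ctrl) a => (quadHess a.cost)⁻¹ q.1 q.2)
  ∪ Set.range (fun (q : d.Time × Fin d.m) a => a.pos 0 q.1 q.2)
  ∪ Set.range (fun (q : d.Time × Fin d.m × d.Ctrl) a =>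
      slope (fun c => a.pos c q.1 q.2.1) q.2.2)
  ∪ Set.range (fun (q : d.Time × Fin d.m × d.Zeta) a => a.dev (a.posRow q.1 q.2.1) 0 q.2.2)
  ∪ Set.range (fun (q : d.Time × Fin d.m × d.Zeta × d.Ctrl) a =>
      slope (fun c => a.dev (a.posRow q.1 q.2.1) c q.2.2.1) q.2.2.2)
  ∪ Set.range (fun (r : Fin d.nlin) a => a.aLin r ⬝ᵥ a.mean 0)
  ∪ Set.range (fun (q : Fin d.nlin × d.Ctrl) a => slope (fun c => a.aLin q.1 ⬝ᵥ a.mean c) q.2)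
  ∪ Set.range (fun (q : Fin d.nlin × d.Zeta) a => a.dev (a.aLin q.1) 0 q.2)
  ∪ Set.range (fun (q : Fin d.nlin × d.Zeta × d.Ctrl) a =>
      slope (fun c => a.dev (a.aLin q.1) c q.2.1) q.2.2)
  ∪ Set.range (fun (r : Fin d.ntight) a => a.aTight r ⬝ᵥ a.mean 0)
  ∪ Set.range (fun (q : Fin d.ntight × d.Ctrl) a =>
      slope (fun c => a.aTight q.1 ⬝ᵥ a.mean c) q.2)
  ∪ Set.range (fun (q : Fin d.ntight × d.Zeta) a => a.dev (a.aTight q.1) 0 q.2)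
  ∪ Set.range (fun (q : Fin d.ntight × d.Zeta × d.Ctrl) a =>
      slope (fun c => a.dev (a.aTight q.1) c q.2.1) q.2.2)
  ∪ Set.range (fun (r : Fin d.nlin) a => a.bLin r)
  ∪ Set.range (fun (r : Fin d.ntight) a => a.bTight r)
  ∪ Set.range (fun (r : Fin d.ntight) a => a.ε r)
  ∪ Set.range (fun (q : Fin d.nobs × Fin d.m) a => a.center q.1 q.2)
  ∪ Set.range (fun (o : Fin d.nobs) a => a.cObs o)

end Agent

/-- Data of the multi-agent problem; `nbr i` is the set of neighbors of agent `i`, and `cInter` holds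
the inter-agent safety distances. -/
structure Problem (d : Dims) (nbr : Fin d.N → Finset (Fin d.N)) where
  agent : Fin d.N → Agent d
  cInter : (i : Fin d.N) → nbr i → ℝ

def Problem.Valid {nbr : Fin d.N → Finset (Fin d.N)} (P : Problem d nbr) : Prop :=
  (∀ i, (P.agent i).Valid) ∧ ∀ i j, 0 ≤ P.cInter i j

/-- Euclidean norm. -/
def nrm {n : ℕ} (z : Fin n → ℝ) : ℝ := √(z ⬝ᵥ z)

/-- The linearization at `zl` of the Euclidean norm. -/
def linNrm {n : ℕ} (zl z : Fin n → ℝ) : ℝ := nrm zl + (zl ⬝ᵥ (z - zl)) / nrm zl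

/-! ### The centralized approach -/

section Central

variable {nbr : Fin d.N → Finset (Fin d.N)}

/-- Ordered pairs of an agent and a neighbor of it. -/
abbrev Edge (nbr : Fin d.N → Finset (Fin d.N)) : Type := Σ i, nbr i

/-- Variables of the centralized problem: all control parameters, the deviation bounds `μ_d`, the
slack variables of the obstacle constraints and those of the inter-agent constraints. -/
abbrev CVar (nbr : Fin d.N → Finset (Fin d.N)) : Type :=
  (Fin d.N × d.Ctrl) ⊕ (Fin d.N × d.Time × Fin d.m) ⊕ (Fin d.N × d.Time × Fin d.nobs)
    ⊕ (Edge nbr × d.Time)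

def CVar.ctrl (x : CVar nbr → ℝ) (i : Fin d.N) : d.Ctrl → ℝ := fun c => x (Sum.inl (i, c))

def CVar.dev (x : CVar nbr → ℝ) (i : Fin d.N) (k : d.Time) : Fin d.m → ℝ :=
  fun r => x (Sum.inr (Sum.inl (i, k, r)))

def CVar.slackObs (x : CVar nbr → ℝ) (i : Fin d.N) (k : d.Time) (o : Fin d.nobs) : ℝ :=
  x (Sum.inr (Sum.inr (Sum.inl (i, k, o))))

def CVar.slackInter (x : CVar nbr → ℝ) (e : Edge nbr) (k : d.Time) : ℝ :=
  x (Sum.inr (Sum.inr (Sum.inr (e, k))))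

/-- Position of agent `i` relative to obstacle `o`. -/
def Problem.relObs (P : Problem d nbr) (x : CVar nbr → ℝ) (i : Fin d.N) (k : d.Time)
    (o : Fin d.nobs) : Fin d.m → ℝ :=
  (P.agent i).pos (CVar.ctrl x i) k - (P.agent i).center o

/-- Relative position of an agent and its neighbor. -/
def Problem.relInter (P : Problem d nbr) (x : CVar nbr → ℝ) (e : Edge nbr) (k : d.Time) :
    Fin d.m → ℝ :=
  (P.agent e.1).pos (CVar.ctrl x e.1) k - (P.agent e.2).pos (CVar.ctrl x e.2) k

/-- The multi-agent problem with the reformulated constraints, the nonconvex constraints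
`‖relObs‖ ≥ c̃` and `‖relInter‖ ≥ c̃` being linearized at `xl`. -/
def Problem.central (P : Problem d nbr) (xl : CVar nbr → ℝ) :
    ConicProgram (CVar nbr) ((Fin d.N × d.Time × Fin d.nobs) ⊕ (Edge nbr × d.Time))
      (Fin d.N × Fin d.ntight)
      ((Fin d.N × Fin d.nlin) ⊕ (Fin d.N × Fin d.ntight) ⊕ (Fin d.N × d.Time × Fin d.m)) d.Zeta
      ((Fin d.N × d.Time × Fin d.nobs) ⊕ (Edge nbr × d.Time)) (Fin d.m) where
  obj x := ∑ i, (P.agent i).cost (CVar.ctrl x i)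
  lin
    | Sum.inl (i, k, o) => fun x =>
        linNrm (P.relObs xl i k o) (P.relObs x i k o) - CVar.slackObs x i k o
    | Sum.inr (e, k) => fun x =>
        linNrm (P.relInter xl e k) (P.relInter x e k) - CVar.slackInter x e k
  eqn
    | (i, r) => fun x =>
        (P.agent i).aTight r ⬝ᵥ (P.agent i).mean (CVar.ctrl x i) - (P.agent i).bTight r
  soc₁
    | Sum.inl (i, r) =>
        { top := fun x =>
            (P.agent i).bLin r - (P.agent i).aLin r ⬝ᵥ (P.agent i).mean (CVar.ctrl x i)
          body := fun z x => (P.agent i).dev ((P.agent i).aLin r) (CVar.ctrl x i) z }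
    | Sum.inr (Sum.inl (i, r)) =>
        { top := fun _ => (P.agent i).ε r
          body := fun z x => (P.agent i).dev ((P.agent i).aTight r) (CVar.ctrl x i) z }
    | Sum.inr (Sum.inr (i, k, r)) =>
        { top := fun x => CVar.dev x i k r
          body := fun z x => (P.agent i).dev ((P.agent i).posRow k r) (CVar.ctrl x i) z }
  soc₂
    | Sum.inl (i, k, o) =>
        { top := fun x => CVar.slackObs x i k o - (P.agent i).cObs o
          body := fun r x => CVar.dev x i k r }
    | Sum.inr (e, k) =>
        { top := fun x => CVar.slackInter x e k - P.cInter e.1 e.2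
          body := fun r x => CVar.dev x e.1 k r + CVar.dev x e.2 k r }

/-- `x` satisfies the equality constraints, and strictly all inequality constraints of the
multi-agent problem with the reformulated (not linearized) constraints. -/
structure Problem.CentralInterior (P : Problem d nbr) (x : CVar nbr → ℝ) : Prop where
  obs : ∀ i k o, CVar.slackObs x i k o < nrm (P.relObs x i k o)
  inter : ∀ e k, CVar.slackInter x e k < nrm (P.relInter x e k)
  eqn : ∀ e, (P.central x).eqn e x = 0
  soc₁ : ∀ b, ((P.central x).soc₁ b).Interior x
  soc₂ : ∀ b, ((P.central x).soc₂ b).Interior x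

/-- What the centralized solver is given: the problem, a schedule of barrier parameters, and a
strictly feasible point. -/
structure CentralInstance (d : Dims) (nbr : Fin d.N → Finset (Fin d.N)) where
  prob : Problem d nbr
  valid : prob.Valid
  t : ℕ → ℝ
  t_pos : ∀ j, 0 < t j
  start : CVar nbr → ℝ
  start_interior : prob.CentralInterior start

/-- The point reached after a number of outer loops, in each of which the nonconvex constraints are
linearized at the previous solution and `LIP` interior-point iterations are made. -/
def CentralInstance.solve (s : CentralInstance d nbr) (LIP : ℕ) : ℕ → CVar nbr → ℝ
  | 0 => s.start
  | l + 1 => (s.prob.central (solve s LIP l)).ipm s.t (solve s LIP l) LIP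

/-- The numbers that the centralized solver is given. -/
def centralInputs (d : Dims) (nbr : Fin d.N → Finset (Fin d.N)) :
    Set (CentralInstance d nbr → ℝ) :=
  {f | ∃ i, ∃ g ∈ Agent.coefficients d, f = fun s => g (s.prob.agent i)}
  ∪ Set.range (fun (e : Edge nbr) s => s.prob.cInter e.1 e.2)
  ∪ Set.range (fun (j : ℕ) s => s.t j)
  ∪ Set.range (fun (v : CVar nbr) s => s.start v)

/-- The output of the centralized solver. -/
def centralOutputs (d : Dims) (nbr : Fin d.N → Finset (Fin d.N)) (LLin LIP : ℕ) :
    Set (CentralInstance d nbr → ℝ) :=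
  Set.range (fun (v : CVar nbr) s => s.solve LIP LLin v)

end Central

/-! ### The distributed algorithm -/

section Distributed

variable {nbr : Fin d.N → Finset (Fin d.N)}

/-- Local variables of an agent with neighbors `nb`: its control parameters, its deviation bounds
`μ_d`, the slack variables of its obstacle and inter-agent constraints, and its copies of the
mean positions and of the deviation bounds of its neighbors. -/
abbrev LVar (nb : Finset (Fin d.N)) : Type :=
  d.Ctrl ⊕ (d.Time × Fin d.m) ⊕ (d.Time × Fin d.nobs) ⊕ (nb × d.Time)
    ⊕ (nb × d.Time × Fin d.m) ⊕ (nb × d.Time × Fin d.m)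

namespace LVar

variable {nb : Finset (Fin d.N)}

def ctrl (x : LVar nb → ℝ) : d.Ctrl → ℝ := fun c => x (Sum.inl c)

def dev (x : LVar nb → ℝ) (k : d.Time) : Fin d.m → ℝ := fun r => x (Sum.inr (Sum.inl (k, r)))

def slackObs (x : LVar nb → ℝ) (k : d.Time) (o : Fin d.nobs) : ℝ :=
  x (Sum.inr (Sum.inr (Sum.inl (k, o))))

def slackInter (x : LVar nb → ℝ) (j : nb) (k : d.Time) : ℝ :=
  x (Sum.inr (Sum.inr (Sum.inr (Sum.inl (j, k)))))

def copyPos (x : LVar nb → ℝ) (j : nb) (k : d.Time) : Fin d.m → ℝ :=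
  fun r => x (Sum.inr (Sum.inr (Sum.inr (Sum.inr (Sum.inl (j, k, r))))))

def copyDev (x : LVar nb → ℝ) (j : nb) (k : d.Time) : Fin d.m → ℝ :=
  fun r => x (Sum.inr (Sum.inr (Sum.inr (Sum.inr (Sum.inr (j, k, r))))))

/-- `[own mean positions; copies of those of the neighbors]`, the own ones at index `none`. -/
def sharedPos (a : Agent d) (x : LVar nb → ℝ) : Option nb → d.Time → Fin d.m → ℝ
  | none => a.pos (ctrl x)
  | some j => copyPos x j

/-- `[own deviation bounds; copies of those of the neighbors]`, the own ones at index `none`. -/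
def sharedDev (x : LVar nb → ℝ) : Option nb → d.Time → Fin d.m → ℝ
  | none => dev x
  | some j => copyDev x j

end LVar

/-- A linear plus a quadratic penalty term of the augmented Lagrangian. -/
def penalty {I : Type} [Fintype I] (ρ : ℝ) (dual μ ν : I → d.Time → Fin d.m → ℝ) : ℝ :=
  ∑ j, ∑ k, ∑ r, (dual j k r * (μ j k r - ν j k r) + ρ / 2 * (μ j k r - ν j k r) ^ 2)

/-- The local subproblem of an agent `a` with neighbors `nb` and safety distances `cI`; dual
variables `dualU`, `dualD`, global variables `νU`, `νD`, nonconvex constraints linearized at `xl`. -/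
def Agent.local (a : Agent d) (nb : Finset (Fin d.N)) (cI : nb → ℝ) (ρU ρD : ℝ)
    (dualU dualD νU νD : Option nb → d.Time → Fin d.m → ℝ) (xl : LVar nb → ℝ) :
    ConicProgram (LVar nb) ((d.Time × Fin d.nobs) ⊕ (nb × d.Time)) (Fin d.ntight)
      (Fin d.nlin ⊕ Fin d.ntight ⊕ (d.Time × Fin d.m)) d.Zeta
      ((d.Time × Fin d.nobs) ⊕ (nb × d.Time)) (Fin d.m) where
  obj x := a.cost (LVar.ctrl x) + penalty ρU dualU (LVar.sharedPos a x) νU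
    + penalty ρD dualD (LVar.sharedDev x) νD
  lin
    | Sum.inl (k, o) => fun x =>
        linNrm (a.pos (LVar.ctrl xl) k - a.center o) (a.pos (LVar.ctrl x) k - a.center o)
          - LVar.slackObs x k o
    | Sum.inr (j, k) => fun x =>
        linNrm (a.pos (LVar.ctrl xl) k - LVar.copyPos xl j k)
          (a.pos (LVar.ctrl x) k - LVar.copyPos x j k) - LVar.slackInter x j k
  eqn r := fun x => a.aTight r ⬝ᵥ a.mean (LVar.ctrl x) - a.bTight r
  soc₁
    | Sum.inl r =>
        { top := fun x => a.bLin r - a.aLin r ⬝ᵥ a.mean (LVar.ctrl x)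
          body := fun z x => a.dev (a.aLin r) (LVar.ctrl x) z }
    | Sum.inr (Sum.inl r) =>
        { top := fun _ => a.ε r
          body := fun z x => a.dev (a.aTight r) (LVar.ctrl x) z }
    | Sum.inr (Sum.inr (k, r)) =>
        { top := fun x => LVar.dev x k r
          body := fun z x => a.dev (a.posRow k r) (LVar.ctrl x) z }
  soc₂
    | Sum.inl (k, o) =>
        { top := fun x => LVar.slackObs x k o - a.cObs o
          body := fun r x => LVar.dev x k r }
    | Sum.inr (j, k) =>
        { top := fun x => LVar.slackInter x j k - cI j
          body := fun r x => LVar.dev x k r + LVar.copyDev x j k r }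

/-- `x` satisfies the local equality constraints, and strictly all local (not linearized)
inequality constraints. -/
structure Agent.LocalInterior (a : Agent d) (nb : Finset (Fin d.N)) (cI : nb → ℝ)
    (x : LVar nb → ℝ) : Prop where
  obs : ∀ k o, LVar.slackObs x k o < nrm (a.pos (LVar.ctrl x) k - a.center o)
  inter : ∀ j k, LVar.slackInter x j k < nrm (a.pos (LVar.ctrl x) k - LVar.copyPos x j k)
  eqn : ∀ r, (a.local nb cI 1 1 0 0 0 0 x).eqn r x = 0
  soc₁ : ∀ b, ((a.local nb cI 1 1 0 0 0 0 x).soc₁ b).Interior x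
  soc₂ : ∀ b, ((a.local nb cI 1 1 0 0 0 0 x).soc₂ b).Interior x

/-- The ADMM variables: local variables, global variables and dual variables. -/
structure AdmmState (nbr : Fin d.N → Finset (Fin d.N)) where
  x : (i : Fin d.N) → LVar (nbr i) → ℝ
  νU : Fin d.N → d.Time → Fin d.m → ℝ
  νD : Fin d.N → d.Time → Fin d.m → ℝ
  dualU : (i : Fin d.N) → Option (nbr i) → d.Time → Fin d.m → ℝ
  dualD : (i : Fin d.N) → Option (nbr i) → d.Time → Fin d.m → ℝ

/-- The global variables of agent `i` followed by those of its neighbors. -/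
def gather (i : Fin d.N) (ν : Fin d.N → d.Time → Fin d.m → ℝ) :
    Option (nbr i) → d.Time → Fin d.m → ℝ
  | none => ν i
  | some j => ν j

/-- The agents that have `i` as a neighbor. -/
abbrev Pre (nbr : Fin d.N → Finset (Fin d.N)) (i : Fin d.N) : Type := {j : Fin d.N // i ∈ nbr j}

/-- The minimizing global variable of agent `i`, from its own and the received local variables `μ`
and dual variables. -/
def average (ρ : ℝ) (i : Fin d.N)
    (dual μ : (j : Fin d.N) → Option (nbr j) → d.Time → Fin d.m → ℝ) (k : d.Time) (r : Fin d.m) :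
    ℝ :=
  (dual i none k r / ρ + μ i none k r
    + ∑ j : Pre nbr i, (dual j (some ⟨i, j.2⟩) k r / ρ + μ j (some ⟨i, j.2⟩) k r))
  / (Fintype.card (Pre nbr i) + 1)

/-- What the distributed algorithm is given: the problem, the penalty parameters, a schedule of
barrier parameters, and initial values with strictly feasible local variables. -/
structure AdmmInstance (d : Dims) (nbr : Fin d.N → Finset (Fin d.N)) where
  prob : Problem d nbr
  valid : prob.Valid
  ρU : ℝ
  ρD : ℝ
  ρU_pos : 0 < ρU
  ρD_pos : 0 < ρD
  t : ℕ → ℝ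
  t_pos : ∀ j, 0 < t j
  start : AdmmState nbr
  start_interior : ∀ i, (prob.agent i).LocalInterior (nbr i) (prob.cInter i) (start.x i)

namespace AdmmInstance

/-- Local update: `LIP` interior-point iterations on the local subproblem of each agent, with the
nonconvex constraints linearized at the previous iterate. -/
def localUpdate (s : AdmmInstance d nbr) (LIP : ℕ) (y : AdmmState nbr) (i : Fin d.N) :
    LVar (nbr i) → ℝ :=
  ((s.prob.agent i).local (nbr i) (s.prob.cInter i) s.ρU s.ρD (y.dualU i) (y.dualD i)
    (gather i y.νU) (gather i y.νD) (y.x i)).ipm s.t (y.x i) LIP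

def globalUpdateU (s : AdmmInstance d nbr) (y : AdmmState nbr)
    (x : (i : Fin d.N) → LVar (nbr i) → ℝ) (i : Fin d.N) : d.Time → Fin d.m → ℝ :=
  average s.ρU i y.dualU (fun j => LVar.sharedPos (s.prob.agent j) (x j))

def globalUpdateD (s : AdmmInstance d nbr) (y : AdmmState nbr)
    (x : (i : Fin d.N) → LVar (nbr i) → ℝ) (i : Fin d.N) : d.Time → Fin d.m → ℝ :=
  average s.ρD i y.dualD (fun j => LVar.sharedDev (x j))

/-- One ADMM iteration. -/
def next (s : AdmmInstance d nbr) (LIP : ℕ) (y : AdmmState nbr) : AdmmState nbr where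
  x := s.localUpdate LIP y
  νU := s.globalUpdateU y (s.localUpdate LIP y)
  νD := s.globalUpdateD y (s.localUpdate LIP y)
  dualU i j k r := y.dualU i j k r
    + s.ρU * (LVar.sharedPos (s.prob.agent i) (s.localUpdate LIP y i) j k r
      - gather i (s.globalUpdateU y (s.localUpdate LIP y)) j k r)
  dualD i j k r := y.dualD i j k r
    + s.ρD * (LVar.sharedDev (s.localUpdate LIP y i) j k r
      - gather i (s.globalUpdateD y (s.localUpdate LIP y)) j k r)

/-- The ADMM variables after a number of iterations. -/
def run (s : AdmmInstance d nbr) (LIP : ℕ) : ℕ → AdmmState nbr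
  | 0 => s.start
  | l + 1 => s.next LIP (run s LIP l)

end AdmmInstance

/-- Constants known to agent `i`. -/
def agentConstants (nbr : Fin d.N → Finset (Fin d.N)) (i : Fin d.N) :
    Set (AdmmInstance d nbr → ℝ) :=
  {f | ∃ g ∈ Agent.coefficients d, f = fun s => g (s.prob.agent i)}
  ∪ Set.range (fun (j : nbr i) s => s.prob.cInter i j)
  ∪ Set.range (fun (j : ℕ) s => s.t j)
  ∪ {fun s => s.ρU, fun s => s.ρD}

/-- The local variables of agent `i` after `l` iterations. -/
def localVars (nbr : Fin d.N → Finset (Fin d.N)) (LIP l : ℕ) (i : Fin d.N) :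
    Set (AdmmInstance d nbr → ℝ) :=
  Set.range (fun (v : LVar (nbr i)) s => (s.run LIP l).x i v)

/-- The global variables of agent `i` after `l` iterations. -/
def globalVars (nbr : Fin d.N → Finset (Fin d.N)) (LIP l : ℕ) (i : Fin d.N) :
    Set (AdmmInstance d nbr → ℝ) :=
  Set.range (fun (q : d.Time × Fin d.m) s => (s.run LIP l).νU i q.1 q.2)
  ∪ Set.range (fun (q : d.Time × Fin d.m) s => (s.run LIP l).νD i q.1 q.2)

/-- The dual variables of agent `i` after `l` iterations. -/
def dualVars (nbr : Fin d.N → Finset (Fin d.N)) (LIP l : ℕ) (i : Fin d.N) :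
    Set (AdmmInstance d nbr → ℝ) :=
  Set.range (fun (q : Option (nbr i) × d.Time × Fin d.m) s =>
    (s.run LIP l).dualU i q.1 q.2.1 q.2.2)
  ∪ Set.range (fun (q : Option (nbr i) × d.Time × Fin d.m) s =>
    (s.run LIP l).dualD i q.1 q.2.1 q.2.2)

/-- The global variables of agent `i` and those that it receives from its neighbors. -/
def gatheredVars (nbr : Fin d.N → Finset (Fin d.N)) (LIP l : ℕ) (i : Fin d.N) :
    Set (AdmmInstance d nbr → ℝ) :=
  globalVars nbr LIP l i ∪ ⋃ j : nbr i, globalVars nbr LIP l j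

/-- In iteration `l + 1`: what agent `i` receives from the agents that have it as a neighbor, namely
their new copies of the variables of `i` and the corresponding dual variables. -/
def receivedCopies (nbr : Fin d.N → Finset (Fin d.N)) (LIP l : ℕ) (i : Fin d.N) :
    Set (AdmmInstance d nbr → ℝ) :=
  Set.range (fun (q : Pre nbr i × d.Time × Fin d.m) s =>
    LVar.copyPos ((s.run LIP (l + 1)).x q.1) ⟨i, q.1.2⟩ q.2.1 q.2.2)
  ∪ Set.range (fun (q : Pre nbr i × d.Time × Fin d.m) s =>
    LVar.copyDev ((s.run LIP (l + 1)).x q.1) ⟨i, q.1.2⟩ q.2.1 q.2.2)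
  ∪ Set.range (fun (q : Pre nbr i × d.Time × Fin d.m) s =>
    (s.run LIP l).dualU q.1 (some ⟨i, q.1.2⟩) q.2.1 q.2.2)
  ∪ Set.range (fun (q : Pre nbr i × d.Time × Fin d.m) s =>
    (s.run LIP l).dualD q.1 (some ⟨i, q.1.2⟩) q.2.1 q.2.2)

/-- In each of the first `LADMM` iterations, each agent, working in parallel with the others and with
the information it holds or has received, needs at most `k₁`, `k₂` and `k₃` operations for its local,
global and dual update; the total is `LADMM * (k₁ + k₂ + k₃)`. -/
def DistributedCost (nbr : Fin d.N → Finset (Fin d.N)) (LADMM LIP total : ℕ) : Prop :=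
  ∃ k₁ k₂ k₃ : ℕ, total = LADMM * (k₁ + k₂ + k₃) ∧ ∀ l < LADMM, ∀ i : Fin d.N,
    (∃ k ≤ k₁, Computes
      (agentConstants nbr i ∪ localVars nbr LIP l i ∪ dualVars nbr LIP l i
        ∪ gatheredVars nbr LIP l i) k (localVars nbr LIP (l + 1) i)) ∧
    (∃ k ≤ k₂, Computes
      (agentConstants nbr i ∪ localVars nbr LIP (l + 1) i ∪ dualVars nbr LIP l i
        ∪ receivedCopies nbr LIP l i) k (globalVars nbr LIP (l + 1) i)) ∧
    (∃ k ≤ k₃, Computes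
      (agentConstants nbr i ∪ localVars nbr LIP (l + 1) i ∪ dualVars nbr LIP l i
        ∪ gatheredVars nbr LIP (l + 1) i) k (dualVars nbr LIP (l + 1) i))

end Distributed

end

end RobustMAS

set_option linter.unusedSectionVars false

/-! One Newton step in n variables whose barrier Hessian has r rank-one terms can be made with
O(n²(r+1)) operations, and this is what produces the exponents. For one agent n is of order
`varBound` = T γ n_u n_x (n_inter + n_obs), and r is of order `rankBound` = T² n_d (n_inter +
n_obs). The product n²r is then T⁴ (n_inter + n_obs)³ n_u² n_x² n_d γ². For the joint problem both n
and r gain a factor N, hence N³; a local subproblem involves no N.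

Factoring the Newton matrix would cost n³, which is not within the bound, since γ n_u n_x may exceed
T n_d. Instead, the inverse of the Hessian of the cost, which is part of the given data, is carried
along by Sherman-Morrison updates of O(n²) operations each. The start is the scaled cost Hessian
with an identity block on the variables that are not control parameters. The positive rank-one terms
of the barrier and of the penalties are added; then the negative ones and the auxiliary identity are
removed. Equality constraints are incorporated one at a time by the same formula with reciprocal
weight 0. The lemmas are `inv_add_rankOne`, `IsKKTSolver.insert`, `kktSolver_of_program`,
`newtonStep_cheap`.

A straight-line program may divide, or take a root, only where this is legitimate on every instance,
so most of the work is to show that nothing degenerates. (a) Every intermediate matrix is positive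
definite: while adding, this is clear; while removing, each partial sum is the final Hessian plus
terms still to be removed (`symPos_posMat_add`). (b) The Hessian is positive definite at strictly
feasible points (`SOC.localForm_nonneg`, `Regular.hess_symPos`). (c) Iterates stay strictly
feasible: the damped step has local norm δ/(1+δ) < 1, so it remains in the Dikin ellipsoid
(`Regular.interior_newtonStep`). (d) Relinearization preserves feasibility, because the norm is
convex and lies above its linearization (`linNrm_le`); the linearization points are nonzero because
the slacks exceed safety distances c ≥ 0.

What remains is to count variables and rank-one terms (`card_localVar_le`, `localRank_le` and the
centralized analogues). The averaging and dual updates of ADMM cost only O(`varBound`²), which one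
interior-point iteration absorbs. -/

namespace RobustMAS

/-! ### Calculus of straight-line programs and their costs -/

section Programs

variable {D : Type}

/-- The constant functions of the instance. -/
abbrev consts (D : Type) : Set (D → ℝ) := Set.range (Function.const D)

theorem OneOp.of_subset {S S' : Set (D → ℝ)} {f : D → ℝ} (h : OneOp S f)
    (hS : S ⊆ S' ∪ consts D) : OneOp S' f := by
  have key : ∀ g, g ∈ S ∪ Set.range (Function.const D) →
      g ∈ S' ∪ Set.range (Function.const D) := by
    rintro g (hg | hg)
    · exact hS hg
    · exact Or.inr hg
  cases h with
  | add f g hf hg => exact .add f g (key _ hf) (key _ hg)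
  | sub f g hf hg => exact .sub f g (key _ hf) (key _ hg)
  | mul f g hf hg => exact .mul f g (key _ hf) (key _ hg)
  | div f g hf hg h0 => exact .div f g (key _ hf) (key _ hg) h0
  | sqrt f hf h0 => exact .sqrt f (key _ hf) h0

/-- Inputs are compared modulo constants because a program without operations may output constants;
`Computes.append` needs this in its base case. -/
theorem Computes.of_subset {S S' F : Set (D → ℝ)} {k : ℕ} (h : Computes S k F)
    (hS : S ⊆ S' ∪ consts D) : Computes S' k F := by
  induction h generalizing S' with
  | done h =>
    refine .done fun g hg => ?_
    rcases h hg with hg | hg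
    · exact hS hg
    · exact Or.inr hg
  | step hf _ ih =>
    refine .step (hf.of_subset hS) (ih ?_)
    rintro g (rfl | hg)
    · exact Or.inl (Set.mem_insert _ _)
    · rcases hS hg with hg | hg
      · exact Or.inl (Set.mem_insert_of_mem _ hg)
      · exact Or.inr hg

theorem Computes.anti {S F G : Set (D → ℝ)} {k : ℕ} (h : Computes S k F) (hG : G ⊆ F) :
    Computes S k G := by
  induction h with
  | done h => exact .done (hG.trans h)
  | step hf _ ih => exact .step hf (ih hG)

theorem Computes.union_inputs {S F G : Set (D → ℝ)} {k : ℕ} (h : Computes S k G)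
    (hF : F ⊆ S ∪ consts D) : Computes S k (F ∪ G) := by
  induction h with
  | done h => exact .done (Set.union_subset hF h)
  | step hf _ ih =>
    refine .step hf (ih (hF.trans ?_))
    exact Set.union_subset_union_left _ (Set.subset_insert _ _)

/-- A program never forgets, so the second program may read the results of the first. This is the
only source of sharing: costs add along stored stages instead of multiplying through nested
expressions. -/
theorem Computes.append {S F G : Set (D → ℝ)} {k l : ℕ} (h : Computes S k F)
    (h' : Computes (S ∪ F) l G) : Computes S (k + l) (F ∪ G) := by
  induction h with
  | @done S F h =>
    rw [Nat.zero_add]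
    refine Computes.union_inputs (h'.of_subset ?_) h
    exact Set.union_subset Set.subset_union_left h
  | @step S F k f hf _ ih =>
    rw [Nat.add_right_comm]
    refine .step hf (ih (h'.of_subset ?_))
    refine Set.Subset.trans ?_ Set.subset_union_left
    exact Set.union_subset_union_left _ (Set.subset_insert _ _)

/-- `F` can be computed from `S` with at most `k` operations. -/
def Cheap (S : Set (D → ℝ)) (k : ℕ) (F : Set (D → ℝ)) : Prop := ∃ k' ≤ k, Computes S k' F

/-- `f` can be computed from `S` with at most `k` operations. -/
def Cost (S : Set (D → ℝ)) (k : ℕ) (f : D → ℝ) : Prop := Cheap S k {f}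

namespace Cheap

variable {S S' F G : Set (D → ℝ)} {k l : ℕ}

theorem mono (h : Cheap S k F) (hk : k ≤ l) : Cheap S l F :=
  let ⟨k', hk', h'⟩ := h
  ⟨k', hk'.trans hk, h'⟩

theorem of_subset (h : Cheap S k F) (hS : S ⊆ S') : Cheap S' k F :=
  let ⟨k', hk', h'⟩ := h
  ⟨k', hk', h'.of_subset (hS.trans Set.subset_union_left)⟩

theorem anti (h : Cheap S k F) (hG : G ⊆ F) : Cheap S k G :=
  let ⟨k', hk', h'⟩ := h
  ⟨k', hk', h'.anti hG⟩

theorem append (h : Cheap S k F) (h' : Cheap (S ∪ F) l G) : Cheap S (k + l) (F ∪ G) :=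
  let ⟨k', hk', c⟩ := h
  let ⟨l', hl', c'⟩ := h'
  ⟨k' + l', Nat.add_le_add hk' hl', c.append c'⟩

theorem trans (h : Cheap S k F) (h' : Cheap (S ∪ F) l G) : Cheap S (k + l) G :=
  (h.append h').anti Set.subset_union_right

theorem union (h : Cheap S k F) (h' : Cheap S l G) : Cheap S (k + l) (F ∪ G) :=
  h.append (h'.of_subset Set.subset_union_left)

theorem of_inputs (h : F ⊆ S) : Cheap S k F :=
  ⟨0, Nat.zero_le _, .done (h.trans Set.subset_union_left)⟩

theorem range {ι : Type} [Fintype ι] {f : ι → D → ℝ} (h : ∀ i, Cost S k (f i)) :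
    Cheap S (Fintype.card ι * k) (Set.range f) := by
  classical
  have key : ∀ K : Finset ι, Cheap S (K.card * k) (f '' K) := by
    intro K
    induction K using Finset.induction_on with
    | empty => exact of_inputs (by simp)
    | insert a K ha ih =>
      rw [Finset.card_insert_of_notMem ha, Finset.coe_insert, Set.image_insert_eq,
        Nat.succ_mul, Nat.add_comm]
      exact (h a).union ih
  simpa using key Finset.univ

end Cheap

namespace Cost

variable {S S' : Set (D → ℝ)} {k l : ℕ} {f g : D → ℝ}

theorem mono (h : Cost S k f) (hk : k ≤ l) : Cost S l f := Cheap.mono h hk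

theorem of_subset (h : Cost S k f) (hS : S ⊆ S') : Cost S' k f := Cheap.of_subset h hS

theorem of_mem (h : f ∈ S) : Cost S k f := Cheap.of_inputs (Set.singleton_subset_iff.2 h)

theorem const (c : ℝ) : Cost S k (fun _ : D => c) :=
  ⟨0, Nat.zero_le _, .done (Set.singleton_subset_iff.2 (Or.inr ⟨c, rfl⟩))⟩

theorem one_op {F : Set (D → ℝ)} (hF : Cheap S k F) (hf : OneOp F f) : Cost S (k + 1) f := by
  refine Cheap.trans hF ⟨1, le_rfl, .step (hf.of_subset ?_) (.done ?_)⟩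
  · exact Set.subset_union_right.trans Set.subset_union_left
  · exact Set.singleton_subset_iff.2 (Or.inl (Set.mem_insert _ _))

theorem add (hf : Cost S k f) (hg : Cost S l g) : Cost S (k + l + 1) (fun s => f s + g s) :=
  one_op (Cheap.union hf hg) (.add f g (by simp) (by simp))

theorem sub (hf : Cost S k f) (hg : Cost S l g) : Cost S (k + l + 1) (fun s => f s - g s) :=
  one_op (Cheap.union hf hg) (.sub f g (by simp) (by simp))

theorem mul (hf : Cost S k f) (hg : Cost S l g) : Cost S (k + l + 1) (fun s => f s * g s) :=
  one_op (Cheap.union hf hg) (.mul f g (by simp) (by simp))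

theorem div (hf : Cost S k f) (hg : Cost S l g) (h0 : ∀ s, g s ≠ 0) :
    Cost S (k + l + 1) (fun s => f s / g s) :=
  one_op (Cheap.union hf hg) (.div f g (by simp) (by simp) h0)

theorem sqrt (hf : Cost S k f) (h0 : ∀ s, 0 ≤ f s) : Cost S (k + 1) (fun s => √(f s)) :=
  one_op hf (.sqrt f (by simp) h0)

theorem neg (hf : Cost S k f) : Cost S (k + 1) (fun s => -f s) := by
  have := ((const 0 : Cost S 0 _).sub hf)
  simpa using this

/-- The base is computed once and used twice, so the cost is not the `2 * k + 1` that `mul` would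
give. -/
theorem sq (hf : Cost S k f) : Cost S (k + 1) (fun s => f s ^ 2) := by
  have : Cost S (k + 1) (fun s => f s * f s) := one_op hf (.mul f f (by simp) (by simp))
  simpa [pow_two] using this

theorem sum {ι : Type} [Fintype ι] {f : ι → D → ℝ} (h : ∀ i, Cost S k (f i)) :
    Cost S (Fintype.card ι * (k + 1)) (fun s => ∑ i, f i s) := by
  classical
  have key : ∀ K : Finset ι, Cost S (K.card * (k + 1)) (fun s => ∑ i ∈ K, f i s) := by
    intro K
    induction K using Finset.induction_on with
    | empty => simpa using const (S := S) 0
    | insert a K ha ih =>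
      simp only [Finset.sum_insert ha, Finset.card_insert_of_notMem ha]
      exact ((h a).add ih).mono (by ring_nf; omega)
  simpa using key Finset.univ

theorem dot {ι : Type} [Fintype ι] {f g : ι → D → ℝ} (hf : ∀ i, Cost S k (f i))
    (hg : ∀ i, Cost S l (g i)) :
    Cost S (Fintype.card ι * (k + l + 2)) (fun s => ∑ i, f i s * g i s) :=
  sum fun i => (hf i).mul (hg i)

theorem congr (h : Cost S k f) (hfg : ∀ s, g s = f s) : Cost S k g := by
  have : g = f := funext hfg
  rwa [this]

end Cost

end Programs

/-! ### Sherman-Morrison updates and the solution of the Newton system -/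

section LinearAlgebra

open Matrix

variable {V E : Type} [Fintype V] [DecidableEq V] [Fintype E] [DecidableEq E]

/-- A real symmetric positive definite matrix. -/
def SymPos (H : Matrix V V ℝ) : Prop := H.IsSymm ∧ ∀ x, x ≠ 0 → 0 < x ⬝ᵥ H *ᵥ x

theorem SymPos.eq_zero {H : Matrix V V ℝ} (h : SymPos H) {x : V → ℝ} (hx : x ⬝ᵥ H *ᵥ x = 0) :
    x = 0 := by
  by_contra hne
  exact (h.2 x hne).ne' hx

theorem SymPos.nonneg {H : Matrix V V ℝ} (h : SymPos H) (x : V → ℝ) : 0 ≤ x ⬝ᵥ H *ᵥ x := by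
  by_cases hx : x = 0
  · simp [hx]
  · exact (h.2 x hx).le

theorem SymPos.isUnit_det {H : Matrix V V ℝ} (h : SymPos H) : IsUnit H.det := by
  rw [isUnit_iff_ne_zero]
  intro h0
  obtain ⟨v, hv, hHv⟩ := Matrix.exists_mulVec_eq_zero_iff.2 h0
  exact hv (h.eq_zero (by simp [hHv]))

theorem dotProduct_vecMulVec_mulVec (a x : V → ℝ) :
    x ⬝ᵥ vecMulVec a a *ᵥ x = (a ⬝ᵥ x) ^ 2 := by
  rw [vecMulVec_mulVec, dotProduct_comm x]
  simp [pow_two]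

theorem SymPos.add_sum {ι : Type} {H : Matrix V V ℝ} (h : SymPos H) (K : Finset ι)
    (c : ι → ℝ) (hc : ∀ i ∈ K, 0 ≤ c i) (a : ι → V → ℝ) :
    SymPos (H + ∑ i ∈ K, c i • vecMulVec (a i) (a i)) := by
  constructor
  · rw [Matrix.IsSymm, Matrix.transpose_add, h.1, Matrix.transpose_sum]
    simp [Matrix.transpose_vecMulVec]
  · intro x hx
    rw [Matrix.add_mulVec, dotProduct_add, Matrix.sum_mulVec, dotProduct_sum]
    refine add_pos_of_pos_of_nonneg (h.2 x hx) (Finset.sum_nonneg fun i hi => ?_)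
    rw [Matrix.smul_mulVec, dotProduct_smul, dotProduct_vecMulVec_mulVec]
    exact mul_nonneg (hc i hi) (sq_nonneg _)

/-- The Sherman-Morrison formula for a symmetric rank-one update. -/
theorem inv_add_rankOne {H : Matrix V V ℝ} (hs : H.IsSymm) (hu : IsUnit H.det) {e : ℝ}
    (he : e ≠ 0) (a : V → ℝ) (hu' : IsUnit (H + e⁻¹ • vecMulVec a a).det) :
    e + a ⬝ᵥ H⁻¹ *ᵥ a ≠ 0 ∧ (H + e⁻¹ • vecMulVec a a)⁻¹ =
      H⁻¹ - (e + a ⬝ᵥ H⁻¹ *ᵥ a)⁻¹ • vecMulVec (H⁻¹ *ᵥ a) (H⁻¹ *ᵥ a) := by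
  set w := H⁻¹ *ᵥ a with hw
  have hHw : H *ᵥ w = a := by rw [hw, mulVec_mulVec, mul_nonsing_inv _ hu, one_mulVec]
  -- If the denominator vanished, `w` would lie in the kernel of the updated matrix, hence be zero,
  -- and then `e = 0`. So invertibility before and after the update is what makes the division
  -- legitimate. Using the reciprocal weight `e` keeps the formula meaningful at `e = 0`, the case
  -- of an equality constraint.
  have hne : e + a ⬝ᵥ w ≠ 0 := by
    intro h0
    have h1 : (H + e⁻¹ • vecMulVec a a) *ᵥ w = 0 := by
      rw [add_mulVec, smul_mulVec, vecMulVec_mulVec, hHw]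
      ext v
      have : e⁻¹ * (a ⬝ᵥ w) = -1 := by
        rw [show a ⬝ᵥ w = -e by linarith]
        field_simp
      simp only [Pi.add_apply, Pi.smul_apply, smul_eq_mul, Pi.zero_apply, MulOpposite.smul_eq_mul_unop,
        MulOpposite.unop_op]
      linear_combination a v * this
    have h2 : w = 0 := by
      have := congrArg (fun z => (H + e⁻¹ • vecMulVec a a)⁻¹ *ᵥ z) h1
      simpa [mulVec_mulVec, nonsing_inv_mul _ hu'] using this
    rw [h2, dotProduct_zero, add_zero] at h0
    exact he h0
  refine ⟨hne, Matrix.inv_eq_right_inv ?_⟩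
  have hsym : a ᵥ* H⁻¹ = w := by
    rw [← mulVec_transpose, transpose_nonsing_inv, hs.eq]
  rw [Matrix.mul_sub, Matrix.add_mul, Matrix.add_mul, mul_nonsing_inv _ hu, Matrix.mul_smul,
    Matrix.mul_smul, Matrix.smul_mul, Matrix.smul_mul, mul_vecMulVec, vecMulVec_mul, hsym, hHw,
    vecMulVec_mul_vecMulVec]
  ext u v
  simp only [Matrix.sub_apply, Matrix.add_apply, Matrix.smul_apply, smul_eq_mul, vecMulVec_apply]
  have : ∀ α : ℝ, e + α ≠ 0 → e⁻¹ - (e + α)⁻¹ - (e + α)⁻¹ * e⁻¹ * α = 0 := by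
    intro α hα
    field_simp
    ring
  simp only [Pi.smul_apply, smul_eq_mul]
  linear_combination a u * w v * this _ hne

/-- `M` solves the Newton system with Hessian `H` and the rows `e ∈ K` of `A` as equality
constraints. -/
structure IsKKTSolver (H : Matrix V V ℝ) (A : Matrix E V ℝ) (K : Finset E) (M : Matrix V V ℝ) :
    Prop where
  symm : M.IsSymm
  ker : ∀ e ∈ K, M *ᵥ A e = 0
  res : ∀ v, ∃ y : E → ℝ, (∀ e, e ∉ K → y e = 0) ∧ H *ᵥ (M *ᵥ v) = v + y ᵥ* A

theorem IsKKTSolver.empty {H : Matrix V V ℝ} (h : SymPos H) (A : Matrix E V ℝ) :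
    IsKKTSolver H A ∅ H⁻¹ where
  symm := by rw [Matrix.IsSymm, transpose_nonsing_inv, h.1.eq]
  ker := by simp
  res v := ⟨0, by simp, by
    rw [mulVec_mulVec, mul_nonsing_inv _ h.isUnit_det, one_mulVec, zero_vecMul, add_zero]⟩

theorem IsKKTSolver.dot_ker {H : Matrix V V ℝ} {A : Matrix E V ℝ} {K : Finset E}
    {M : Matrix V V ℝ} (hM : IsKKTSolver H A K M) {e : E} (he : e ∈ K) (v : V → ℝ) :
    A e ⬝ᵥ M *ᵥ v = 0 := by
  rw [dotProduct_mulVec, ← mulVec_transpose, hM.symm.eq, hM.ker e he, zero_dotProduct]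

/-- An equality constraint acts as a rank-one term of infinite weight, so the update is
Sherman-Morrison with `e = 0`. If the denominator vanished, `w = M a` would satisfy wᵀHw = 0, since
the residual of `w` is a combination of old rows, which are orthogonal to the range of `M`. Then `w
= 0` would make the new row a combination of the old ones. -/
theorem IsKKTSolver.insert {H : Matrix V V ℝ} (h : SymPos H) {A : Matrix E V ℝ}
    (hA : LinearIndependent ℝ (fun e => A e)) {K : Finset E} {M : Matrix V V ℝ}
    (hM : IsKKTSolver H A K M) {e₀ : E} (he : e₀ ∉ K) :
    A e₀ ⬝ᵥ M *ᵥ A e₀ ≠ 0 ∧ IsKKTSolver H A (insert e₀ K)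
      (M - (A e₀ ⬝ᵥ M *ᵥ A e₀)⁻¹ • vecMulVec (M *ᵥ A e₀) (M *ᵥ A e₀)) := by
  set w := M *ᵥ A e₀ with hw
  obtain ⟨y₀, hy₀, hr₀⟩ := hM.res (A e₀)
  rw [← hw] at hr₀
  have hvec : ∀ y : E → ℝ, y ᵥ* A = ∑ e, y e • A e := fun y => by
    ext v; simp [vecMul, dotProduct]
  have hne : A e₀ ⬝ᵥ w ≠ 0 := by
    intro h0
    have hw0 : w = 0 := by
      refine h.eq_zero ?_
      rw [hr₀, dotProduct_add, dotProduct_comm w, h0, zero_add, hvec, dotProduct_sum]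
      refine Finset.sum_eq_zero fun e _ => ?_
      by_cases heK : e ∈ K
      · rw [dotProduct_smul, dotProduct_comm, hw, hM.dot_ker heK, smul_zero]
      · simp [hy₀ e heK]
    rw [hw0, mulVec_zero, hvec] at hr₀
    have hz : ∑ e, (y₀ e + if e = e₀ then 1 else 0) • A e = 0 := by
      have h1 : ∀ e, (y₀ e + if e = e₀ then 1 else 0) • A e
          = y₀ e • A e + if e = e₀ then A e₀ else 0 := by
        intro e
        split_ifs with hee
        · rw [add_smul, one_smul, hee]
        · simp
      rw [Finset.sum_congr rfl fun e _ => h1 e, Finset.sum_add_distrib, Finset.sum_ite_eq',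
        if_pos (Finset.mem_univ _), add_comm]
      exact hr₀.symm
    have := Fintype.linearIndependent_iff.1 hA _ hz e₀
    simp [hy₀ e₀ he] at this
  have hmv : ∀ v, (M - (A e₀ ⬝ᵥ w)⁻¹ • vecMulVec w w) *ᵥ v
      = M *ᵥ v - ((A e₀ ⬝ᵥ w)⁻¹ * (w ⬝ᵥ v)) • w := by
    intro v
    rw [sub_mulVec, smul_mulVec, vecMulVec_mulVec]
    ext i
    simp only [Pi.sub_apply, Pi.smul_apply, smul_eq_mul, MulOpposite.smul_eq_mul_unop,
      MulOpposite.unop_op]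
    ring
  refine ⟨hne, ?_, ?_, ?_⟩
  · rw [Matrix.IsSymm, transpose_sub, transpose_smul, transpose_vecMulVec, hM.symm.eq]
  · intro e heK
    rw [hmv]
    rcases Finset.mem_insert.1 heK with rfl | heK
    · rw [dotProduct_comm w, inv_mul_cancel₀ hne, one_smul, ← hw, sub_self]
    · rw [hM.ker e heK, dotProduct_comm w, hw, hM.dot_ker heK]
      simp
  · intro v
    obtain ⟨y, hy, hr⟩ := hM.res v
    set c := (A e₀ ⬝ᵥ w)⁻¹ * (w ⬝ᵥ v)
    -- The new solution is `M v - c w` and `H w = a + y₀ A`, where `a` is the row of `e₀`; so the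
    -- multipliers of `v` change by `c` times those of `w`, and the new row gets the multiplier
    -- `-c`.
    refine ⟨y - c • y₀ - c • Pi.single e₀ 1, ?_, ?_⟩
    · intro e heK
      rw [Finset.mem_insert, not_or] at heK
      simp [hy e heK.2, hy₀ e heK.2, heK.1]
    · rw [hmv, mulVec_sub, mulVec_smul, hr, hr₀, sub_vecMul, sub_vecMul, smul_vecMul, smul_vecMul,
        single_one_vecMul]
      ext i
      simp only [Pi.add_apply, Pi.sub_apply, Pi.smul_apply, smul_eq_mul, row_apply]
      ring

/-- A solver for all equality constraints gives the solution of the KKT system. -/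
theorem IsKKTSolver.kkt_inv {H : Matrix V V ℝ} (h : SymPos H) {A : Matrix E V ℝ}
    (hA : LinearIndependent ℝ (fun e => A e)) {M : Matrix V V ℝ}
    (hM : IsKKTSolver H A Finset.univ M) (g : V → ℝ) (v : V) :
    ((fromBlocks H Aᵀ A 0)⁻¹ *ᵥ Sum.elim (fun u => -g u) (fun _ : E => 0)) (Sum.inl v)
      = -(M *ᵥ g) v := by
  have hvec : ∀ y : E → ℝ, y ᵥ* A = ∑ e, y e • A e := fun y => by
    ext v; simp [vecMul, dotProduct]
  -- For a kernel vector `(d, y)`, pairing the first block with `d` gives dᵀHd = 0; then `d = 0`,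
  -- and `y A = 0` forces `y = 0` by independence.
  have hdet : IsUnit (fromBlocks H Aᵀ A (0 : Matrix E E ℝ)).det := by
    rw [isUnit_iff_ne_zero]
    intro h0
    obtain ⟨z, hz, hz0⟩ := Matrix.exists_mulVec_eq_zero_iff.2 h0
    obtain ⟨d, y, rfl⟩ : ∃ d y, z = Sum.elim d y := ⟨_, _, (Sum.elim_comp_inl_inr z).symm⟩
    rw [fromBlocks_mulVec] at hz0
    have h1 : H *ᵥ d + y ᵥ* A = 0 := by
      have := congrArg (fun z => z ∘ Sum.inl) hz0
      simpa [mulVec_transpose] using this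
    have h2 : A *ᵥ d = 0 := by
      have := congrArg (fun z => z ∘ Sum.inr) hz0
      simpa using this
    have hd : d = 0 := by
      refine h.eq_zero ?_
      have := congrArg (fun z => d ⬝ᵥ z) h1
      simpa [dotProduct_add, dotProduct_comm d (y ᵥ* A), ← dotProduct_mulVec, h2] using this
    have hy : y = 0 := by
      rw [hd, mulVec_zero, zero_add, hvec] at h1
      exact funext (Fintype.linearIndependent_iff.1 hA _ h1)
    exact hz (by rw [hd, hy]; ext (i | i) <;> rfl)
  obtain ⟨y, -, hr⟩ := hM.res (-g)
  have key : fromBlocks H Aᵀ A (0 : Matrix E E ℝ) *ᵥ Sum.elim (M *ᵥ (-g)) (-y)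
      = Sum.elim (fun u => -g u) (fun _ : E => 0) := by
    rw [fromBlocks_mulVec]
    ext (i | i)
    · simp [hr, mulVec_transpose, neg_vecMul]
    · have := hM.dot_ker (Finset.mem_univ i) (-g)
      have h2 : (A *ᵥ (M *ᵥ (-g))) i = 0 := this
      simp only [Sum.elim_inr, Sum.elim_comp_inl, Sum.elim_comp_inr, zero_mulVec,
        add_zero, h2]
  rw [← key, mulVec_mulVec, nonsing_inv_mul _ hdet, one_mulVec]
  simp [mulVec_neg]

/-- The residual of `M g` lies in the span of the constraint rows, which is orthogonal to the range
of `M`. This identifies the two expressions for the Newton decrement. -/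
theorem IsKKTSolver.dot_mulVec {H : Matrix V V ℝ} {A : Matrix E V ℝ}
    {K : Finset E} {M : Matrix V V ℝ} (hM : IsKKTSolver H A K M) (g : V → ℝ) :
    (M *ᵥ g) ⬝ᵥ H *ᵥ (M *ᵥ g) = g ⬝ᵥ M *ᵥ g := by
  obtain ⟨y, hy, hr⟩ := hM.res g
  have hvec : y ᵥ* A = ∑ e, y e • A e := by
    ext v; simp [vecMul, dotProduct]
  rw [hr, dotProduct_add, hvec, dotProduct_sum, Finset.sum_eq_zero, add_zero, dotProduct_comm]
  intro e _
  by_cases he : e ∈ K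
  · rw [dotProduct_smul, dotProduct_comm, hM.dot_ker he, smul_zero]
  · simp [hy e he]

theorem exists_isKKTSolver {H : Matrix V V ℝ} (h : SymPos H) {A : Matrix E V ℝ}
    (hA : LinearIndependent ℝ (fun e => A e)) (K : Finset E) : ∃ M, IsKKTSolver H A K M := by
  induction K using Finset.induction_on with
  | empty => exact ⟨_, .empty h A⟩
  | insert e K he ih =>
    obtain ⟨M, hM⟩ := ih
    exact ⟨_, (hM.insert h hA he).2⟩

end LinearAlgebra

/-! ### Affine functions -/

section Affine

variable {V : Type} [Fintype V] [DecidableEq V]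

/-- `f` is an affine function. -/
def IsAff (f : (V → ℝ) → ℝ) : Prop := ∃ (c : ℝ) (a : V → ℝ), ∀ x, f x = c + ∑ v, a v * x v

/-- The linear part of an affine function. -/
noncomputable def linPart (f : (V → ℝ) → ℝ) (w : V → ℝ) : ℝ := ∑ v, slope f v * w v

namespace IsAff

variable {f g : (V → ℝ) → ℝ}

theorem eval (h : IsAff f) (x : V → ℝ) : f x = f 0 + linPart f x := by
  obtain ⟨c, a, h⟩ := h
  have hs : ∀ v, slope f v = a v := by
    intro v
    simp [slope, h, Pi.single_apply]
  simp only [linPart, hs]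
  rw [h, h]
  simp

theorem add_smul (h : IsAff f) (x w : V → ℝ) (s : ℝ) :
    f (x + s • w) = f x + s * linPart f w := by
  rw [h.eval, h.eval x]
  simp only [linPart, Pi.add_apply, Pi.smul_apply, smul_eq_mul, mul_add, Finset.sum_add_distrib,
    Finset.mul_sum]
  rw [add_assoc]
  congr 2
  exact Finset.sum_congr rfl fun _ _ => by ring

theorem add_vec (h : IsAff f) (x w : V → ℝ) : f (x + w) = f x + linPart f w := by
  simpa using h.add_smul x w 1

theorem const (c : ℝ) : IsAff (fun _ : V → ℝ => c) := ⟨c, 0, by simp⟩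

theorem coord (v : V) : IsAff (fun x : V → ℝ => x v) := ⟨0, Pi.single v 1, by simp [Pi.single_apply]⟩

theorem add (hf : IsAff f) (hg : IsAff g) : IsAff (fun x => f x + g x) := by
  obtain ⟨c, a, h⟩ := hf
  obtain ⟨c', a', h'⟩ := hg
  refine ⟨c + c', a + a', fun x => ?_⟩
  simp only [h, h', Pi.add_apply, add_mul, Finset.sum_add_distrib]
  ring

theorem const_mul (hf : IsAff f) (r : ℝ) : IsAff (fun x => r * f x) := by
  obtain ⟨c, a, h⟩ := hf
  refine ⟨r * c, r • a, fun x => ?_⟩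
  simp only [h, Pi.smul_apply, smul_eq_mul, mul_add, Finset.mul_sum, mul_assoc]

theorem mul_const (hf : IsAff f) (r : ℝ) : IsAff (fun x => f x * r) := by
  simpa [mul_comm] using hf.const_mul r

theorem div_const (hf : IsAff f) (r : ℝ) : IsAff (fun x => f x / r) := by
  simpa [div_eq_mul_inv] using hf.mul_const r⁻¹

theorem sub (hf : IsAff f) (hg : IsAff g) : IsAff (fun x => f x - g x) := by
  simpa [sub_eq_add_neg] using hf.add (hg.const_mul (-1))

theorem sum {ι : Type} (K : Finset ι) {f : ι → (V → ℝ) → ℝ} (h : ∀ i ∈ K, IsAff (f i)) :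
    IsAff (fun x => ∑ i ∈ K, f i x) := by
  classical
  induction K using Finset.induction_on with
  | empty => simpa using const (V := V) 0
  | insert a K ha ih =>
    simp only [Finset.sum_insert ha]
    exact (h a (Finset.mem_insert_self _ _)).add
      (ih fun i hi => h i (Finset.mem_insert_of_mem hi))

theorem comp {W : Type} [Fintype W] [DecidableEq W] (hf : IsAff f)
    {L : (W → ℝ) → V → ℝ} (hL : ∀ v, IsAff (fun x => L x v)) : IsAff (fun x => f (L x)) := by
  obtain ⟨c, a, h⟩ := hf
  simp only [h]
  exact (const c).add (sum _ fun v _ => (hL v).const_mul (a v))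

end IsAff

end Affine

/-! ### The barrier of a second-order cone constraint -/

section Cone

open Matrix

variable {V R : Type} [Fintype V] [DecidableEq V] [Fintype R]

namespace SOC

/-- The data of a second-order cone constraint are affine. -/
structure Aff (c : SOC V R) : Prop where
  top : IsAff c.top
  body : ∀ r, IsAff (c.body r)

/-- The quadratic form of the Hessian of the barrier. -/
noncomputable def localForm (c : SOC V R) (x w : V → ℝ) : ℝ :=
  4 / c.gap x ^ 2 * (c.top x * linPart c.top w - ∑ r, c.body r x * linPart (c.body r) w) ^ 2
    + 2 / c.gap x * (∑ r, linPart (c.body r) w ^ 2 - linPart c.top w ^ 2)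

theorem halfGrad_dot (c : SOC V R) (x w : V → ℝ) :
    c.halfGrad x ⬝ᵥ w = c.top x * linPart c.top w - ∑ r, c.body r x * linPart (c.body r) w := by
  simp only [dotProduct, halfGrad, linPart, sub_mul, Finset.sum_sub_distrib, Finset.mul_sum,
    Finset.sum_mul]
  rw [Finset.sum_comm]
  simp only [mul_assoc]

theorem hess_eq (c : SOC V R) (x : V → ℝ) : c.hess x =
    (4 / c.gap x ^ 2) • vecMulVec (c.halfGrad x) (c.halfGrad x)
      + (2 / c.gap x) • (∑ r, vecMulVec (slope (c.body r)) (slope (c.body r))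
        - vecMulVec (slope c.top) (slope c.top)) := by
  ext u v
  simp [hess, Matrix.sum_apply, vecMulVec_apply]

theorem dot_hess (c : SOC V R) (x w : V → ℝ) : w ⬝ᵥ c.hess x *ᵥ w = c.localForm x w := by
  have h : ∀ f : (V → ℝ) → ℝ, slope f ⬝ᵥ w = linPart f w := fun f => rfl
  simp only [hess_eq, add_mulVec, smul_mulVec, sub_mulVec, sum_mulVec, dotProduct_add,
    dotProduct_smul, dotProduct_sub, dotProduct_sum, dotProduct_vecMulVec_mulVec, halfGrad_dot, h,
    smul_eq_mul, localForm]

theorem hess_symm (c : SOC V R) (x : V → ℝ) : (c.hess x).IsSymm := by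
  ext u v
  simp only [hess, transpose_apply]
  congr 2
  · ring
  · simp only [mul_comm]

/-- Convexity of the barrier made explicit: `g² / 2` times the form, multiplied by `τ² + B`,
dominates a square plus `g² β`. The excess is exactly `2 g (B β - s²)`, which is nonnegative by
Cauchy-Schwarz. The vanishing case is needed for the definiteness of the full Hessian. -/
theorem localForm_nonneg {c : SOC V R} {x : V → ℝ} (hx : c.Interior x) (w : V → ℝ) :
    0 ≤ c.localForm x w ∧
      (c.localForm x w = 0 → linPart c.top w = 0 ∧ ∀ r, linPart (c.body r) w = 0) := by
  obtain ⟨hτ, hg⟩ := hx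
  unfold localForm
  set τ := c.top x
  set t := linPart c.top w
  set s := ∑ r, c.body r x * linPart (c.body r) w
  set g := c.gap x with hgdef
  have hB : g = τ ^ 2 - ∑ r, c.body r x ^ 2 := rfl
  set B := ∑ r, c.body r x ^ 2
  set β := ∑ r, linPart (c.body r) w ^ 2 with hβ
  have hcs : s ^ 2 ≤ B * β := Finset.sum_mul_sq_le_sq_mul_sq _ _ _
  have hβ0 : 0 ≤ β := Finset.sum_nonneg fun _ _ => sq_nonneg _
  have hB0 : 0 ≤ B := Finset.sum_nonneg fun _ _ => sq_nonneg _
  have hP : 0 < τ ^ 2 + B := by positivity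
  have hmul : g ^ 2 / 2 * (4 / g ^ 2 * (τ * t - s) ^ 2 + 2 / g * (β - t ^ 2))
      = 2 * (τ * t - s) ^ 2 + g * (β - t ^ 2) := by
    field_simp
    ring
  have hkey : ((τ ^ 2 + B) * t - 2 * τ * s) ^ 2 + g ^ 2 * β
      ≤ (τ ^ 2 + B) * (2 * (τ * t - s) ^ 2 + g * (β - t ^ 2)) := by
    have h1 : 0 ≤ g * (B * β - s ^ 2) := mul_nonneg hg.le (by linarith)
    rw [hB] at h1 ⊢
    nlinarith [h1]
  have hlow : 0 ≤ ((τ ^ 2 + B) * t - 2 * τ * s) ^ 2 + g ^ 2 * β := by positivity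
  constructor
  · have h2 : 0 ≤ 2 * (τ * t - s) ^ 2 + g * (β - t ^ 2) :=
      nonneg_of_mul_nonneg_right (hlow.trans hkey) hP
    rw [← hmul] at h2
    exact nonneg_of_mul_nonneg_right h2 (by positivity)
  · intro h0
    rw [h0, mul_zero] at hmul
    rw [← hmul, mul_zero] at hkey
    have hβz : β = 0 := by
      have : g ^ 2 * β ≤ 0 := by nlinarith [sq_nonneg ((τ ^ 2 + B) * t - 2 * τ * s)]
      have h3 : 0 < g ^ 2 := by positivity
      nlinarith
    have hb : ∀ r, linPart (c.body r) w = 0 := by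
      intro r
      have := (Finset.sum_eq_zero_iff_of_nonneg fun _ _ => sq_nonneg _).1 hβz r (Finset.mem_univ r)
      simpa using this
    refine ⟨?_, hb⟩
    have hs : s = 0 := by simp [s, hb]
    rw [hs, hβz] at hkey
    have h4 : ((τ ^ 2 + B) * t) ^ 2 = 0 := le_antisymm (by linarith) (sq_nonneg _)
    have h5 : (τ ^ 2 + B) * t = 0 := by simpa using h4
    exact (mul_eq_zero.1 h5).resolve_left hP.ne'

/-- The Dikin ellipsoid lies in the cone. The gap stays positive along the whole segment from `x` to
`x + w`, so `top` cannot vanish there and keeps its sign. -/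
theorem interior_add {c : SOC V R} (hc : c.Aff) {x w : V → ℝ} (hx : c.Interior x)
    (hw : c.localForm x w < 1) : c.Interior (x + w) := by
  have hgap : ∀ σ : ℝ, 0 ≤ σ → σ ≤ 1 → 0 < c.gap (x + σ • w) := by
    intro σ h0 h1
    have hg := hx.2
    have e : c.gap (x + σ • w) = c.gap x
        + 2 * σ * (c.top x * linPart c.top w - ∑ r, c.body r x * linPart (c.body r) w)
        + σ ^ 2 * (linPart c.top w ^ 2 - ∑ r, linPart (c.body r) w ^ 2) := by
      simp only [gap, hc.top.add_smul, (hc.body _).add_smul, add_sq, Finset.sum_add_distrib]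
      have e1 : ∑ r, 2 * c.body r x * (σ * linPart (c.body r) w)
          = 2 * σ * ∑ r, c.body r x * linPart (c.body r) w := by
        rw [Finset.mul_sum]; exact Finset.sum_congr rfl fun _ _ => by ring
      have e2 : ∑ r, (σ * linPart (c.body r) w) ^ 2 = σ ^ 2 * ∑ r, linPart (c.body r) w ^ 2 := by
        rw [Finset.mul_sum]; exact Finset.sum_congr rfl fun _ _ => by ring
      rw [e1, e2]; ring
    rw [e]
    unfold localForm at hw
    set g := c.gap x
    set a := c.top x * linPart c.top w - ∑ r, c.body r x * linPart (c.body r) w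
    set b := linPart c.top w ^ 2 - ∑ r, linPart (c.body r) w ^ 2 with hb
    rw [show ∑ r, linPart (c.body r) w ^ 2 - linPart c.top w ^ 2 = -b by rw [hb]; ring] at hw
    have hw' : 4 * a ^ 2 - 2 * g * b < g ^ 2 := by
      have := mul_lt_mul_of_pos_left hw (show 0 < g ^ 2 by positivity)
      have e3 : g ^ 2 * (4 / g ^ 2 * a ^ 2 + 2 / g * -b) = 4 * a ^ 2 - 2 * g * b := by
        field_simp; ring
      linarith
    -- This expression equals `g² + (g + 2σa)² - σ² (4a² - 2gb)`, and the last bracket is below `g²`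
    -- by `hw'`.
    have h2 : 0 < 2 * g * (g + 2 * σ * a + σ ^ 2 * b) := by
      rcases h0.eq_or_lt with rfl | hpos
      · nlinarith [mul_pos hg hg]
      · have h3 : σ ^ 2 * (4 * a ^ 2 - 2 * g * b) < σ ^ 2 * g ^ 2 :=
          mul_lt_mul_of_pos_left hw' (by positivity)
        have h4 : σ ^ 2 * g ^ 2 ≤ g ^ 2 := by
          have : σ ^ 2 ≤ 1 := by nlinarith
          nlinarith [sq_nonneg g]
        nlinarith [sq_nonneg (g + 2 * σ * a)]
    exact pos_of_mul_pos_right h2 (by positivity)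
  have hne : ∀ σ : ℝ, 0 ≤ σ → σ ≤ 1 → c.top (x + σ • w) ≠ 0 := by
    intro σ h0 h1 hz
    have := hgap σ h0 h1
    rw [gap, hz] at this
    have h2 : 0 ≤ ∑ r, c.body r (x + σ • w) ^ 2 := Finset.sum_nonneg fun _ _ => sq_nonneg _
    nlinarith
  refine ⟨?_, by simpa using hgap 1 zero_le_one le_rfl⟩
  by_contra hneg
  rw [not_lt, hc.top.add_vec] at hneg
  have ht : linPart c.top w < 0 := by linarith [hx.1]
  -- The parameter at which the affine function `top` would reach zero on the segment.
  refine hne (c.top x / -linPart c.top w) (div_nonneg hx.1.le (by linarith)) ?_ ?_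
  · rw [div_le_one (by linarith)]; linarith
  · rw [hc.top.add_smul]
    have := ht.ne
    have e1 : c.top x / -linPart c.top w * linPart c.top w = -c.top x := by
      field_simp
    rw [e1, add_neg_cancel]

end SOC

end Cone

/-! ### Definiteness of the barrier Hessian and invariance of the interior -/

section Program

open Matrix

variable {X Y L E B₁ R₁ B₂ R₂ J : Type} [Fintype X] [DecidableEq X] [Fintype Y] [DecidableEq Y]
  [Fintype L] [Fintype E] [DecidableEq E] [Fintype B₁] [Fintype R₁] [Fintype B₂] [Fintype R₂]
  [Fintype J]

namespace ConicProgram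

/-- Strict satisfaction of the inequality constraints. -/
structure Interior (P : ConicProgram (X ⊕ Y) L E B₁ R₁ B₂ R₂) (x : X ⊕ Y → ℝ) : Prop where
  lin : ∀ l, 0 < P.lin l x
  soc₁ : ∀ b, (P.soc₁ b).Interior x
  soc₂ : ∀ b, (P.soc₂ b).Interior x

/-- A program whose objective has the gradient
`Q x + ∑ j, (α j + w j * ⟨p j, x⟩) p j`, whose constraints are affine, with independent equality
constraints, and whose barrier Hessian is definite. -/
structure Regular (P : ConicProgram (X ⊕ Y) L E B₁ R₁ B₂ R₂) (Q : Matrix X X ℝ)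
    (α w : J → ℝ) (p : J → X ⊕ Y → ℝ) : Prop where
  lin_aff : ∀ l, IsAff (P.lin l)
  soc₁_aff : ∀ b, (P.soc₁ b).Aff
  soc₂_aff : ∀ b, (P.soc₂ b).Aff
  Q_pos : SymPos Q
  w_pos : ∀ j, 0 < w j
  obj_grad : ∀ x v, quadGrad P.obj x v =
    Sum.elim (fun i => ∑ u, Q i u * x (Sum.inl u)) (fun _ => 0) v
      + ∑ j, (α j + w j * ∑ u, p j u * x u) * p j v
  obj_hess : quadHess P.obj = fromBlocks Q 0 0 0 + ∑ j, w j • vecMulVec (p j) (p j)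
  -- The terms named here already determine every variable: the cost and the penalties, the linear
  -- constraints, and the tops of the first cone family. The second family is not needed.
  definite : ∀ z : X ⊕ Y → ℝ, (∀ i, z (Sum.inl i) = 0) → (∀ j, p j ⬝ᵥ z = 0) →
    (∀ l, P.lin l z = P.lin l 0) → (∀ b, (P.soc₁ b).top z = (P.soc₁ b).top 0) → z = 0
  eq_indep : LinearIndependent ℝ (fun e => P.eqMat e)

variable {P : ConicProgram (X ⊕ Y) L E B₁ R₁ B₂ R₂} {Q : Matrix X X ℝ} {α w : J → ℝ}
  {p : J → X ⊕ Y → ℝ}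

theorem hess_eq (P : ConicProgram (X ⊕ Y) L E B₁ R₁ B₂ R₂) (t : ℝ) (x : X ⊕ Y → ℝ) :
    P.hess t x = t • quadHess P.obj
      + ∑ l, (P.lin l x ^ 2)⁻¹ • vecMulVec (slope (P.lin l)) (slope (P.lin l))
      + ∑ b, (P.soc₁ b).hess x + ∑ b, (P.soc₂ b).hess x := by
  ext u v
  simp [hess, Matrix.sum_apply, vecMulVec_apply, div_eq_inv_mul]

theorem dot_hess (P : ConicProgram (X ⊕ Y) L E B₁ R₁ B₂ R₂) (t : ℝ) (x z : X ⊕ Y → ℝ) :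
    z ⬝ᵥ P.hess t x *ᵥ z = t * (z ⬝ᵥ quadHess P.obj *ᵥ z)
      + ∑ l, (P.lin l x ^ 2)⁻¹ * linPart (P.lin l) z ^ 2
      + ∑ b, (P.soc₁ b).localForm x z + ∑ b, (P.soc₂ b).localForm x z := by
  have h : ∀ f : (X ⊕ Y → ℝ) → ℝ, slope f ⬝ᵥ z = linPart f z := fun f => rfl
  simp only [hess_eq, add_mulVec, smul_mulVec, sum_mulVec, dotProduct_add,
    dotProduct_smul, dotProduct_sum, dotProduct_vecMulVec_mulVec, h, SOC.dot_hess,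
    smul_eq_mul]

theorem Regular.dot_quadHess (h : P.Regular Q α w p) (z : X ⊕ Y → ℝ) :
    z ⬝ᵥ quadHess P.obj *ᵥ z
      = (z ∘ Sum.inl) ⬝ᵥ Q *ᵥ (z ∘ Sum.inl) + ∑ j, w j * (p j ⬝ᵥ z) ^ 2 := by
  obtain ⟨a, b, rfl⟩ : ∃ a b, z = Sum.elim a b := ⟨_, _, (Sum.elim_comp_inl_inr z).symm⟩
  rw [h.obj_hess, add_mulVec, dotProduct_add, sum_mulVec, dotProduct_sum, fromBlocks_mulVec]
  simp only [smul_mulVec, dotProduct_smul, dotProduct_vecMulVec_mulVec, smul_eq_mul]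
  simp

theorem Regular.terms_nonneg (h : P.Regular Q α w p) {t : ℝ} (ht : 0 < t) {x : X ⊕ Y → ℝ}
    (hx : P.Interior x) (z : X ⊕ Y → ℝ) :
    0 ≤ t * (z ⬝ᵥ quadHess P.obj *ᵥ z) ∧
      0 ≤ ∑ l, (P.lin l x ^ 2)⁻¹ * linPart (P.lin l) z ^ 2 ∧
      0 ≤ ∑ b, (P.soc₁ b).localForm x z ∧ 0 ≤ ∑ b, (P.soc₂ b).localForm x z := by
  refine ⟨mul_nonneg ht.le ?_, Finset.sum_nonneg fun l _ => by positivity,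
    Finset.sum_nonneg fun b _ => (SOC.localForm_nonneg (hx.soc₁ b) z).1,
    Finset.sum_nonneg fun b _ => (SOC.localForm_nonneg (hx.soc₂ b) z).1⟩
  rw [h.dot_quadHess]
  exact add_nonneg (h.Q_pos.nonneg _)
    (Finset.sum_nonneg fun j _ => mul_nonneg (h.w_pos j).le (sq_nonneg _))

/-- The quadratic form is a sum of nonnegative terms, so if it vanishes then each term does, and
`definite` applies. -/
theorem Regular.hess_symPos (h : P.Regular Q α w p) {t : ℝ} (ht : 0 < t) {x : X ⊕ Y → ℝ}
    (hx : P.Interior x) : SymPos (P.hess t x) := by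
  constructor
  · rw [hess_eq]
    refine ((IsSymm.add ?_ ?_).add ?_).add ?_
    · refine IsSymm.smul ?_ t
      ext u v
      simp only [quadHess, transpose_apply]
      rw [add_comm (Pi.single v 1 : X ⊕ Y → ℝ)]
      ring
    · simp [Matrix.IsSymm, transpose_sum, transpose_vecMulVec]
    · rw [Matrix.IsSymm, transpose_sum]
      exact Finset.sum_congr rfl fun b _ => (P.soc₁ b).hess_symm x
    · rw [Matrix.IsSymm, transpose_sum]
      exact Finset.sum_congr rfl fun b _ => (P.soc₂ b).hess_symm x
  · intro z hz
    obtain ⟨h1, h2, h3, h4⟩ := h.terms_nonneg ht hx z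
    rw [dot_hess]
    refine lt_of_le_of_ne (by linarith) fun h0 => hz ?_
    have e1 : z ⬝ᵥ quadHess P.obj *ᵥ z = 0 :=
      (mul_eq_zero.1 (by linarith : t * (z ⬝ᵥ quadHess P.obj *ᵥ z) = 0)).resolve_left ht.ne'
    have e2 : ∑ l, (P.lin l x ^ 2)⁻¹ * linPart (P.lin l) z ^ 2 = 0 := by linarith
    have e3 : ∑ b, (P.soc₁ b).localForm x z = 0 := by linarith
    rw [h.dot_quadHess] at e1
    have n1 := h.Q_pos.nonneg (z ∘ Sum.inl)
    have n2 : 0 ≤ ∑ j, w j * (p j ⬝ᵥ z) ^ 2 :=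
      Finset.sum_nonneg fun j _ => mul_nonneg (h.w_pos j).le (sq_nonneg _)
    refine h.definite z ?_ ?_ ?_ ?_
    · exact fun i => congrFun (h.Q_pos.eq_zero (by linarith)) i
    · intro j
      have := (Finset.sum_eq_zero_iff_of_nonneg fun j _ =>
        mul_nonneg (h.w_pos j).le (sq_nonneg _)).1 (by linarith : ∑ j, w j * (p j ⬝ᵥ z) ^ 2 = 0)
        j (Finset.mem_univ j)
      simpa [(h.w_pos j).ne'] using this
    · intro l
      have := (Finset.sum_eq_zero_iff_of_nonneg fun l _ => by positivity).1 e2 l (Finset.mem_univ l)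
      rw [(h.lin_aff l).eval z]
      simpa [(hx.lin l).ne'] using this
    · intro b
      have := (Finset.sum_eq_zero_iff_of_nonneg fun b _ =>
        (SOC.localForm_nonneg (hx.soc₁ b) z).1).1 e3 b (Finset.mem_univ b)
      rw [(h.soc₁_aff b).top.eval z, ((SOC.localForm_nonneg (hx.soc₁ b) z).2 this).1, add_zero]

/-- A step of local norm less than one preserves strict feasibility. -/
theorem Regular.interior_add (h : P.Regular Q α w p) {t : ℝ} (ht : 0 < t) {x : X ⊕ Y → ℝ}
    (hx : P.Interior x) {z : X ⊕ Y → ℝ} (hz : z ⬝ᵥ P.hess t x *ᵥ z < 1) :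
    P.Interior (x + z) := by
  obtain ⟨h1, h2, h3, h4⟩ := h.terms_nonneg ht hx z
  rw [dot_hess] at hz
  constructor
  · intro l
    -- Each summand is bounded by the whole form, so it is below one: the constraint changes by less
    -- than its current value.
    have := Finset.single_le_sum (f := fun l => (P.lin l x ^ 2)⁻¹ * linPart (P.lin l) z ^ 2)
      (fun l _ => by positivity) (Finset.mem_univ l)
    have hlt : (P.lin l x ^ 2)⁻¹ * linPart (P.lin l) z ^ 2 < 1 := by linarith
    have hl := hx.lin l
    rw [inv_mul_lt_iff₀ (by positivity), mul_one] at hlt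
    rw [(h.lin_aff l).add_vec]
    have := (abs_lt_of_sq_lt_sq hlt hl.le)
    linarith [(abs_lt.1 this).1]
  · intro b
    refine SOC.interior_add (h.soc₁_aff b) (hx.soc₁ b) ?_
    have := Finset.single_le_sum (f := fun b => (P.soc₁ b).localForm x z)
      (fun b _ => (SOC.localForm_nonneg (hx.soc₁ b) z).1) (Finset.mem_univ b)
    linarith
  · intro b
    refine SOC.interior_add (h.soc₂_aff b) (hx.soc₂ b) ?_
    have := Finset.single_le_sum (f := fun b => (P.soc₂ b).localForm x z)
      (fun b _ => (SOC.localForm_nonneg (hx.soc₂ b) z).1) (Finset.mem_univ b)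
    linarith

theorem newtonDir_eq {t : ℝ} {x : X ⊕ Y → ℝ} (hH : SymPos (P.hess t x))
    (hA : LinearIndependent ℝ (fun e => P.eqMat e)) {M : Matrix (X ⊕ Y) (X ⊕ Y) ℝ}
    (hM : IsKKTSolver (P.hess t x) P.eqMat Finset.univ M) :
    P.newtonDir t x = -(M *ᵥ P.grad t x) :=
  funext fun v => hM.kkt_inv hH hA _ v

/-- It shows that the number under the square root is nonnegative, and that the root is the local
norm of the direction. -/
theorem newton_decrement {t : ℝ} {x : X ⊕ Y → ℝ} (hH : SymPos (P.hess t x))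
    (hA : LinearIndependent ℝ (fun e => P.eqMat e)) :
    P.newtonDir t x ⬝ᵥ P.hess t x *ᵥ P.newtonDir t x
      = -(P.grad t x ⬝ᵥ P.newtonDir t x) := by
  obtain ⟨M, hM⟩ := exists_isKKTSolver hH hA Finset.univ
  rw [newtonDir_eq hH hA hM, mulVec_neg, neg_dotProduct_neg, dotProduct_neg, neg_neg,
    hM.dot_mulVec]

theorem decrement_nonneg {t : ℝ} {x : X ⊕ Y → ℝ} (hH : SymPos (P.hess t x))
    (hA : LinearIndependent ℝ (fun e => P.eqMat e)) :
    0 ≤ -(P.grad t x ⬝ᵥ P.newtonDir t x) := by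
  rw [← newton_decrement hH hA]
  exact hH.nonneg _

/-- The damped step has local norm δ/(1+δ) < 1 whatever the size of δ; no line search and no
closeness to the central path is needed. -/
theorem Regular.interior_newtonStep (h : P.Regular Q α w p) {t : ℝ} (ht : 0 < t)
    {x : X ⊕ Y → ℝ} (hx : P.Interior x) : P.Interior (P.newtonStep t x) := by
  have hH := h.hess_symPos ht hx
  set δ := √(-(P.grad t x ⬝ᵥ P.newtonDir t x)) with hδ
  have h0 : 0 ≤ δ := Real.sqrt_nonneg _
  have hstep : P.newtonStep t x = x + (1 + δ)⁻¹ • P.newtonDir t x := by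
    ext v
    simp [newtonStep, div_eq_inv_mul, hδ]
  rw [hstep]
  refine h.interior_add ht hx ?_
  rw [mulVec_smul, smul_dotProduct, dotProduct_smul, newton_decrement hH h.eq_indep,
    ← Real.sq_sqrt (decrement_nonneg hH h.eq_indep), ← hδ, smul_eq_mul, smul_eq_mul]
  have : (1 + δ)⁻¹ * ((1 + δ)⁻¹ * δ ^ 2) = (δ / (1 + δ)) ^ 2 := by
    field_simp
  rw [this, sq_lt_one_iff₀ (by positivity), div_lt_one (by positivity)]
  linarith

theorem Regular.interior_ipm (h : P.Regular Q α w p) {t : ℕ → ℝ} (ht : ∀ j, 0 < t j)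
    {x : X ⊕ Y → ℝ} (hx : P.Interior x) (j : ℕ) : P.Interior (P.ipm t x j) := by
  induction j with
  | zero => exact hx
  | succ j ih => exact h.interior_newtonStep (ht j) ih

end ConicProgram

end Program

/-! ### Storing intermediate families -/

section Stages

variable {D : Type} {S S' F G : Set (D → ℝ)} {k l : ℕ}

theorem Cost.of_range {ι : Type} {f : ι → D → ℝ} (h : Set.range f ⊆ S) (i : ι) :
    Cost S k (f i) := Cost.of_mem (h ⟨i, rfl⟩)

/-- Compute and store a finite family, then go on. -/
theorem Cheap.stage {ι : Type} [Fintype ι] {f : ι → D → ℝ} (h : ∀ i, Cost S k (f i))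
    (next : ∀ S', S ⊆ S' → (∀ i, Cost S' 0 (f i)) → Cheap S' l G) :
    Cheap S (Fintype.card ι * k + l) G :=
  (Cheap.range h).trans (next _ Set.subset_union_left
    fun i => Cost.of_range Set.subset_union_right i)

/-- The entries of a matrix that depends on the instance. -/
def entries {V W : Type} (M : D → Matrix V W ℝ) : Set (D → ℝ) :=
  Set.range fun (q : V × W) s => M s q.1 q.2

theorem Cheap.of_entries {V W : Type} [Fintype V] [Fintype W] {M : D → Matrix V W ℝ}
    (h : ∀ u v, Cost S k (fun s => M s u v)) :
    Cheap S (Fintype.card V * Fintype.card W * k) (entries M) := by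
  rw [← Fintype.card_prod]
  exact Cheap.range fun q => h q.1 q.2

theorem Cost.of_entries {V W : Type} {M : D → Matrix V W ℝ} (h : entries M ⊆ S) (u : V) (v : W) :
    Cost S k (fun s => M s u v) := Cost.of_mem (h ⟨(u, v), rfl⟩)

end Stages

/-! ### Coefficient tables of affine functions -/

section Tables

variable {D V : Type} [Fintype V] [DecidableEq V] {S S' : Set (D → ℝ)} {k l : ℕ}

/-- The coefficients of the affine function `f` can be computed with `k` operations each. -/
structure Tab (S : Set (D → ℝ)) (k : ℕ) (f : D → (V → ℝ) → ℝ) : Prop where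
  aff : ∀ s, IsAff (f s)
  slope : ∀ v, Cost S k (fun s => slope (f s) v)
  const : Cost S k (fun s => f s 0)

namespace Tab

variable {f g : D → (V → ℝ) → ℝ}

theorem of_subset (h : Tab S k f) (hS : S ⊆ S') : Tab S' k f :=
  ⟨h.aff, fun v => (h.slope v).of_subset hS, h.const.of_subset hS⟩

theorem mono (h : Tab S k f) (hk : k ≤ l) : Tab S l f :=
  ⟨h.aff, fun v => (h.slope v).mono hk, h.const.mono hk⟩

theorem eval (h : Tab S 0 f) {x : D → V → ℝ} (hx : ∀ v, Cost S 0 (fun s => x s v)) :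
    Cost S (2 * Fintype.card V + 1) (fun s => f s (x s)) := by
  refine ((h.const.add (Cost.dot h.slope hx)).mono (by omega)).congr fun s => ?_
  exact (h.aff s).eval (x s)

theorem add (hf : Tab S k f) (hg : Tab S l g) : Tab S (k + l + 1) (fun s x => f s x + g s x) where
  aff s := (hf.aff s).add (hg.aff s)
  slope v := ((hf.slope v).add (hg.slope v)).congr fun s => by simp only [RobustMAS.slope]; ring
  const := hf.const.add hg.const

theorem sub (hf : Tab S k f) (hg : Tab S l g) : Tab S (k + l + 1) (fun s x => f s x - g s x) where
  aff s := (hf.aff s).sub (hg.aff s)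
  slope v := ((hf.slope v).sub (hg.slope v)).congr fun s => by simp only [RobustMAS.slope]; ring
  const := hf.const.sub hg.const

theorem const_mul {c : D → ℝ} (hc : Cost S l c) (hf : Tab S k f) :
    Tab S (l + k + 1) (fun s x => c s * f s x) where
  aff s := (hf.aff s).const_mul _
  slope v := (hc.mul (hf.slope v)).congr fun s => by simp only [RobustMAS.slope]; ring
  const := hc.mul hf.const

theorem div_const {c : D → ℝ} (hf : Tab S k f) (hc : Cost S l c) (h0 : ∀ s, c s ≠ 0) :
    Tab S (k + l + 1) (fun s x => f s x / c s) where
  aff s := (hf.aff s).div_const _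
  slope v := ((hf.slope v).div hc h0).congr fun s => by simp only [RobustMAS.slope]; ring
  const := hf.const.div hc h0

theorem sum {ι : Type} [Fintype ι] {f : ι → D → (V → ℝ) → ℝ} (h : ∀ i, Tab S k (f i)) :
    Tab S (Fintype.card ι * (k + 1)) (fun s x => ∑ i, f i s x) where
  aff s := IsAff.sum _ fun i _ => (h i).aff s
  slope v := (Cost.sum fun i => (h i).slope v).congr fun s => by
    simp only [RobustMAS.slope, Finset.sum_sub_distrib]
  const := Cost.sum fun i => (h i).const

theorem of_const {c : D → ℝ} (hc : Cost S k c) : Tab S k (fun s (_ : V → ℝ) => c s) where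
  aff _ := IsAff.const _
  slope v := (Cost.const 0).congr fun s => by simp [RobustMAS.slope]
  const := hc

theorem coord (v : V) : Tab S k (fun (_ : D) (x : V → ℝ) => x v) where
  aff _ := IsAff.coord v
  slope _ := Cost.const _
  const := Cost.const _

end Tab

end Tables

/-! ### Cost of the rank-one updates -/

section RankOne

open Matrix

variable {D V E : Type} [Fintype V] [DecidableEq V] [Fintype E] [DecidableEq E]
  {S : Set (D → ℝ)}

/-- Storing `M a` (2n² operations) and the denominator (2n + 1) leaves three operations per entry.
With `e = 0` it also covers the insertion of an equality constraint. -/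
theorem rankOne_cheap {M M' : D → Matrix V V ℝ} {a : D → V → ℝ} {e : D → ℝ}
    (hM : ∀ u v, Cost S 0 (fun s => M s u v)) (ha : ∀ v, Cost S 0 (fun s => a s v))
    (he : Cost S 0 e) (hne : ∀ s, e s + a s ⬝ᵥ M s *ᵥ a s ≠ 0)
    (hM' : ∀ s, M' s = M s - (e s + a s ⬝ᵥ M s *ᵥ a s)⁻¹ • vecMulVec (M s *ᵥ a s) (M s *ᵥ a s)) :
    Cheap S (8 * (Fintype.card V + 1) ^ 2) (entries M') := by
  have hw : ∀ v, Cost S (Fintype.card V * 2) (fun s => (M s *ᵥ a s) v) := fun v =>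
    Cost.dot (hM v) ha
  refine Cheap.mono (Cheap.stage hw fun S₁ h₁ hw => ?_)
    (k := Fintype.card V * (Fintype.card V * 2) + (Fintype.card Unit * (Fintype.card V * 2 + 1)
      + Fintype.card V * Fintype.card V * 3)) (by
        rw [Fintype.card_unit]; nlinarith)
  have hd : Cost S₁ (Fintype.card V * 2 + 1) (fun s => e s + a s ⬝ᵥ M s *ᵥ a s) :=
    ((he.of_subset h₁).add (Cost.dot (fun v => (ha v).of_subset h₁) hw)).mono (by omega)
  refine Cheap.stage (ι := Unit) (fun _ => hd) fun S₂ h₂ hd => ?_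
  refine Cheap.of_entries fun u v => ?_
  have := (((hM u v).of_subset h₁).of_subset h₂).sub
    ((((hw u).of_subset h₂).mul ((hw v).of_subset h₂)).div (hd ()) hne)
  refine this.congr fun s => ?_
  simp only [hM', Matrix.sub_apply, Matrix.smul_apply, vecMulVec_apply, smul_eq_mul]
  rw [div_eq_inv_mul]

/-- The inverse of a matrix after rank-one updates, from the inverse of the matrix. -/
theorem inv_cheap {ι : Type} [Fintype ι] {B : D → Matrix V V ℝ}
    {a : ι → D → V → ℝ} {e : ι → D → ℝ}
    (hB : ∀ u v, Cost S 0 (fun s => (B s)⁻¹ u v)) (ha : ∀ i v, Cost S 0 (fun s => a i s v))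
    (he : ∀ i, Cost S 0 (e i)) (hne : ∀ i s, e i s ≠ 0) (hs : ∀ s, (B s).IsSymm)
    -- Invertibility is required for every subset because the induction over finite sets does not
    -- fix the order of the updates.
    (hK : ∀ s (K : Finset ι),
      IsUnit (B s + ∑ i ∈ K, (e i s)⁻¹ • vecMulVec (a i s) (a i s)).det) :
    Cheap S (Fintype.card ι * (8 * (Fintype.card V + 1) ^ 2))
      (entries fun s => (B s + ∑ i, (e i s)⁻¹ • vecMulVec (a i s) (a i s))⁻¹) := by
  classical
  have key : ∀ K : Finset ι, Cheap S (K.card * (8 * (Fintype.card V + 1) ^ 2))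
      (entries fun s => (B s + ∑ i ∈ K, (e i s)⁻¹ • vecMulVec (a i s) (a i s))⁻¹) := by
    intro K
    induction K using Finset.induction_on with
    | empty =>
      refine (Cheap.of_entries (k := 0) fun u v => ?_).mono (by simp)
      simpa using hB u v
    | insert i K hi ih =>
      rw [Finset.card_insert_of_notMem hi, Nat.succ_mul]
      refine ih.trans ?_
      have step : ∀ s, _ := fun s => inv_add_rankOne (H := B s + ∑ i ∈ K, (e i s)⁻¹ •
        vecMulVec (a i s) (a i s)) (by
          rw [Matrix.IsSymm, transpose_add, (hs s).eq, transpose_sum]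
          simp [transpose_vecMulVec]) (hK s K) (hne i s) (a i s) (by
          have := hK s (insert i K)
          rwa [Finset.sum_insert hi, add_comm (_ • _), ← add_assoc] at this)
      refine rankOne_cheap (e := e i) (a := a i)
        (fun u v => Cost.of_entries Set.subset_union_right u v)
        (fun v => (ha i v).of_subset Set.subset_union_left)
        ((he i).of_subset Set.subset_union_left) (fun s => (step s).1) fun s => ?_
      rw [Finset.sum_insert hi, add_comm (_ • _), ← add_assoc]
      exact (step s).2
  simpa using key Finset.univ

theorem kktSolver_cheap {H : D → Matrix V V ℝ} (hH : ∀ s, SymPos (H s)) {A : D → Matrix E V ℝ}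
    (hA : ∀ s, LinearIndependent ℝ (fun e => A s e))
    (hHi : ∀ u v, Cost S 0 (fun s => (H s)⁻¹ u v)) (ha : ∀ e v, Cost S 0 (fun s => A s e v)) :
    ∃ M : D → Matrix V V ℝ, (∀ s, IsKKTSolver (H s) (A s) Finset.univ (M s)) ∧
      Cheap S (Fintype.card E * (8 * (Fintype.card V + 1) ^ 2)) (entries M) := by
  have key : ∀ K : Finset E, ∃ M : D → Matrix V V ℝ, (∀ s, IsKKTSolver (H s) (A s) K (M s)) ∧
      Cheap S (K.card * (8 * (Fintype.card V + 1) ^ 2)) (entries M) := by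
    intro K
    induction K using Finset.induction_on with
    | empty =>
      exact ⟨fun s => (H s)⁻¹, fun s => .empty (hH s) _,
        (Cheap.of_entries (k := 0) hHi).mono (by simp)⟩
    | insert e K he ih =>
      obtain ⟨M, hM, hc⟩ := ih
      have step := fun s => (hM s).insert (hH s) (hA s) he
      refine ⟨_, fun s => (step s).2, ?_⟩
      rw [Finset.card_insert_of_notMem he, Nat.succ_mul]
      refine hc.trans ?_
      refine rankOne_cheap (e := fun _ => 0) (a := fun s => A s e)
        (fun u v => Cost.of_entries Set.subset_union_right u v)
        (fun v => (ha e v).of_subset Set.subset_union_left) (Cost.const 0)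
        (fun s => by rw [zero_add]; exact (step s).1) fun s => by rw [zero_add]
  exact key Finset.univ

end RankOne

/-! ### Cone values and coefficient tables of a program -/

section Newton

open Matrix

variable {D X Y L E B₁ R₁ B₂ R₂ J : Type} [Fintype X] [DecidableEq X] [Fintype Y] [DecidableEq Y]
  [Fintype L] [Fintype E] [DecidableEq E] [Fintype B₁] [Fintype R₁] [Fintype B₂] [Fintype R₂]
  [Fintype J] {S S' : Set (D → ℝ)} {k : ℕ}

/-- The affine data are evaluated once and stored; after that, gaps and half gradients are sums over
the body index only. The half gradient serves both the gradient and the rank-one part of the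
Hessian. -/
theorem SOC.cheap {V B R : Type} [Fintype V] [DecidableEq V] [Fintype B] [Fintype R]
    {soc : D → B → SOC V R} (htop : ∀ b, Tab S 0 (fun s => (soc s b).top))
    (hbody : ∀ b r, Tab S 0 (fun s => (soc s b).body r)) {x : D → V → ℝ}
    (hx : ∀ v, Cost S 0 (fun s => x s v)) {l : ℕ} {G : Set (D → ℝ)}
    (next : ∀ S', S ⊆ S' → (∀ b, Cost S' 0 (fun s => (soc s b).gap (x s))) →
      (∀ b v, Cost S' 0 (fun s => (soc s b).halfGrad (x s) v)) → Cheap S' l G) :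
    Cheap S (4 * (Fintype.card V + 1) * (Fintype.card B * (Fintype.card R + 2)) + l) G := by
  have h1 : ∀ q : B ⊕ B × R, Cost S (2 * Fintype.card V + 1)
      (Sum.elim (fun b s => (soc s b).top (x s)) (fun q s => (soc s q.1).body q.2 (x s)) q) := by
    rintro (b | ⟨b, r⟩)
    · exact (htop b).eval hx
    · exact (hbody b r).eval hx
  refine Cheap.mono (Cheap.stage h1 fun S₁ s₁ h1 => ?_)
    (k := Fintype.card (B ⊕ B × R) * (2 * Fintype.card V + 1)
      + (Fintype.card (B ⊕ B × V) * (Fintype.card R * 2 + 2) + l)) (by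
      simp only [Fintype.card_sum, Fintype.card_prod]
      nlinarith [Nat.zero_le (Fintype.card B * Fintype.card V),
        Nat.zero_le (Fintype.card B * Fintype.card R)])
  have ht : ∀ b, Cost S₁ 0 (fun s => (soc s b).top (x s)) := fun b => h1 (Sum.inl b)
  have hb : ∀ b r, Cost S₁ 0 (fun s => (soc s b).body r (x s)) := fun b r => h1 (Sum.inr (b, r))
  have h2 : ∀ q : B ⊕ B × V, Cost S₁ (Fintype.card R * 2 + 2)
      (Sum.elim (fun b s => (soc s b).gap (x s))
        (fun q s => (soc s q.1).halfGrad (x s) q.2) q) := by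
    rintro (b | ⟨b, v⟩)
    · exact ((ht b).sq.sub (Cost.sum fun r => (hb b r).sq)).mono (by omega)
    · exact (((ht b).mul ((htop b).of_subset s₁ |>.slope v)).sub
        (Cost.dot (hb b) fun r => ((hbody b r).of_subset s₁).slope v)).mono (by omega)
  refine Cheap.stage h2 fun S₂ s₂ h2 => next S₂ (s₁.trans s₂) ?_ ?_
  · exact fun b => h2 (Sum.inl b)
  · exact fun b v => h2 (Sum.inr (b, v))

/-- The coefficients of the constraints of `P` can be computed with `k` operations each. -/
structure ConstraintTab (S : Set (D → ℝ)) (k : ℕ) (P : D → ConicProgram (X ⊕ Y) L E B₁ R₁ B₂ R₂) :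
    Prop where
  lin : ∀ l, Tab S k (fun s => (P s).lin l)
  eqn : ∀ e, Tab S k (fun s => (P s).eqn e)
  top₁ : ∀ b, Tab S k (fun s => ((P s).soc₁ b).top)
  body₁ : ∀ b r, Tab S k (fun s => ((P s).soc₁ b).body r)
  top₂ : ∀ b, Tab S k (fun s => ((P s).soc₂ b).top)
  body₂ : ∀ b r, Tab S k (fun s => ((P s).soc₂ b).body r)

theorem ConstraintTab.of_subset {P : D → ConicProgram (X ⊕ Y) L E B₁ R₁ B₂ R₂}
    (h : ConstraintTab S k P) (hS : S ⊆ S') : ConstraintTab S' k P :=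
  ⟨fun l => (h.lin l).of_subset hS, fun l => (h.eqn l).of_subset hS,
    fun l => (h.top₁ l).of_subset hS, fun l r => (h.body₁ l r).of_subset hS,
    fun l => (h.top₂ l).of_subset hS, fun l r => (h.body₂ l r).of_subset hS⟩

/-- The coefficients of the objective are available. -/
structure ObjectiveTab (S : Set (D → ℝ)) (Q Qi : D → Matrix X X ℝ) (α w : D → J → ℝ)
    (p : D → J → X ⊕ Y → ℝ) : Prop where
  hess : ∀ u v, Cost S 0 (fun s => Q s u v)
  hess_inv : ∀ u v, Cost S 0 (fun s => Qi s u v)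
  shift : ∀ j, Cost S 0 (fun s => α s j)
  weight : ∀ j, Cost S 0 (fun s => w s j)
  dir : ∀ j v, Cost S 0 (fun s => p s j v)
  inv : ∀ s, Q s * Qi s = 1

end Newton

/-! ### Cost of one Newton step and of the interior-point method -/

section NewtonStep

open Matrix

variable {D X Y L E B₁ R₁ B₂ R₂ J : Type} [Fintype X] [DecidableEq X] [Fintype Y] [DecidableEq Y]
  [Fintype L] [Fintype E] [DecidableEq E] [Fintype B₁]
  [Fintype R₁] [Fintype B₂] [Fintype R₂]
  [Fintype J] {S S' : Set (D → ℝ)} {k : ℕ}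

namespace ConicProgram

/-- Index type of the positive rank-one terms of the barrier Hessian. -/
abbrev PosIdx (L B₁ R₁ B₂ R₂ J : Type) : Type :=
  L ⊕ (B₁ × R₁) ⊕ B₁ ⊕ (B₂ × R₂) ⊕ B₂ ⊕ J

/-- Index type of the negative rank-one terms of the barrier Hessian. -/
abbrev NegIdx (B₁ B₂ Y : Type) : Type := B₁ ⊕ B₂ ⊕ Y

/-- The vectors of the positive rank-one terms. -/
noncomputable def posVec (P : ConicProgram (X ⊕ Y) L E B₁ R₁ B₂ R₂) (p : J → X ⊕ Y → ℝ)
    (x : X ⊕ Y → ℝ) : PosIdx L B₁ R₁ B₂ R₂ J → X ⊕ Y → ℝ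
  | .inl l => slope (P.lin l)
  | .inr (.inl q) => slope ((P.soc₁ q.1).body q.2)
  | .inr (.inr (.inl b)) => (P.soc₁ b).halfGrad x
  | .inr (.inr (.inr (.inl q))) => slope ((P.soc₂ q.1).body q.2)
  | .inr (.inr (.inr (.inr (.inl b)))) => (P.soc₂ b).halfGrad x
  | .inr (.inr (.inr (.inr (.inr j)))) => p j

/-- The reciprocals of the weights of the positive rank-one terms. -/
noncomputable def posWt (P : ConicProgram (X ⊕ Y) L E B₁ R₁ B₂ R₂) (w : J → ℝ) (t : ℝ)
    (x : X ⊕ Y → ℝ) : PosIdx L B₁ R₁ B₂ R₂ J → ℝ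
  | .inl l => P.lin l x ^ 2
  | .inr (.inl q) => (P.soc₁ q.1).gap x / 2
  | .inr (.inr (.inl b)) => (P.soc₁ b).gap x ^ 2 / 4
  | .inr (.inr (.inr (.inl q))) => (P.soc₂ q.1).gap x / 2
  | .inr (.inr (.inr (.inr (.inl b)))) => (P.soc₂ b).gap x ^ 2 / 4
  | .inr (.inr (.inr (.inr (.inr j)))) => 1 / (t * w j)

/-- The vectors of the negative rank-one terms. -/
noncomputable def negVec (P : ConicProgram (X ⊕ Y) L E B₁ R₁ B₂ R₂) :
    NegIdx B₁ B₂ Y → X ⊕ Y → ℝ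
  | .inl b => slope (P.soc₁ b).top
  | .inr (.inl b) => slope (P.soc₂ b).top
  | .inr (.inr y) => Pi.single (.inr y) 1

/-- The reciprocals of the weights of the negative rank-one terms. -/
noncomputable def negWt (P : ConicProgram (X ⊕ Y) L E B₁ R₁ B₂ R₂) (x : X ⊕ Y → ℝ) :
    NegIdx B₁ B₂ Y → ℝ
  | .inl b => (P.soc₁ b).gap x / -2
  | .inr (.inl b) => (P.soc₂ b).gap x / -2
  | .inr (.inr _) => -1

/-- The matrix from which the barrier Hessian is built by rank-one updates. -/
noncomputable def baseMat (Y : Type) [DecidableEq Y] (Q : Matrix X X ℝ) (t : ℝ) :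
    Matrix (X ⊕ Y) (X ⊕ Y) ℝ :=
  fromBlocks (t • Q) 0 0 1

/-- The barrier Hessian without its negative terms. -/
noncomputable def posMat (P : ConicProgram (X ⊕ Y) L E B₁ R₁ B₂ R₂) (Q : Matrix X X ℝ)
    (w : J → ℝ) (p : J → X ⊕ Y → ℝ) (t : ℝ) (x : X ⊕ Y → ℝ) : Matrix (X ⊕ Y) (X ⊕ Y) ℝ :=
  baseMat Y Q t + ∑ i, (P.posWt w t x i)⁻¹ • vecMulVec (P.posVec p x i) (P.posVec p x i)

theorem baseMat_symPos {Q : Matrix X X ℝ} (hQ : SymPos Q) {t : ℝ} (ht : 0 < t) :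
    SymPos (baseMat Y Q t) := by
  constructor
  · rw [Matrix.IsSymm, baseMat, fromBlocks_transpose, transpose_smul, hQ.1.eq]
    simp
  · intro z hz
    obtain ⟨a, b, rfl⟩ : ∃ a b, z = Sum.elim a b := ⟨_, _, (Sum.elim_comp_inl_inr z).symm⟩
    have hval : Sum.elim a b ⬝ᵥ baseMat Y Q t *ᵥ Sum.elim a b
        = t * (a ⬝ᵥ Q *ᵥ a) + b ⬝ᵥ b := by
      simp [baseMat, fromBlocks_mulVec, smul_mulVec]
    rw [hval]
    have hb : 0 ≤ b ⬝ᵥ b := by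
      simpa [dotProduct] using Finset.sum_nonneg fun i (_ : i ∈ Finset.univ) => mul_self_nonneg (b i)
    have ha := mul_nonneg ht.le (hQ.nonneg a)
    refine lt_of_le_of_ne (by linarith) fun h0 => hz ?_
    have h1 : a ⬝ᵥ Q *ᵥ a = 0 :=
      (mul_eq_zero.1 (by linarith : t * (a ⬝ᵥ Q *ᵥ a) = 0)).resolve_left ht.ne'
    have h2 : b = 0 := dotProduct_self_eq_zero.1 (by linarith)
    rw [hQ.eq_zero h1, h2]
    ext (i | i) <;> rfl

theorem baseMat_inv {Q Qi : Matrix X X ℝ} (hQ : Q * Qi = 1) {t : ℝ} (ht : 0 < t) :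
    (baseMat Y Q t)⁻¹ = fromBlocks (t⁻¹ • Qi) 0 0 1 := by
  refine Matrix.inv_eq_right_inv ?_
  rw [baseMat, fromBlocks_multiply]
  simp [hQ, smul_smul, ht.ne']

variable {P : ConicProgram (X ⊕ Y) L E B₁ R₁ B₂ R₂} {Q : Matrix X X ℝ} {α w : J → ℝ}
  {p : J → X ⊕ Y → ℝ}

/-- The identity block that makes `baseMat` invertible is the sum of the rank-one matrices of the
unit vectors of `Y`; it is removed again by the last family of negative terms. -/
theorem Regular.posMat_add_neg (h : P.Regular Q α w p) (t : ℝ) (x : X ⊕ Y → ℝ) :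
    P.posMat Q w p t x + ∑ i, (P.negWt x i)⁻¹ • vecMulVec (P.negVec i) (P.negVec i)
      = P.hess t x := by
  have hone : ∑ y : Y, vecMulVec (Pi.single (.inr y) 1 : X ⊕ Y → ℝ)
      (Pi.single (.inr y) 1 : X ⊕ Y → ℝ) = fromBlocks 0 0 0 1 := by
    ext (i | i) (j | j) <;>
      simp [Matrix.sum_apply, vecMulVec_apply, Pi.single_apply, Matrix.one_apply]
  have hbase : baseMat Y Q t = t • (fromBlocks Q 0 0 0 : Matrix (X ⊕ Y) (X ⊕ Y) ℝ) + fromBlocks 0 0 0 1 := by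
    simp [baseMat, fromBlocks_smul, fromBlocks_add]
  simp only [posMat, hess_eq, h.obj_hess, hbase, SOC.hess_eq, Fintype.sum_sum_type, posWt, posVec,
    negWt, negVec, Fintype.sum_prod_type, inv_div, one_div, inv_inv, Finset.sum_add_distrib,
    smul_sub, smul_add, Finset.smul_sum, smul_smul, Finset.sum_sub_distrib, div_neg, neg_smul,
    Finset.sum_neg_distrib, inv_neg, inv_one, one_smul, hone]
  abel

theorem posWt_pos {t : ℝ} (ht : 0 < t) (hw : ∀ j, 0 < w j) {x : X ⊕ Y → ℝ} (hx : P.Interior x)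
    (i) : 0 < P.posWt w t x i := by
  rcases i with l | q | b | q | b | j
  · exact pow_pos (hx.lin l) 2
  · exact half_pos (hx.soc₁ q.1).2
  · have := (hx.soc₁ b).2
    simp only [posWt]; positivity
  · exact half_pos (hx.soc₂ q.1).2
  · have := (hx.soc₂ b).2
    simp only [posWt]; positivity
  · have := hw j
    simp only [posWt]; positivity

theorem negWt_neg {x : X ⊕ Y → ℝ} (hx : P.Interior x) (i) : P.negWt x i < 0 := by
  rcases i with b | b | y
  · exact div_neg_of_pos_of_neg (hx.soc₁ b).2 (by norm_num)
  · exact div_neg_of_pos_of_neg (hx.soc₂ b).2 (by norm_num)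
  · norm_num [negWt]

theorem Regular.symPos_base_add (h : P.Regular Q α w p) {t : ℝ} (ht : 0 < t) {x : X ⊕ Y → ℝ}
    (hx : P.Interior x) (K : Finset (PosIdx L B₁ R₁ B₂ R₂ J)) :
    SymPos (baseMat Y Q t
      + ∑ i ∈ K, (P.posWt w t x i)⁻¹ • vecMulVec (P.posVec p x i) (P.posVec p x i)) :=
  (baseMat_symPos h.Q_pos ht).add_sum K _
    (fun i _ => (inv_pos.2 (posWt_pos ht h.w_pos hx i)).le) _

/-- After removing the terms in `K`, what is left is the definite Hessian plus the terms outside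
`K`, which are still present with positive weight. So definiteness at the end of the removal gives
it throughout. -/
theorem Regular.symPos_posMat_add (h : P.Regular Q α w p) {t : ℝ} (ht : 0 < t) {x : X ⊕ Y → ℝ}
    (hx : P.Interior x) (K : Finset (NegIdx B₁ B₂ Y)) :
    SymPos (P.posMat Q w p t x
      + ∑ i ∈ K, (P.negWt x i)⁻¹ • vecMulVec (P.negVec i) (P.negVec i)) := by
  classical
  have e : P.posMat Q w p t x
      + ∑ i ∈ K, (P.negWt x i)⁻¹ • vecMulVec (P.negVec i) (P.negVec i)
      = P.hess t x + ∑ i ∈ Kᶜ, (-(P.negWt x i)⁻¹) • vecMulVec (P.negVec i) (P.negVec i) := by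
    rw [← h.posMat_add_neg t x, ← Finset.sum_add_sum_compl K]
    simp only [neg_smul, Finset.sum_neg_distrib]
    abel
  rw [e]
  exact (h.hess_symPos ht hx).add_sum _ _
    (fun i _ => neg_nonneg.2 (inv_nonpos.2 (negWt_neg hx i).le)) _

end ConicProgram

open ConicProgram

/-- The number of rank-one updates in one Newton step. -/
abbrev rankCount (Y L E B₁ R₁ B₂ R₂ J : Type) [Fintype Y] [Fintype L] [Fintype E] [Fintype B₁]
    [Fintype R₁] [Fintype B₂] [Fintype R₂] [Fintype J] : ℕ :=
  Fintype.card L + Fintype.card E + Fintype.card B₁ * (Fintype.card R₁ + 2)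
    + Fintype.card B₂ * (Fintype.card R₂ + 2) + Fintype.card J + Fintype.card Y

theorem ObjectiveTab.of_subset {Q Qi : D → Matrix X X ℝ} {α w : D → J → ℝ}
    {p : D → J → X ⊕ Y → ℝ} (h : ObjectiveTab S Q Qi α w p) (hS : S ⊆ S') :
    ObjectiveTab S' Q Qi α w p :=
  ⟨fun u v => (h.hess u v).of_subset hS, fun u v => (h.hess_inv u v).of_subset hS,
    fun j => (h.shift j).of_subset hS, fun j => (h.weight j).of_subset hS,
    fun j v => (h.dir j v).of_subset hS, h.inv⟩

variable {P : D → ConicProgram (X ⊕ Y) L E B₁ R₁ B₂ R₂} {Q Qi : D → Matrix X X ℝ}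
  {α w : D → J → ℝ} {p : D → J → X ⊕ Y → ℝ}

/-- The matrix `Qi` is given, so the inverse of the base matrix needs at most one division per
entry. Every later step is one of `rankCount` updates at `8 (n + 1)²` operations, and at most two
operations give each weight. -/
theorem kktSolver_of_program (hP : ConstraintTab S 0 P) (hO : ObjectiveTab S Q Qi α w p)
    (hreg : ∀ s, (P s).Regular (Q s) (α s) (w s) (p s)) {t : D → ℝ} (ht : Cost S 0 t)
    (ht0 : ∀ s, 0 < t s) {x : D → X ⊕ Y → ℝ} (hx : ∀ s, (P s).Interior (x s))
    (hlin : ∀ l, Cost S 0 (fun s => (P s).lin l (x s)))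
    (hg₁ : ∀ b, Cost S 0 (fun s => ((P s).soc₁ b).gap (x s)))
    (hg₂ : ∀ b, Cost S 0 (fun s => ((P s).soc₂ b).gap (x s)))
    (hh₁ : ∀ b v, Cost S 0 (fun s => ((P s).soc₁ b).halfGrad (x s) v))
    (hh₂ : ∀ b v, Cost S 0 (fun s => ((P s).soc₂ b).halfGrad (x s) v)) :
    ∃ M : D → Matrix (X ⊕ Y) (X ⊕ Y) ℝ,
      (∀ s, IsKKTSolver ((P s).hess (t s) (x s)) (P s).eqMat Finset.univ (M s)) ∧
      Cheap S ((Fintype.card (X ⊕ Y) + 1) ^ 2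
        * (8 * rankCount Y L E B₁ R₁ B₂ R₂ J
          + 2 * rankCount Y L E B₁ R₁ B₂ R₂ J + 1)) (entries M) := by
  set n := Fintype.card (X ⊕ Y) with hn
  have hinv : Cheap S (n * n * 1 + (Fintype.card (PosIdx L B₁ R₁ B₂ R₂ J) * 2
      + (Fintype.card (NegIdx B₁ B₂ Y) * 1
      + (Fintype.card (PosIdx L B₁ R₁ B₂ R₂ J) * (8 * (n + 1) ^ 2)
      + Fintype.card (NegIdx B₁ B₂ Y) * (8 * (n + 1) ^ 2)))))
      (entries fun s => ((P s).hess (t s) (x s))⁻¹) := by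
    refine (Cheap.of_entries (M := fun s => (baseMat Y (Q s) (t s))⁻¹) (k := 1) ?_).trans ?_
    · intro u v
      simp only [fun s => baseMat_inv (Y := Y) (hO.inv s) (ht0 s)]
      rcases u with u | u <;> rcases v with v | v
      · refine ((hO.hess_inv u v).div ht fun s => (ht0 s).ne').congr fun s => ?_
        simp [div_eq_inv_mul]
      · exact (Cost.const 0).congr fun s => by simp
      · exact (Cost.const 0).congr fun s => by simp
      · exact (Cost.const ((1 : Matrix Y Y ℝ) u v)).congr fun s => by simp
    have s₁ : S ⊆ S ∪ entries fun s => (baseMat Y (Q s) (t s))⁻¹ := Set.subset_union_left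
    have hbase : ∀ u v, Cost (S ∪ entries fun s => (baseMat Y (Q s) (t s))⁻¹) 0
        (fun s => (baseMat Y (Q s) (t s))⁻¹ u v) := fun u v =>
      Cost.of_entries Set.subset_union_right u v
    refine Cheap.stage (f := fun i s => (P s).posWt (w s) (t s) (x s) i) ?_ fun S₂ s₂ hpw => ?_
    · rintro (l | q | b | q | b | j)
      · exact ((hlin l).of_subset s₁).sq.mono (by omega)
      · exact (((hg₁ q.1).of_subset s₁).div (Cost.const (k := 0) 2) (by simp)).mono (by omega)
      · exact (((hg₁ b).of_subset s₁).sq.div (Cost.const (k := 0) 4) (by simp)).mono (by omega)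
      · exact (((hg₂ q.1).of_subset s₁).div (Cost.const (k := 0) 2) (by simp)).mono (by omega)
      · exact (((hg₂ b).of_subset s₁).sq.div (Cost.const (k := 0) 4) (by simp)).mono (by omega)
      · exact ((Cost.const (k := 0) 1).div ((ht.mul (hO.weight j)).of_subset s₁)
          fun s => (mul_pos (ht0 s) ((hreg s).w_pos j)).ne').mono (by omega)
    refine Cheap.stage (f := fun i s => (P s).negWt (x s) i) ?_ fun S₃ s₃ hnw => ?_
    · rintro (b | b | y)
      · exact (((hg₁ b).of_subset (s₁.trans s₂)).div (Cost.const (k := 0) (-2))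
          (by simp)).mono (by omega)
      · exact (((hg₂ b).of_subset (s₁.trans s₂)).div (Cost.const (k := 0) (-2))
          (by simp)).mono (by omega)
      · exact Cost.const (-1)
    have s₁₃ : S ⊆ S₃ := (s₁.trans s₂).trans s₃
    have hpos := inv_cheap (S := S₃) (B := fun s => baseMat Y (Q s) (t s))
      (a := fun i s => (P s).posVec (p s) (x s) i) (e := fun i s => (P s).posWt (w s) (t s) (x s) i)
      (fun u v => (hbase u v).of_subset (s₂.trans s₃)) (by
        rintro (l | q | b | q | b | j) v
        · exact ((hP.lin l).slope v).of_subset s₁₃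
        · exact ((hP.body₁ q.1 q.2).slope v).of_subset s₁₃
        · exact (hh₁ b v).of_subset s₁₃
        · exact ((hP.body₂ q.1 q.2).slope v).of_subset s₁₃
        · exact (hh₂ b v).of_subset s₁₃
        · exact (hO.dir j v).of_subset s₁₃)
      (fun i => (hpw i).of_subset s₃)
      (fun i s => (posWt_pos (ht0 s) (hreg s).w_pos (hx s) i).ne')
      (fun s => (baseMat_symPos (hreg s).Q_pos (ht0 s)).1)
      (fun s K => ((hreg s).symPos_base_add (ht0 s) (hx s) K).isUnit_det)
    refine hpos.trans ?_
    have hneg := inv_cheap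
      (S := S₃ ∪ entries fun s => ((P s).posMat (Q s) (w s) (p s) (t s) (x s))⁻¹)
      (B := fun s => (P s).posMat (Q s) (w s) (p s) (t s) (x s))
      (a := fun i s => (P s).negVec i) (e := fun i s => (P s).negWt (x s) i)
      (fun u v => Cost.of_entries Set.subset_union_right u v) (by
        rintro (b | b | y) v
        · exact (((hP.top₁ b).slope v).of_subset s₁₃).of_subset Set.subset_union_left
        · exact (((hP.top₂ b).slope v).of_subset s₁₃).of_subset Set.subset_union_left
        · exact Cost.const _)
      (fun i => (hnw i).of_subset Set.subset_union_left)
      (fun i s => (negWt_neg (hx s) i).ne)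
      (fun s => ((hreg s).symPos_base_add (ht0 s) (hx s) Finset.univ).1)
      (fun s K => ((hreg s).symPos_posMat_add (ht0 s) (hx s) K).isUnit_det)
    simp only [fun s => (hreg s).posMat_add_neg (t s) (x s)] at hneg
    exact hneg
  obtain ⟨M, hM, hc⟩ := kktSolver_cheap
    (H := fun s => (P s).hess (t s) (x s)) (A := fun s => (P s).eqMat)
    (S := S ∪ entries fun s => ((P s).hess (t s) (x s))⁻¹)
    (fun s => (hreg s).hess_symPos (ht0 s) (hx s)) (fun s => (hreg s).eq_indep)
    (fun u v => Cost.of_entries Set.subset_union_right u v)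
    (fun e v => ((hP.eqn e).slope v).of_subset Set.subset_union_left)
  refine ⟨M, hM, (hinv.trans hc).mono ?_⟩
  rw [← hn]
  -- A cone constraint with body index `R` contributes `|R| + 2` updates: its body rows, its half
  -- gradient, and its top with negative sign.
  have hr : Fintype.card (PosIdx L B₁ R₁ B₂ R₂ J) + Fintype.card (NegIdx B₁ B₂ Y)
      + Fintype.card E = rankCount Y L E B₁ R₁ B₂ R₂ J := by
    simp only [Fintype.card_sum, Fintype.card_prod]
    ring
  rw [← hr]
  set a := Fintype.card (PosIdx L B₁ R₁ B₂ R₂ J)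
  set b := Fintype.card (NegIdx B₁ B₂ Y)
  set c := Fintype.card E
  have h1 : 1 ≤ (n + 1) ^ 2 := Nat.one_le_pow _ _ (by omega)
  have h2 : a * 1 ≤ a * (n + 1) ^ 2 := Nat.mul_le_mul_left _ h1
  have h3 : b * 1 ≤ b * (n + 1) ^ 2 := Nat.mul_le_mul_left _ h1
  have h4 : n * n ≤ (n + 1) ^ 2 := by nlinarith
  have h5 : 0 ≤ c * (n + 1) ^ 2 := Nat.zero_le _
  nlinarith

/-- The cost of one interior-point iteration. -/
theorem newtonStep_cheap (hP : ConstraintTab S 0 P) (hO : ObjectiveTab S Q Qi α w p)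
    (hreg : ∀ s, (P s).Regular (Q s) (α s) (w s) (p s)) {t : D → ℝ} (ht : Cost S 0 t)
    (ht0 : ∀ s, 0 < t s) {x : D → X ⊕ Y → ℝ} (hxc : ∀ v, Cost S 0 (fun s => x s v))
    (hx : ∀ s, (P s).Interior (x s)) :
    Cheap S (40 * (Fintype.card (X ⊕ Y) + 1) ^ 2 * (rankCount Y L E B₁ R₁ B₂ R₂ J + 1))
      (Set.range fun v s => (P s).newtonStep (t s) (x s) v) := by
  set n := Fintype.card (X ⊕ Y) with hn
  set r := rankCount Y L E B₁ R₁ B₂ R₂ J with hr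
  have hr' : r = Fintype.card L + Fintype.card E + Fintype.card B₁ * (Fintype.card R₁ + 2)
    + Fintype.card B₂ * (Fintype.card R₂ + 2) + Fintype.card J + Fintype.card Y := hr
  have hL : Fintype.card L ≤ r := by omega
  have hJ : Fintype.card J ≤ r := by omega
  have hB : Fintype.card B₁ * (Fintype.card R₁ + 2) + Fintype.card B₂ * (Fintype.card R₂ + 2)
      + Fintype.card L + Fintype.card J ≤ r := by omega
  have hBB : Fintype.card B₁ + Fintype.card B₂ + Fintype.card L + Fintype.card J ≤ r := by
    refine le_trans ?_ hB
    have h1 := Nat.le_mul_of_pos_right (Fintype.card B₁) (Nat.succ_pos (Fintype.card R₁ + 1))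
    have h2 := Nat.le_mul_of_pos_right (Fintype.card B₂) (Nat.succ_pos (Fintype.card R₂ + 1))
    simp only [Nat.succ_eq_add_one, add_assoc] at h1 h2 ⊢
    norm_num at h1 h2
    omega
  -- The summands are the stages: values of the linear constraints, the two cone families, the
  -- products `⟨p j, x⟩`, the gradient, the KKT solver, the direction, `1 + δ`, and the step itself.
  refine Cheap.mono (k := Fintype.card L * (2 * n + 1)
    + (4 * (n + 1) * (Fintype.card B₁ * (Fintype.card R₁ + 2))
    + (4 * (n + 1) * (Fintype.card B₂ * (Fintype.card R₂ + 2))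
    + (Fintype.card J * (n * 2) + (n * (2 * n + 4 * r + 5)
    + ((n + 1) ^ 2 * (8 * r + 2 * r + 1) + (n * (n * 2 + 1)
    + (Fintype.card Unit * (n * 2 + 3) + n * 2)))))))) ?_ ?_
  · refine Cheap.stage (f := fun l s => (P s).lin l (x s)) (fun l => (hP.lin l).eval hxc)
      fun S₁ s₁ hlin => ?_
    replace hP := hP.of_subset s₁
    replace hO := hO.of_subset s₁
    replace ht := ht.of_subset s₁
    replace hxc := fun v => (hxc v).of_subset s₁
    refine SOC.cheap hP.top₁ hP.body₁ hxc fun S₂ s₂ hg₁ hh₁ => ?_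
    replace hP := hP.of_subset s₂
    replace hO := hO.of_subset s₂
    replace ht := ht.of_subset s₂
    replace hxc := fun v => (hxc v).of_subset s₂
    refine SOC.cheap hP.top₂ hP.body₂ hxc fun S₃ s₃ hg₂ hh₂ => ?_
    replace hP := hP.of_subset s₃
    replace hO := hO.of_subset s₃
    replace ht := ht.of_subset s₃
    replace hxc := fun v => (hxc v).of_subset s₃
    refine Cheap.stage (f := fun j s => ∑ u, p s j u * x s u)
      (fun j => Cost.dot (hO.dir j) hxc) fun S₄ s₄ hpx => ?_
    replace hP := hP.of_subset s₄
    replace hO := hO.of_subset s₄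
    replace ht := ht.of_subset s₄
    replace hxc := fun v => (hxc v).of_subset s₄
    replace hg₂ := fun b => (hg₂ b).of_subset s₄
    replace hh₂ := fun b v => (hh₂ b v).of_subset s₄
    replace hg₁ := fun b => ((hg₁ b).of_subset s₃).of_subset s₄
    replace hh₁ := fun b v => ((hh₁ b v).of_subset s₃).of_subset s₄
    replace hlin := fun l => (((hlin l).of_subset s₂).of_subset s₃).of_subset s₄
    refine Cheap.stage (f := fun v s => (P s).grad (t s) (x s) v) ?_ fun S₅ s₅ hgrad => ?_
    · intro v
      have hobj : Cost S₄ (2 * n + Fintype.card J * 4 + 1)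
          (fun s => quadGrad (P s).obj (x s) v) := by
        have h1 : Cost S₄ (2 * n) (fun s => (Sum.elim (fun i => ∑ u, Q s i u * x s (Sum.inl u))
            (fun _ => 0) v : ℝ)) := by
          rcases v with i | y
          · refine (Cost.dot (hO.hess i) fun u => hxc (Sum.inl u)).mono ?_
            rw [hn, Fintype.card_sum]
            omega
          · exact Cost.const 0
        refine ((h1.add (Cost.sum fun j => (((hO.shift j).add ((hO.weight j).mul (hpx j))).mul
          (hO.dir j v)))).mono (by omega)).congr fun s => ?_
        exact (hreg s).obj_grad (x s) v
      have hsoc : ∀ {g h : D → ℝ}, Cost S₄ 0 g → Cost S₄ 0 h → (∀ s, g s ≠ 0) →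
          Cost S₄ 3 (fun s => -(2 / g s) * h s) := fun hg hh h0 =>
        ((((Cost.const (k := 0) 2).div hg h0).neg).mul hh).mono (by omega)
      refine ((((ht.mul hobj).sub (Cost.sum fun l => ((hP.lin l).slope v).div (hlin l)
        fun s => ((hx s).lin l).ne')).add (Cost.sum fun b => hsoc (hg₁ b) (hh₁ b v)
        fun s => ((hx s).soc₁ b).2.ne')).add (Cost.sum fun b => hsoc (hg₂ b) (hh₂ b v)
        fun s => ((hx s).soc₂ b).2.ne')).mono ?_
      omega
    replace hP := hP.of_subset s₅
    replace hO := hO.of_subset s₅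
    replace ht := ht.of_subset s₅
    replace hxc := fun v => (hxc v).of_subset s₅
    obtain ⟨M, hM, hc⟩ := kktSolver_of_program hP hO hreg ht ht0 hx
      (fun l => (hlin l).of_subset s₅) (fun b => (hg₁ b).of_subset s₅)
      (fun b => (hg₂ b).of_subset s₅) (fun b v => (hh₁ b v).of_subset s₅)
      (fun b v => (hh₂ b v).of_subset s₅)
    refine hc.trans ?_
    have hdir : ∀ s, (P s).newtonDir (t s) (x s) = -(M s *ᵥ (P s).grad (t s) (x s)) := fun s =>
      newtonDir_eq ((hreg s).hess_symPos (ht0 s) (hx s)) (hreg s).eq_indep (hM s)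
    refine Cheap.stage (f := fun v s => (P s).newtonDir (t s) (x s) v) ?_ fun S₇ s₇ hd => ?_
    · intro v
      refine (Cost.neg (Cost.dot (fun u => Cost.of_entries Set.subset_union_right v u)
        fun u => (hgrad u).of_subset Set.subset_union_left)).congr fun s => ?_
      rw [hdir]
      rfl
    replace hxc := fun v => ((hxc v).of_subset (Set.subset_union_left (t := entries M))).of_subset s₇
    replace hgrad := fun v =>
      ((hgrad v).of_subset (Set.subset_union_left (t := entries M))).of_subset s₇
    have hdec : Cost S₇ (n * 2 + 3) (fun s =>
        1 + √(-((P s).grad (t s) (x s) ⬝ᵥ (P s).newtonDir (t s) (x s)))) :=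
      ((Cost.const (k := 0) 1).add ((Cost.neg (Cost.dot hgrad hd)).sqrt fun s =>
        decrement_nonneg ((hreg s).hess_symPos (ht0 s) (hx s)) (hreg s).eq_indep)).mono (by omega)
    refine Cheap.stage (ι := Unit) (fun _ => hdec) fun S₈ s₈ hdec => ?_
    refine Cheap.range fun v => ?_
    refine (((hxc v).of_subset s₈).add (((hd v).of_subset s₈).div (hdec ()) fun s => ?_)).mono
      (by omega)
    have := Real.sqrt_nonneg (-((P s).grad (t s) (x s) ⬝ᵥ (P s).newtonDir (t s) (x s)))
    linarith
  · rw [Fintype.card_unit]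
    have e1 : Fintype.card L * (2 * n + 1) ≤ 2 * ((n + 1) * r) := by nlinarith
    have e2 : 4 * (n + 1) * (Fintype.card B₁ * (Fintype.card R₁ + 2))
        + 4 * (n + 1) * (Fintype.card B₂ * (Fintype.card R₂ + 2)) ≤ 4 * ((n + 1) * r) := by
      rw [← mul_add, mul_assoc]
      exact Nat.mul_le_mul_left _ (Nat.mul_le_mul_left _ (by omega))
    have e3 : Fintype.card J * (n * 2) ≤ 2 * ((n + 1) * r) := by nlinarith
    have e4 : (n + 1) * r ≤ (n + 1) ^ 2 * r :=
      Nat.mul_le_mul_right _ (by nlinarith)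
    nlinarith [Nat.zero_le (n * r), Nat.zero_le (n * n * r)]

/-- The cost of the interior-point method. -/
theorem ipm_cheap (hP : ConstraintTab S 0 P) (hO : ObjectiveTab S Q Qi α w p)
    (hreg : ∀ s, (P s).Regular (Q s) (α s) (w s) (p s)) {t : D → ℕ → ℝ}
    (ht : ∀ j, Cost S 0 (fun s => t s j))
    (ht0 : ∀ s j, 0 < t s j) {x : D → X ⊕ Y → ℝ} (hxc : ∀ v, Cost S 0 (fun s => x s v))
    (hx : ∀ s, (P s).Interior (x s)) (i : ℕ) :
    Cheap S (i * (40 * (Fintype.card (X ⊕ Y) + 1) ^ 2 * (rankCount Y L E B₁ R₁ B₂ R₂ J + 1)))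
      (Set.range fun v s => (P s).ipm (t s) (x s) i v) := by
  induction i with
  | zero => exact (Cheap.range (k := 0) hxc).mono (by simp)
  | succ i ih =>
    rw [Nat.succ_mul]
    refine ih.trans ?_
    have s₁ : S ⊆ S ∪ Set.range fun v s => (P s).ipm (t s) (x s) i v := Set.subset_union_left
    exact newtonStep_cheap (hP.of_subset s₁) (hO.of_subset s₁) hreg ((ht i).of_subset s₁)
      (fun s => ht0 s i) (fun v => Cost.of_range Set.subset_union_right v)
      fun s => (hreg s).interior_ipm (ht0 s) (hx s) i

end NewtonStep

/-! ### Quadratic forms -/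

section Quadratic

open Matrix

variable {V : Type} [Fintype V] [DecidableEq V]

/-- `f` is a quadratic form. -/
def IsQuad (f : (V → ℝ) → ℝ) : Prop := ∃ A : Matrix V V ℝ, ∀ x, f x = x ⬝ᵥ A *ᵥ x

namespace IsQuad

variable {f g : (V → ℝ) → ℝ}

theorem zero : IsQuad (fun _ : V → ℝ => 0) := ⟨0, by simp⟩

theorem add (hf : IsQuad f) (hg : IsQuad g) : IsQuad (fun x => f x + g x) := by
  obtain ⟨A, h⟩ := hf
  obtain ⟨A', h'⟩ := hg
  exact ⟨A + A', fun x => by simp only [h, h', add_mulVec, dotProduct_add]⟩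

theorem sum {ι : Type} (K : Finset ι) {f : ι → (V → ℝ) → ℝ} (h : ∀ i, IsQuad (f i)) :
    IsQuad (fun x => ∑ i ∈ K, f i x) := by
  classical
  induction K using Finset.induction_on with
  | empty => simpa using zero (V := V)
  | insert a K ha ih =>
    simp only [Finset.sum_insert ha]
    exact (h a).add ih

theorem mul (hf : IsAff f) (hf0 : f 0 = 0) (hg : IsAff g) (hg0 : g 0 = 0) :
    IsQuad (fun x => f x * g x) := by
  refine ⟨vecMulVec (slope f) (slope g), fun x => ?_⟩
  have hf' : f x = slope f ⬝ᵥ x := by rw [hf.eval, hf0, zero_add]; rfl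
  have hg' : g x = slope g ⬝ᵥ x := by rw [hg.eval, hg0, zero_add]; rfl
  simp only [hf', hg', vecMulVec_mulVec, dotProduct_comm x, smul_dotProduct,
    MulOpposite.smul_eq_mul_unop, MulOpposite.unop_op]

theorem comp {W : Type} [Fintype W] [DecidableEq W] (hf : IsQuad f)
    {L : (W → ℝ) → V → ℝ} (hL : ∀ v, IsAff (fun x => L x v))
    (hL0 : ∀ v, L 0 v = 0) : IsQuad (fun x => f (L x)) := by
  obtain ⟨A, h⟩ := hf
  have e : (fun x => f (L x)) = fun x => ∑ u, ∑ v, L x u * (A u v * L x v) := by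
    funext x
    simp [h, dotProduct, mulVec, Finset.mul_sum]
  rw [e]
  refine sum _ fun u => sum _ fun v => mul (hL u) (hL0 u) ((hL v).const_mul _) ?_
  simp [hL0]

theorem hess_eq {A : Matrix V V ℝ} (h : ∀ x, f x = x ⬝ᵥ A *ᵥ x) : quadHess f = A + Aᵀ := by
  ext u v
  simp only [quadHess, h, mulVec_add, dotProduct_add, add_dotProduct, Matrix.add_apply,
    transpose_apply, mulVec_single_one, single_one_dotProduct, zero_dotProduct, col_apply]
  ring

/-- Without a linear part the gradient is the Hessian applied to `x`, so the stored Hessian suffices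
for gradients too. -/
theorem grad_eq (hf : IsQuad f) (x : V → ℝ) (v : V) :
    quadGrad f x v = ∑ u, quadHess f v u * x u := by
  obtain ⟨A, h⟩ := hf
  have e : ∑ u, quadHess f v u * x u = (A *ᵥ x) v + (x ᵥ* A) v := by
    rw [hess_eq h, ← mulVec_transpose, ← Pi.add_apply, ← add_mulVec]
    rfl
  rw [e]
  simp only [quadGrad, h, mulVec_add, mulVec_sub, dotProduct_add, add_dotProduct, dotProduct_sub,
    sub_dotProduct, mulVec_single_one, single_one_dotProduct, col_apply]
  have e2 : x ⬝ᵥ A.col v = (x ᵥ* A) v := rfl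
  rw [e2]
  ring

theorem dot_hess (hf : IsQuad f) (x : V → ℝ) : x ⬝ᵥ quadHess f *ᵥ x = 2 * f x := by
  obtain ⟨A, h⟩ := hf
  rw [hess_eq h, h, add_mulVec, dotProduct_add, mulVec_transpose, dotProduct_comm x (x ᵥ* A),
    ← dotProduct_mulVec]
  ring

theorem symPos_hess (hf : IsQuad f) (hpos : ∀ x, x ≠ 0 → 0 < f x) : SymPos (quadHess f) := by
  constructor
  · obtain ⟨A, h⟩ := hf
    rw [Matrix.IsSymm, hess_eq h, transpose_add, transpose_transpose, add_comm]
  · intro x hx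
    rw [hf.dot_hess]
    linarith [hpos x hx]

end IsQuad

end Quadratic

/-! ### Affine and quadratic structure of one agent -/

namespace Agent

open Matrix

variable {d : Dims}

theorem isAff_feedForward (q : d.Inp) : IsAff (fun c : d.Ctrl → ℝ => feedForward c q) :=
  IsAff.coord _

theorem isAff_gainMat (p : d.Inp) (q : d.St) : IsAff (fun c : d.Ctrl → ℝ => gainMat c p q) := by
  unfold gainMat
  split_ifs with h
  · exact IsAff.coord _
  · exact IsAff.const 0

theorem isAff_dot_mean (a : Agent d) (v : d.St → ℝ) : IsAff (fun c => v ⬝ᵥ a.mean c) := by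
  simp only [mean, dotProduct, Pi.add_apply, mulVec]
  refine IsAff.sum _ fun p _ => IsAff.const_mul (IsAff.add (IsAff.const _) ?_) _
  exact IsAff.sum _ fun q _ => (isAff_feedForward q).const_mul _

theorem isAff_pos (a : Agent d) (k : d.Time) (r : Fin d.m) : IsAff (fun c => a.pos c k r) :=
  a.isAff_dot_mean _

theorem isAff_dev (a : Agent d) (v : d.St → ℝ) (z : d.Zeta) : IsAff (fun c => a.dev v c z) := by
  simp only [dev, M, Pi.smul_apply, smul_eq_mul, mulVec, dotProduct, transpose_apply, mul_apply,
    Matrix.add_apply]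
  refine IsAff.const_mul (IsAff.sum _ fun i _ => IsAff.const_mul (IsAff.sum _ fun j _ =>
    IsAff.const_mul (IsAff.sum _ fun p _ => IsAff.mul_const (IsAff.sum _ fun q _ =>
    IsAff.mul_const (IsAff.add (IsAff.sum _ fun u _ => IsAff.const_mul ?_ _) (IsAff.const _))
    _) _) _) _) _
  exact isAff_gainMat _ _

theorem isQuad_cost (a : Agent d) : IsQuad a.cost := by
  unfold cost
  refine IsQuad.add ?_ (IsQuad.sum _ fun p => IsQuad.sum _ fun q => ?_)
  · simp only [dotProduct, mulVec, Finset.mul_sum]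
    refine IsQuad.sum _ fun p => IsQuad.sum _ fun q => ?_
    exact IsQuad.mul (isAff_feedForward p) rfl ((isAff_feedForward q).const_mul _)
      (by simp [feedForward])
  · simp only [pow_two]
    have h : IsAff (fun c : d.Ctrl → ℝ => (a.RK * gainMat c) p q) := by
      simp only [mul_apply]
      exact IsAff.sum _ fun u _ => (isAff_gainMat u q).const_mul _
    have h0 : (a.RK * gainMat (0 : d.Ctrl → ℝ)) p q = 0 := by
      simp [mul_apply, gainMat]
    exact IsQuad.mul h h0 h h0

/-- A zero cost kills `ū` by definiteness of `Ru` and the gain matrix by invertibility of `RK`;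
every gain parameter is an entry of the gain matrix. -/
theorem Valid.cost_pos {a : Agent d} (h : a.Valid) (c : d.Ctrl → ℝ) (hc : c ≠ 0) :
    0 < a.cost c := by
  have h1 : 0 ≤ feedForward c ⬝ᵥ (a.Ru *ᵥ feedForward c) := by
    simpa using h.Ru_pos.posSemidef.dotProduct_mulVec_nonneg (feedForward c)
  have h2 : 0 ≤ ∑ p, ∑ q, (a.RK * gainMat c) p q ^ 2 :=
    Finset.sum_nonneg fun p _ => Finset.sum_nonneg fun q _ => sq_nonneg _
  refine lt_of_le_of_ne (add_nonneg h1 h2) fun h0 => hc ?_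
  have e1 : feedForward c ⬝ᵥ (a.Ru *ᵥ feedForward c) = 0 := by
    unfold cost at h0; linarith
  have e2 : ∑ p, ∑ q, (a.RK * gainMat c) p q ^ 2 = 0 := by
    unfold cost at h0; linarith
  have f1 : feedForward c = 0 := by
    by_contra hne
    have := h.Ru_pos.dotProduct_mulVec_pos hne
    simp only [star_trivial] at this
    linarith
  have f2 : a.RK * gainMat c = 0 := by
    ext p q
    have := (Finset.sum_eq_zero_iff_of_nonneg fun p _ => Finset.sum_nonneg
      fun q _ => sq_nonneg ((a.RK * gainMat c) p q)).1 e2 p (Finset.mem_univ p)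
    have := (Finset.sum_eq_zero_iff_of_nonneg
      fun q _ => sq_nonneg ((a.RK * gainMat c) p q)).1 this q (Finset.mem_univ q)
    simpa using this
  have f3 : gainMat c = 0 := by
    have := congrArg (fun N => a.RK⁻¹ * N) f2
    simpa [← Matrix.mul_assoc, nonsing_inv_mul _ h.RK_inv] using this
  ext (q | ⟨⟨⟨k, l⟩, hw⟩, u, v⟩)
  · exact congrFun f1 q
  · have := congrFun (congrFun f3 (k, u)) (l, v)
    simpa [gainMat, hw] using this

theorem Valid.symPos_cost {a : Agent d} (h : a.Valid) : SymPos (quadHess a.cost) :=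
  a.isQuad_cost.symPos_hess h.cost_pos

theorem Valid.cost_mul_inv {a : Agent d} (h : a.Valid) :
    quadHess a.cost * (quadHess a.cost)⁻¹ = 1 :=
  mul_nonsing_inv _ h.symPos_cost.isUnit_det

/-- The mean depends on `ū` only through `Gu`, so the assumed independence of the rows `aTight r ᵥ*
Gu` becomes independence of the equality constraints of the program. -/
theorem slope_dot_mean (a : Agent d) (v : d.St → ℝ) (q : d.Inp) :
    slope (fun c => v ⬝ᵥ a.mean c) (Sum.inl q) = (v ᵥ* a.Gu) q := by
  have h1 : feedForward (Pi.single (Sum.inl q) 1 : d.Ctrl → ℝ) = Pi.single q 1 := by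
    ext p
    simp [feedForward, Pi.single_apply]
  have h0 : feedForward (0 : d.Ctrl → ℝ) = 0 := rfl
  simp only [slope, mean, h1, h0, dotProduct_add, mulVec_zero, add_zero,
    add_sub_cancel_left, mulVec_single_one]
  rfl

end Agent

/-! ### Linearization of the Euclidean norm -/

section Norms

variable {n : ℕ}

theorem nrm_nonneg (z : Fin n → ℝ) : 0 ≤ nrm z := Real.sqrt_nonneg _

theorem dotProduct_self_nonneg' (z : Fin n → ℝ) : 0 ≤ z ⬝ᵥ z :=
  Finset.sum_nonneg fun i _ => mul_self_nonneg (z i)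

theorem nrm_sq (z : Fin n → ℝ) : nrm z ^ 2 = z ⬝ᵥ z := Real.sq_sqrt (dotProduct_self_nonneg' z)

theorem linNrm_self {z : Fin n → ℝ} : linNrm z z = nrm z := by simp [linNrm]

/-- The tangent of a convex function lies below it; here this is Cauchy-Schwarz. Linearized
collision constraints are therefore stricter than the original ones. -/
theorem linNrm_le {zl : Fin n → ℝ} (h : 0 < nrm zl) (z : Fin n → ℝ) : linNrm zl z ≤ nrm z := by
  have hcs : (zl ⬝ᵥ z) ^ 2 ≤ (nrm zl * nrm z) ^ 2 := by
    rw [mul_pow, nrm_sq, nrm_sq]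
    have := Finset.sum_mul_sq_le_sq_mul_sq Finset.univ zl z
    simpa [dotProduct, pow_two] using this
  have h1 : zl ⬝ᵥ z ≤ nrm zl * nrm z :=
    (abs_le_of_sq_le_sq' hcs (mul_nonneg h.le (nrm_nonneg z))).2
  rw [linNrm, dotProduct_sub, ← nrm_sq, ← sub_nonneg]
  have e : nrm z - (nrm zl + (zl ⬝ᵥ z - nrm zl ^ 2) / nrm zl)
      = (nrm zl * nrm z - zl ⬝ᵥ z) / nrm zl := by
    field_simp
    ring
  rw [e]
  exact div_nonneg (by linarith) h.le

end Norms

/-! ### Functions of some of the variables -/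

section Restriction

variable {V W : Type} [Fintype V] [DecidableEq V] [Fintype W] [DecidableEq W]

theorem single_comp_injective {ι : W → V} (hι : Function.Injective ι) (w : W) :
    (fun c => (Pi.single (ι w) 1 : V → ℝ) (ι c)) = Pi.single w 1 := by
  ext c
  simp [Pi.single_apply, hι.eq_iff]

theorem single_comp_of_notMem {ι : W → V} {v : V} (hv : v ∉ Set.range ι) :
    (fun c => (Pi.single v 1 : V → ℝ) (ι c)) = 0 := by
  ext c
  have : ι c ≠ v := fun h => hv ⟨c, h⟩
  simp [this]

theorem slope_comp {ι : W → V} (hι : Function.Injective ι) (f : (W → ℝ) → ℝ) (w : W) :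
    slope (fun x : V → ℝ => f (fun c => x (ι c))) (ι w) = slope f w := by
  simp only [slope, single_comp_injective hι]
  rfl

theorem slope_comp_of_notMem {ι : W → V} {v : V} (hv : v ∉ Set.range ι) (f : (W → ℝ) → ℝ) :
    slope (fun x : V → ℝ => f (fun c => x (ι c))) v = 0 := by
  simp only [slope, single_comp_of_notMem hv]
  exact sub_self _

theorem IsAff.reindex {f : (W → ℝ) → ℝ} (hf : IsAff f) (ι : W → V) :
    IsAff (fun x : V → ℝ => f (fun c => x (ι c))) :=
  hf.comp fun w => IsAff.coord (ι w)

/-- Coefficients of variables outside the range of `ι` are the constant zero and cost nothing, so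
the table of one agent serves in the full set of variables. -/
theorem Tab.reindex {D : Type} {S : Set (D → ℝ)} {k : ℕ} {f : D → (W → ℝ) → ℝ} (hf : Tab S k f)
    {ι : W → V} (hι : Function.Injective ι) :
    Tab S k (fun s (x : V → ℝ) => f s (fun c => x (ι c))) where
  aff s := (hf.aff s).reindex ι
  slope v := by
    by_cases hv : v ∈ Set.range ι
    · obtain ⟨w, rfl⟩ := hv
      exact (hf.slope w).congr fun s => slope_comp hι _ w
    · exact (Cost.const 0).congr fun s => slope_comp_of_notMem hv _
  const := hf.const

theorem Tab.eval_of {D : Type} {S : Set (D → ℝ)} {k : ℕ} {f : D → (V → ℝ) → ℝ} (h : Tab S k f)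
    {x : D → V → ℝ} (hx : ∀ v, Cost S 0 (fun s => x s v)) :
    Cost S ((k + 2) * (Fintype.card V + 1)) (fun s => f s (x s)) := by
  refine ((h.const.add (Cost.dot h.slope hx)).mono ?_).congr fun s => (h.aff s).eval (x s)
  ring_nf
  omega

end Restriction

/-! ### Quadratic forms in the first block of variables -/

section QuadraticRestriction

open Matrix

variable {X Y : Type} [Fintype X] [DecidableEq X] [Fintype Y] [DecidableEq Y]

theorem quadHess_comp_inl (f : (X → ℝ) → ℝ) :
    quadHess (fun x : X ⊕ Y → ℝ => f (fun c => x (Sum.inl c)))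
      = fromBlocks (quadHess f) 0 0 0 := by
  have hl := single_comp_injective (ι := (Sum.inl : X → X ⊕ Y)) Sum.inl_injective
  have hr : ∀ y : Y, (fun c => (Pi.single (Sum.inr y) 1 : X ⊕ Y → ℝ) (Sum.inl c)) = 0 :=
    fun y => single_comp_of_notMem (by simp)
  have hadd : ∀ z z' : X ⊕ Y → ℝ, (fun c => (z + z') (Sum.inl c))
      = (fun c => z (Sum.inl c)) + fun c => z' (Sum.inl c) := fun _ _ => rfl
  have h0 : (fun c => (0 : X ⊕ Y → ℝ) (Sum.inl c)) = 0 := rfl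
  ext (u | u) (v | v) <;> simp only [quadHess, hadd, hl, hr, h0] <;> simp [quadHess]

theorem quadGrad_comp_inl {f : (X → ℝ) → ℝ} (hf : IsQuad f) (x : X ⊕ Y → ℝ) (v : X ⊕ Y) :
    quadGrad (fun x : X ⊕ Y → ℝ => f (fun c => x (Sum.inl c))) x v
      = Sum.elim (fun i => ∑ u, quadHess f i u * x (Sum.inl u)) (fun _ => 0) v := by
  have hl := single_comp_injective (ι := (Sum.inl : X → X ⊕ Y)) Sum.inl_injective
  have hr : ∀ y : Y, (fun c => (Pi.single (Sum.inr y) 1 : X ⊕ Y → ℝ) (Sum.inl c)) = 0 :=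
    fun y => single_comp_of_notMem (by simp)
  have hadd : ∀ z z' : X ⊕ Y → ℝ, (fun c => (z + z') (Sum.inl c))
      = (fun c => z (Sum.inl c)) + fun c => z' (Sum.inl c) := fun _ _ => rfl
  have hsub : ∀ z z' : X ⊕ Y → ℝ, (fun c => (z - z') (Sum.inl c))
      = (fun c => z (Sum.inl c)) - fun c => z' (Sum.inl c) := fun _ _ => rfl
  rcases v with v | v
  · rw [Sum.elim_inl, ← hf.grad_eq (fun c => x (Sum.inl c))]
    simp only [quadGrad, hadd, hsub, hl]
  · simp only [quadGrad, hadd, hsub, hr]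
    simp

end QuadraticRestriction

/-! ### Tables from the coefficients of an agent -/

section AgentTables

variable {D : Type} {d : Dims} {S S' : Set (D → ℝ)} {ag : D → Agent d}

/-- The coefficients of an agent are available. -/
def HasCoefficients (S : Set (D → ℝ)) (ag : D → Agent d) : Prop :=
  ∀ g ∈ Agent.coefficients d, (fun s => g (ag s)) ∈ S

namespace HasCoefficients

theorem of_subset (h : HasCoefficients S ag) (hS : S ⊆ S') : HasCoefficients S' ag :=
  fun g hg => hS (h g hg)

theorem cost_of (h : HasCoefficients S ag) {g : Agent d → ℝ} (hg : g ∈ Agent.coefficients d) :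
    Cost S 0 (fun s => g (ag s)) := Cost.of_mem (h g hg)

theorem hess (h : HasCoefficients S ag) (u v : d.Ctrl) :
    Cost S 0 (fun s => (fun a => quadHess a.cost u v) (ag s)) :=
  h.cost_of (Or.inl (Or.inl (Or.inl (Or.inl (Or.inl (Or.inl (Or.inl (Or.inl (Or.inl (Or.inl (Or.inl (Or.inl (Or.inl (Or.inl (Or.inl (Or.inl (Or.inl (Or.inl ⟨(u, v), rfl⟩))))))))))))))))))

theorem hess_inv (h : HasCoefficients S ag) (u v : d.Ctrl) :
    Cost S 0 (fun s => (fun a => (quadHess a.cost)⁻¹ u v) (ag s)) :=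
  h.cost_of (Or.inl (Or.inl (Or.inl (Or.inl (Or.inl (Or.inl (Or.inl (Or.inl (Or.inl (Or.inl (Or.inl (Or.inl (Or.inl (Or.inl (Or.inl (Or.inl (Or.inl (Or.inr ⟨(u, v), rfl⟩))))))))))))))))))

theorem bLin (h : HasCoefficients S ag) (r : Fin d.nlin) :
    Cost S 0 (fun s => (fun a => a.bLin r) (ag s)) :=
  h.cost_of (Or.inl (Or.inl (Or.inl (Or.inl (Or.inr ⟨r, rfl⟩)))))

theorem ε (h : HasCoefficients S ag) (r : Fin d.ntight) :
    Cost S 0 (fun s => (fun a => a.ε r) (ag s)) :=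
  h.cost_of (Or.inl (Or.inl (Or.inr ⟨r, rfl⟩)))

theorem bTight (h : HasCoefficients S ag) (r : Fin d.ntight) :
    Cost S 0 (fun s => (fun a => a.bTight r) (ag s)) :=
  h.cost_of (Or.inl (Or.inl (Or.inl (Or.inr ⟨r, rfl⟩))))

theorem center (h : HasCoefficients S ag) (o : Fin d.nobs) (r : Fin d.m) :
    Cost S 0 (fun s => (fun a => a.center o r) (ag s)) :=
  h.cost_of (Or.inl (Or.inr ⟨(o, r), rfl⟩))

theorem cObs (h : HasCoefficients S ag) (o : Fin d.nobs) :
    Cost S 0 (fun s => (fun a => a.cObs o) (ag s)) :=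
  h.cost_of (Or.inr ⟨o, rfl⟩)

theorem pos (h : HasCoefficients S ag) (k : d.Time) (r : Fin d.m) :
    Tab S 0 (fun s => (fun a c => a.pos c k r) (ag s)) where
  aff s := (ag s).isAff_pos k r
  slope v := h.cost_of (g := fun a => slope (fun c => a.pos c k r) v)
    (Or.inl (Or.inl (Or.inl (Or.inl (Or.inl (Or.inl (Or.inl (Or.inl (Or.inl (Or.inl (Or.inl (Or.inl (Or.inl (Or.inl (Or.inl (Or.inr ⟨(k, r, v), rfl⟩))))))))))))))))
  const := h.cost_of (g := fun a => a.pos 0 k r)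
    (Or.inl (Or.inl (Or.inl (Or.inl (Or.inl (Or.inl (Or.inl (Or.inl (Or.inl (Or.inl (Or.inl (Or.inl (Or.inl (Or.inl (Or.inl (Or.inl (Or.inr ⟨(k, r), rfl⟩)))))))))))))))))

theorem dev_pos (h : HasCoefficients S ag) (k : d.Time) (r : Fin d.m) (z : d.Zeta) :
    Tab S 0 (fun s => (fun a c => a.dev (a.posRow k r) c z) (ag s)) where
  aff s := (ag s).isAff_dev _ z
  slope v := h.cost_of (g := fun a => slope (fun c => a.dev (a.posRow k r) c z) v)
    (Or.inl (Or.inl (Or.inl (Or.inl (Or.inl (Or.inl (Or.inl (Or.inl (Or.inl (Or.inl (Or.inl (Or.inl (Or.inl (Or.inr ⟨(k, r, z, v), rfl⟩))))))))))))))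
  const := h.cost_of (g := fun a => a.dev (a.posRow k r) 0 z)
    (Or.inl (Or.inl (Or.inl (Or.inl (Or.inl (Or.inl (Or.inl (Or.inl (Or.inl (Or.inl (Or.inl (Or.inl (Or.inl (Or.inl (Or.inr ⟨(k, r, z), rfl⟩)))))))))))))))

theorem mean_lin (h : HasCoefficients S ag) (r : Fin d.nlin) :
    Tab S 0 (fun s => (fun a c => a.aLin r ⬝ᵥ a.mean c) (ag s)) where
  aff s := (ag s).isAff_dot_mean _
  slope v := h.cost_of (g := fun a => slope (fun c => a.aLin r ⬝ᵥ a.mean c) v)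
    (Or.inl (Or.inl (Or.inl (Or.inl (Or.inl (Or.inl (Or.inl (Or.inl (Or.inl (Or.inl (Or.inl (Or.inr ⟨(r, v), rfl⟩))))))))))))
  const := h.cost_of (g := fun a => a.aLin r ⬝ᵥ a.mean 0)
    (Or.inl (Or.inl (Or.inl (Or.inl (Or.inl (Or.inl (Or.inl (Or.inl (Or.inl (Or.inl (Or.inl (Or.inl (Or.inr ⟨r, rfl⟩)))))))))))))

theorem dev_lin (h : HasCoefficients S ag) (r : Fin d.nlin) (z : d.Zeta) :
    Tab S 0 (fun s => (fun a c => a.dev (a.aLin r) c z) (ag s)) where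
  aff s := (ag s).isAff_dev _ z
  slope v := h.cost_of (g := fun a => slope (fun c => a.dev (a.aLin r) c z) v)
    (Or.inl (Or.inl (Or.inl (Or.inl (Or.inl (Or.inl (Or.inl (Or.inl (Or.inl (Or.inr ⟨(r, z, v), rfl⟩))))))))))
  const := h.cost_of (g := fun a => a.dev (a.aLin r) 0 z)
    (Or.inl (Or.inl (Or.inl (Or.inl (Or.inl (Or.inl (Or.inl (Or.inl (Or.inl (Or.inl (Or.inr ⟨(r, z), rfl⟩)))))))))))

theorem mean_tight (h : HasCoefficients S ag) (r : Fin d.ntight) :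
    Tab S 0 (fun s => (fun a c => a.aTight r ⬝ᵥ a.mean c) (ag s)) where
  aff s := (ag s).isAff_dot_mean _
  slope v := h.cost_of (g := fun a => slope (fun c => a.aTight r ⬝ᵥ a.mean c) v)
    (Or.inl (Or.inl (Or.inl (Or.inl (Or.inl (Or.inl (Or.inl (Or.inr ⟨(r, v), rfl⟩))))))))
  const := h.cost_of (g := fun a => a.aTight r ⬝ᵥ a.mean 0)
    (Or.inl (Or.inl (Or.inl (Or.inl (Or.inl (Or.inl (Or.inl (Or.inl (Or.inr ⟨r, rfl⟩)))))))))

theorem dev_tight (h : HasCoefficients S ag) (r : Fin d.ntight) (z : d.Zeta) :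
    Tab S 0 (fun s => (fun a c => a.dev (a.aTight r) c z) (ag s)) where
  aff s := (ag s).isAff_dev _ z
  slope v := h.cost_of (g := fun a => slope (fun c => a.dev (a.aTight r) c z) v)
    (Or.inl (Or.inl (Or.inl (Or.inl (Or.inl (Or.inr ⟨(r, z, v), rfl⟩))))))
  const := h.cost_of (g := fun a => a.dev (a.aTight r) 0 z)
    (Or.inl (Or.inl (Or.inl (Or.inl (Or.inl (Or.inl (Or.inr ⟨(r, z), rfl⟩)))))))

end HasCoefficients

end AgentTables

/-! ### Cost of linearizing and running the interior-point method -/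

section Linearized

variable {D X Y L E B₁ R₁ B₂ R₂ J : Type} [Fintype X] [DecidableEq X] [Fintype Y] [DecidableEq Y]
  [Fintype L] [Fintype E] [DecidableEq E] [Fintype B₁]
  [Fintype R₁] [Fintype B₂] [Fintype R₂]
  [Fintype J] {S S' : Set (D → ℝ)} {k : ℕ}

theorem Tab.store {V ι : Type} [Fintype V] [DecidableEq V] [Fintype ι]
    {f : ι → D → (V → ℝ) → ℝ} (h : ∀ i, Tab S k (f i)) {l : ℕ} {G : Set (D → ℝ)}
    (next : ∀ S', S ⊆ S' → (∀ i, Tab S' 0 (f i)) → Cheap S' l G) :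
    Cheap S (Fintype.card ι * ((Fintype.card V + 1) * k) + l) G := by
  have h1 : ∀ q : ι × Option V, Cost S k
      (q.2.elim (fun s => f q.1 s 0) (fun v s => RobustMAS.slope (f q.1 s) v)) := by
    rintro ⟨i, _ | v⟩
    · exact (h i).const
    · exact (h i).slope v
  refine Cheap.mono (Cheap.stage h1 fun S' hS h2 => next S' hS fun i => ?_) ?_
  · exact ⟨(h i).aff, fun v => h2 (i, some v), h2 (i, none)⟩
  · rw [Fintype.card_prod, Fintype.card_option, mul_assoc]

/-- Each coefficient is a product sum of length `m`, divided by the stored norm and shifted: `4 m +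
2` operations. Subtracting the slack makes `4 m + 3`, the per-coefficient cost used below. -/
theorem Tab.linNrm {V : Type} [Fintype V] [DecidableEq V] {m : ℕ}
    {z : D → (V → ℝ) → Fin m → ℝ} {zl : D → Fin m → ℝ}
    (hz : ∀ r, Tab S 1 (fun s x => z s x r)) (hzl : ∀ r, Cost S 0 (fun s => zl s r))
    (hn : Cost S 0 (fun s => nrm (zl s))) (h0 : ∀ s, nrm (zl s) ≠ 0) :
    Tab S (4 * m + 2) (fun s x => RobustMAS.linNrm (zl s) (z s x)) := by
  have h1 := (Tab.of_const (V := V) hn).add ((Tab.sum fun r =>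
    Tab.const_mul (hzl r) ((hz r).sub (Tab.of_const (hzl r)))).div_const hn h0)
  refine Tab.mono h1 ?_
  rw [Fintype.card_fin]
  omega

variable {P : D → ConicProgram (X ⊕ Y) L E B₁ R₁ B₂ R₂}

theorem ConstraintTab.store (h : ConstraintTab S k P) {l : ℕ} {G : Set (D → ℝ)} (J : Type)
    [Fintype J] (next : ∀ S', S ⊆ S' → ConstraintTab S' 0 P → Cheap S' l G) :
    Cheap S (rankCount Y L E B₁ R₁ B₂ R₂ J * ((Fintype.card (X ⊕ Y) + 1) * k) + l) G := by
  have h1 : ∀ q : L ⊕ E ⊕ B₁ ⊕ (B₁ × R₁) ⊕ B₂ ⊕ (B₂ × R₂), Tab S k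
      (Sum.elim (fun l s => (P s).lin l) (Sum.elim (fun e s => (P s).eqn e)
        (Sum.elim (fun b s => ((P s).soc₁ b).top)
        (Sum.elim (fun q s => ((P s).soc₁ q.1).body q.2) (Sum.elim (fun b s => ((P s).soc₂ b).top)
        (fun q s => ((P s).soc₂ q.1).body q.2))))) q) := by
    rintro (l | e | b | q | b | q)
    exacts [h.lin l, h.eqn e, h.top₁ b, h.body₁ q.1 q.2, h.top₂ b, h.body₂ q.1 q.2]
  refine Cheap.mono (Tab.store h1 fun S' hS h2 => next S' hS ?_) ?_
  · exact ⟨fun l => h2 (.inl l), fun e => h2 (.inr (.inl e)), fun b => h2 (.inr (.inr (.inl b))),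
      fun b r => h2 (.inr (.inr (.inr (.inl (b, r))))),
      fun b => h2 (.inr (.inr (.inr (.inr (.inl b))))),
      fun b r => h2 (.inr (.inr (.inr (.inr (.inr (b, r))))))⟩
  · refine Nat.add_le_add_right (Nat.mul_le_mul_right _ ?_) _
    simp only [Fintype.card_sum, Fintype.card_prod, rankCount, mul_add]
    omega

variable {m : ℕ} {rel : D → L → (X ⊕ Y → ℝ) → Fin m → ℝ} {slack : L → X ⊕ Y}
  {xl : D → X ⊕ Y → ℝ} {Q Qi : D → Matrix X X ℝ} {α w : D → J → ℝ} {p : D → J → X ⊕ Y → ℝ}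

/-- The cost of linearizing at `xl` and then running the interior-point method from `xl`. -/
theorem linearized_ipm_cheap
    (hrel : ∀ l r, Tab S 1 (fun s x => rel s l x r)) (hxl : ∀ v, Cost S 0 (fun s => xl s v))
    (hne : ∀ s l, nrm (rel s l (xl s)) ≠ 0)
    (hlin : ∀ s l, (P s).lin l = fun x => linNrm (rel s l (xl s)) (rel s l x) - x (slack l))
    (heqn : ∀ e, Tab S (4 * m + 3) (fun s => (P s).eqn e))
    (htop₁ : ∀ b, Tab S (4 * m + 3) (fun s => ((P s).soc₁ b).top))
    (hbody₁ : ∀ b r, Tab S (4 * m + 3) (fun s => ((P s).soc₁ b).body r))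
    (htop₂ : ∀ b, Tab S (4 * m + 3) (fun s => ((P s).soc₂ b).top))
    (hbody₂ : ∀ b r, Tab S (4 * m + 3) (fun s => ((P s).soc₂ b).body r))
    (hO : ObjectiveTab S Q Qi α w p) (hreg : ∀ s, (P s).Regular (Q s) (α s) (w s) (p s))
    {t : D → ℕ → ℝ} (ht : ∀ j, Cost S 0 (fun s => t s j)) (ht0 : ∀ s j, 0 < t s j)
    (hx : ∀ s, (P s).Interior (xl s)) (i : ℕ) :
    Cheap S (i * ((20 * m + 60) * ((Fintype.card (X ⊕ Y) + 1) ^ 2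
        * (rankCount Y L E B₁ R₁ B₂ R₂ J + 1))))
      (Set.range fun v s => (P s).ipm (t s) (xl s) i v) := by
  -- With no iteration nothing is computed, not even the linearization. Otherwise the linearization
  -- is charged to the first iteration.
  rcases Nat.eq_zero_or_pos i with rfl | hi
  · exact (Cheap.range (k := 0) hxl).mono (by simp)
  set n := Fintype.card (X ⊕ Y) with hn
  set r := rankCount Y L E B₁ R₁ B₂ R₂ J with hr
  have hr' : r = Fintype.card L + Fintype.card E + Fintype.card B₁ * (Fintype.card R₁ + 2)
    + Fintype.card B₂ * (Fintype.card R₂ + 2) + Fintype.card J + Fintype.card Y := hr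
  have hL : Fintype.card L ≤ r := by omega
  refine Cheap.mono (k := Fintype.card (L × Fin m) * ((1 + 2) * (n + 1))
    + (Fintype.card L * (m * 2 + 1)
    + (r * ((n + 1) * (4 * m + 3)) + i * (40 * (n + 1) ^ 2 * (r + 1))))) ?_ ?_
  · refine Cheap.stage (f := fun q s => rel s q.1 (xl s) q.2)
      (fun q => (hrel q.1 q.2).eval_of hxl) fun S₁ s₁ hz => ?_
    refine Cheap.stage (f := fun l s => nrm (rel s l (xl s))) (fun l => ?_) fun S₂ s₂ hnz => ?_
    · have := (Cost.dot (fun r => hz (l, r)) (fun r => hz (l, r))).sqrt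
        fun s => dotProduct_self_nonneg' (rel s l (xl s))
      rw [Fintype.card_fin] at this
      exact this
    have s₁₂ := s₁.trans s₂
    have hP : ConstraintTab S₂ (4 * m + 3) P := by
      refine ⟨fun l => ?_, fun e => (heqn e).of_subset s₁₂, fun b => (htop₁ b).of_subset s₁₂,
        fun b r => (hbody₁ b r).of_subset s₁₂, fun b => (htop₂ b).of_subset s₁₂,
        fun b r => (hbody₂ b r).of_subset s₁₂⟩
      simp only [hlin]
      exact (Tab.linNrm (fun r => (hrel l r).of_subset s₁₂) (fun r => (hz (l, r)).of_subset s₂)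
        (hnz l) fun s => hne s l).sub (Tab.coord (k := 0) (slack l))
    refine hP.store J fun S₃ s₃ hP => ?_
    have s₁₃ := s₁₂.trans s₃
    exact ipm_cheap hP (hO.of_subset s₁₃) hreg (fun j => (ht j).of_subset s₁₃) ht0
      (fun v => (hxl v).of_subset s₁₃) hx i
  · rw [Fintype.card_prod, Fintype.card_fin]
    have e1 : Fintype.card L * m * ((1 + 2) * (n + 1)) ≤ 3 * m * ((n + 1) ^ 2 * (r + 1)) := by
      calc Fintype.card L * m * ((1 + 2) * (n + 1))
          = 3 * m * ((n + 1) * Fintype.card L) := by ring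
        _ ≤ 3 * m * ((n + 1) ^ 2 * (r + 1)) :=
          Nat.mul_le_mul_left _ (Nat.mul_le_mul (by nlinarith) (by omega))
    have e2 : Fintype.card L * (m * 2 + 1) ≤ (m * 2 + 1) * ((n + 1) ^ 2 * (r + 1)) := by
      rw [mul_comm]
      refine Nat.mul_le_mul_left _ ?_
      nlinarith [Nat.zero_le (n * r), Nat.zero_le (n ^ 2 * r)]
    have e3 : r * ((n + 1) * (4 * m + 3)) ≤ (4 * m + 3) * ((n + 1) ^ 2 * (r + 1)) := by
      calc r * ((n + 1) * (4 * m + 3)) = (4 * m + 3) * ((n + 1) * r) := by ring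
        _ ≤ _ := Nat.mul_le_mul_left _ (Nat.mul_le_mul (by nlinarith) (by omega))
    set T := (n + 1) ^ 2 * (r + 1)
    have e4 : 1 * T ≤ i * T := Nat.mul_le_mul_right _ hi
    have e5 : m * (1 * T) ≤ m * (i * T) := Nat.mul_le_mul_left _ e4
    have e6 : i * (40 * (n + 1) ^ 2 * (r + 1)) = 40 * (i * T) := by ring
    have e7 : i * ((20 * m + 60) * T) = 20 * (m * (i * T)) + 60 * (i * T) := by ring
    rw [e6, e7]
    have e8 : 0 ≤ m * (i * T) := Nat.zero_le _
    have e9 : 3 * m * T + ((m * 2 + 1) * T + (4 * m + 3) * T) = 9 * (m * (1 * T)) + 4 * (1 * T) := by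
      ring
    omega

end Linearized

/-! ### The centralized program: regularity and feasibility -/

section CentralFacts

open Matrix

variable {d : Dims} {nbr : Fin d.N → Finset (Fin d.N)}

theorem ctrl_index_injective (i : Fin d.N) :
    Function.Injective (fun c => (Sum.inl (i, c) : CVar nbr)) := fun c c' h => by
  simpa using h

namespace Problem

variable {P : Problem d nbr}

/-- The total cost as a function of the control parameters of all agents. -/
noncomputable def totalCost (P : Problem d nbr) (x : Fin d.N × d.Ctrl → ℝ) : ℝ :=
  ∑ i, (P.agent i).cost (fun c => x (i, c))

/-- The block diagonal matrix of the inverses of the cost Hessians. -/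
noncomputable def costInv (P : Problem d nbr) :
    Matrix (Fin d.N × d.Ctrl) (Fin d.N × d.Ctrl) ℝ := fun u v =>
  if u.1 = v.1 then (quadHess (P.agent u.1).cost)⁻¹ u.2 v.2 else 0

theorem isQuad_totalCost (P : Problem d nbr) : IsQuad P.totalCost :=
  IsQuad.sum _ fun i => (P.agent i).isQuad_cost.comp (fun _ => IsAff.coord _) fun _ => rfl

theorem cost_zero (P : Problem d nbr) (i : Fin d.N) : (P.agent i).cost 0 = 0 := by
  obtain ⟨A, h⟩ := (P.agent i).isQuad_cost
  simp [h]

theorem totalCost_pos (hP : P.Valid) (x : Fin d.N × d.Ctrl → ℝ) (hx : x ≠ 0) :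
    0 < P.totalCost x := by
  have hnn : ∀ i ∈ Finset.univ, 0 ≤ (P.agent i).cost (fun c => x (i, c)) := by
    intro i _
    by_cases h : (fun c => x (i, c)) = 0
    · rw [h, P.cost_zero]
    · exact ((hP.1 i).cost_pos _ h).le
  refine lt_of_le_of_ne (Finset.sum_nonneg hnn) fun h0 => hx ?_
  ext ⟨i, c⟩
  have h1 := (Finset.sum_eq_zero_iff_of_nonneg hnn).1 h0.symm i (Finset.mem_univ i)
  by_contra hne
  exact ((hP.1 i).cost_pos (fun c => x (i, c)) fun h => hne (congrFun h c)).ne' h1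

theorem symPos_totalCost (hP : P.Valid) : SymPos (quadHess P.totalCost) :=
  P.isQuad_totalCost.symPos_hess (totalCost_pos hP)

theorem quadHess_totalCost (P : Problem d nbr) (u v : Fin d.N × d.Ctrl) :
    quadHess P.totalCost u v
      = if u.1 = v.1 then quadHess (P.agent u.1).cost u.2 v.2 else 0 := by
  obtain ⟨i, c⟩ := u
  obtain ⟨i', c'⟩ := v
  have hs : ∀ (j i : Fin d.N) (c : d.Ctrl), (fun b => (Pi.single (i, c) 1 : Fin d.N × d.Ctrl → ℝ)
      (j, b)) = if j = i then Pi.single c 1 else 0 := by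
    intro j i c
    ext b
    split_ifs with h <;> simp [Pi.single_apply, h]
  have hadd : ∀ (j) (z z' : Fin d.N × d.Ctrl → ℝ), (fun c => (z + z') (j, c))
      = (fun c => z (j, c)) + fun c => z' (j, c) := fun _ _ _ => rfl
  have h0 : ∀ j, (fun c => (0 : Fin d.N × d.Ctrl → ℝ) (j, c)) = 0 := fun _ => rfl
  simp only [quadHess, totalCost, hadd, hs, h0, P.cost_zero, ← Finset.sum_sub_distrib,
    Finset.sum_const_zero, add_zero]
  rw [Finset.sum_eq_single i]
  · by_cases h : i = i'
    · simp [h]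
    · simp [h, P.cost_zero]
  · intro j _ hj
    simp [hj, P.cost_zero]
  · simp

/-- The cost does not couple the agents, so its Hessian is block diagonal and the given inverses of
the agents' blocks assemble to the full inverse without any inversion. -/
theorem totalCost_mul_inv (hP : P.Valid) : quadHess P.totalCost * P.costInv = 1 := by
  ext ⟨i, c⟩ ⟨i', c'⟩
  rw [mul_apply, Fintype.sum_prod_type]
  simp only [quadHess_totalCost, costInv]
  rw [Finset.sum_eq_single i]
  · by_cases h : i = i'
    · subst h
      have := congrFun (congrFun (hP.1 i).cost_mul_inv c) c'
      rw [mul_apply] at this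
      simpa [one_apply] using this
    · simp [h, one_apply]
  · intro j _ hj
    simp [hj.symm]
  · simp

theorem isAff_relObs (P : Problem d nbr) (i : Fin d.N) (k : d.Time) (o : Fin d.nobs)
    (r : Fin d.m) : IsAff (fun x : CVar nbr → ℝ => P.relObs x i k o r) :=
  ((((P.agent i).isAff_pos k r).reindex fun c => (Sum.inl (i, c) : CVar nbr))).sub (IsAff.const _)

theorem isAff_relInter (P : Problem d nbr) (e : Edge nbr) (k : d.Time)
    (r : Fin d.m) : IsAff (fun x : CVar nbr → ℝ => P.relInter x e k r) :=
  (((P.agent e.1).isAff_pos k r).reindex fun c => (Sum.inl (e.1, c) : CVar nbr)).sub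
    (((P.agent e.2).isAff_pos k r).reindex fun c => (Sum.inl (↑e.2, c) : CVar nbr))

end Problem

theorem isAff_linNrm {V : Type} [Fintype V] [DecidableEq V] {n : ℕ} (zl : Fin n → ℝ)
    {z : (V → ℝ) → Fin n → ℝ} (hz : ∀ r, IsAff (fun x => z x r)) :
    IsAff (fun x => linNrm zl (z x)) :=
  (IsAff.const _).add (IsAff.div_const (IsAff.sum _ fun r _ =>
    ((hz r).sub (IsAff.const _)).const_mul _) _)

namespace Problem

variable {P : Problem d nbr}

theorem central_lin_aff (P : Problem d nbr) (xl : CVar nbr → ℝ) (l) :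
    IsAff ((P.central xl).lin l) := by
  rcases l with ⟨i, k, o⟩ | ⟨e, k⟩
  · exact (isAff_linNrm _ (P.isAff_relObs i k o)).sub (IsAff.coord _)
  · exact (isAff_linNrm _ (P.isAff_relInter e k)).sub (IsAff.coord _)

theorem central_soc₁_aff (P : Problem d nbr) (xl : CVar nbr → ℝ) (b) :
    ((P.central xl).soc₁ b).Aff := by
  rcases b with ⟨i, r⟩ | ⟨i, r⟩ | ⟨i, k, r⟩
  · exact ⟨(IsAff.const _).sub (((P.agent i).isAff_dot_mean _).reindex
      fun c => (Sum.inl (i, c) : CVar nbr)), fun z => ((P.agent i).isAff_dev _ z).reindex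
      fun c => (Sum.inl (i, c) : CVar nbr)⟩
  · exact ⟨IsAff.const _, fun z => ((P.agent i).isAff_dev _ z).reindex
      fun c => (Sum.inl (i, c) : CVar nbr)⟩
  · exact ⟨IsAff.coord _, fun z => ((P.agent i).isAff_dev _ z).reindex
      fun c => (Sum.inl (i, c) : CVar nbr)⟩

theorem central_soc₂_aff (P : Problem d nbr) (xl : CVar nbr → ℝ) (b) :
    ((P.central xl).soc₂ b).Aff := by
  rcases b with ⟨i, k, o⟩ | ⟨e, k⟩
  · exact ⟨(IsAff.coord _).sub (IsAff.const _), fun r => IsAff.coord _⟩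
  · exact ⟨(IsAff.coord _).sub (IsAff.const _), fun r => (IsAff.coord _).add (IsAff.coord _)⟩

/-- Equality constraints of different agents involve disjoint variables; restricting a relation to
the feed-forward columns of one agent reduces it to the assumption on that agent. -/
theorem central_eq_indep (hP : P.Valid) (xl : CVar nbr → ℝ) :
    LinearIndependent ℝ (fun e => (P.central xl).eqMat e) := by
  rw [Fintype.linearIndependent_iff]
  rintro g hg ⟨i, r⟩
  refine Fintype.linearIndependent_iff.1 (hP.1 i).eq_indep (fun r => g (i, r)) ?_ r
  ext q
  have h := congrFun hg (Sum.inl (i, Sum.inl q))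
  rw [Finset.sum_apply, Fintype.sum_prod_type, Finset.sum_eq_single i] at h
  · rw [Finset.sum_apply]
    refine Eq.trans (Finset.sum_congr rfl fun r _ => ?_) h
    simp only [Pi.smul_apply, smul_eq_mul]
    congr 1
    rw [← Agent.slope_dot_mean,
      ← slope_comp (ctrl_index_injective (nbr := nbr) i) _ (Sum.inl q)]
    simp only [ConicProgram.eqMat, central, slope]
    exact (sub_sub_sub_cancel_right _ _ _).symm
  · intro j _ hj
    refine Finset.sum_eq_zero fun r _ => ?_
    have hn : (Sum.inl (i, Sum.inl q) : CVar nbr) ∉ Set.range fun c => Sum.inl (j, c) := by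
      rintro ⟨c, hc⟩
      simp only [Sum.inl.injEq, Prod.mk.injEq] at hc
      exact hj hc.1
    have := slope_comp_of_notMem hn (fun c => (P.agent j).aTight r ⬝ᵥ (P.agent j).mean c)
    simp only [Pi.smul_apply, smul_eq_mul]
    refine mul_eq_zero_of_right _ (Eq.trans ?_ this)
    simp only [ConicProgram.eqMat, central, slope]
    exact sub_sub_sub_cancel_right _ _ _
  · simp

theorem central_regular (hP : P.Valid) (xl : CVar nbr → ℝ) :
    (P.central xl).Regular (quadHess P.totalCost) (Empty.elim : Empty → ℝ) Empty.elim
      (fun j => Empty.elim j) where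
  lin_aff := P.central_lin_aff xl
  soc₁_aff := P.central_soc₁_aff xl
  soc₂_aff := P.central_soc₂_aff xl
  Q_pos := symPos_totalCost hP
  w_pos := fun j => j.elim
  obj_grad x v := by
    refine (quadGrad_comp_inl P.isQuad_totalCost x v).trans ?_
    rw [Fintype.sum_empty, add_zero]
  obj_hess := by
    rw [Fintype.sum_empty, add_zero]
    exact quadHess_comp_inl P.totalCost
  -- Once the controls vanish, the deviation bounds are the tops of the third group in `soc₁`, and
  -- each slack enters its linearized constraint with coefficient `-1`. There are no penalty terms,
  -- hence the index type `Empty`.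
  definite z h1 _ h2 h3 := by
    have hctrl : ∀ i, CVar.ctrl z i = CVar.ctrl (0 : CVar nbr → ℝ) i := fun i =>
      funext fun c => h1 (i, c)
    ext (⟨i, c⟩ | ⟨i, k, r⟩ | ⟨i, k, o⟩ | ⟨e, k⟩)
    · exact h1 (i, c)
    · exact h3 (Sum.inr (Sum.inr (i, k, r)))
    · have := h2 (Sum.inl (i, k, o))
      simp only [central, relObs, hctrl] at this
      simpa [CVar.slackObs] using this
    · have := h2 (Sum.inr (e, k))
      simp only [central, relInter, hctrl] at this
      simpa [CVar.slackInter] using this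
  eq_indep := central_eq_indep hP xl

/-- Strict feasibility for the inequality constraints of the nonconvex problem. -/
structure Feasible (P : Problem d nbr) (x : CVar nbr → ℝ) : Prop where
  obs : ∀ i k o, CVar.slackObs x i k o < nrm (P.relObs x i k o)
  inter : ∀ e k, CVar.slackInter x e k < nrm (P.relInter x e k)
  soc₁ : ∀ b, ((P.central x).soc₁ b).Interior x
  soc₂ : ∀ b, ((P.central x).soc₂ b).Interior x

/-- The chain is ‖relative position‖ > slack > c ≥ 0; the second inequality is the positivity of the
cone's top. The linearization divides by this norm. -/
theorem Feasible.obs_pos (hP : P.Valid) {x : CVar nbr → ℝ} (h : P.Feasible x) (i k o) :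
    0 < nrm (P.relObs x i k o) := by
  have h1 : 0 < CVar.slackObs x i k o - (P.agent i).cObs o := (h.soc₂ (Sum.inl (i, k, o))).1
  linarith [h.obs i k o, (hP.1 i).cObs_nonneg o]

theorem Feasible.inter_pos (hP : P.Valid) {x : CVar nbr → ℝ} (h : P.Feasible x) (e k) :
    0 < nrm (P.relInter x e k) := by
  have h1 : 0 < CVar.slackInter x e k - P.cInter e.1 e.2 := (h.soc₂ (Sum.inr (e, k))).1
  linarith [h.inter e k, hP.2 e.1 e.2]

theorem Feasible.interior {x : CVar nbr → ℝ} (h : P.Feasible x) : (P.central x).Interior x where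
  lin := by
    rintro (⟨i, k, o⟩ | ⟨e, k⟩)
    · have := h.obs i k o
      simp only [central, linNrm_self]
      linarith
    · have := h.inter e k
      simp only [central, linNrm_self]
      linarith
  soc₁ := h.soc₁
  soc₂ := h.soc₂

/-- The linearized constraints imply the original ones by `linNrm_le`. The cone constraints do not
depend on the linearization point, so they carry over unchanged. -/
theorem feasible_of_interior (hP : P.Valid) {xl x : CVar nbr → ℝ} (hl : P.Feasible xl)
    (h : (P.central xl).Interior x) : P.Feasible x where
  obs i k o := by
    have h1 := h.lin (Sum.inl (i, k, o))
    have h2 := linNrm_le (hl.obs_pos hP i k o) (P.relObs x i k o)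
    simp only [central] at h1
    linarith
  inter e k := by
    have h1 := h.lin (Sum.inr (e, k))
    have h2 := linNrm_le (hl.inter_pos hP e k) (P.relInter x e k)
    simp only [central] at h1
    linarith
  soc₁ := h.soc₁
  soc₂ := h.soc₂

end Problem

/-- At its own linearization point the linearized norm is exact, so every outer loop starts strictly
inside its convex program. -/
theorem CentralInstance.feasible (s : CentralInstance d nbr) (LIP l : ℕ) :
    s.prob.Feasible (s.solve LIP l) := by
  induction l with
  | zero => exact ⟨s.start_interior.obs, s.start_interior.inter, s.start_interior.soc₁,
      s.start_interior.soc₂⟩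
  | succ l ih =>
    exact Problem.feasible_of_interior s.valid ih
      ((Problem.central_regular s.valid _).interior_ipm s.t_pos ih.interior LIP)

end CentralFacts

/-! ### Cost of the centralized approach -/

section CentralCost

variable {d : Dims} {nbr : Fin d.N → Finset (Fin d.N)} {S : Set (CentralInstance d nbr → ℝ)}

/-- The number of rank-one updates in a Newton step of the centralized approach. -/
abbrev centralRank (d : Dims) (nbr : Fin d.N → Finset (Fin d.N)) : ℕ :=
  rankCount ((Fin d.N × d.Time × Fin d.m) ⊕ (Fin d.N × d.Time × Fin d.nobs) ⊕ (Edge nbr × d.Time))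
    ((Fin d.N × d.Time × Fin d.nobs) ⊕ (Edge nbr × d.Time)) (Fin d.N × Fin d.ntight)
    ((Fin d.N × Fin d.nlin) ⊕ (Fin d.N × Fin d.ntight) ⊕ (Fin d.N × d.Time × Fin d.m)) d.Zeta
    ((Fin d.N × d.Time × Fin d.nobs) ⊕ (Edge nbr × d.Time)) (Fin d.m) Empty

theorem solve_succ_cheap (hS : centralInputs d nbr ⊆ S) (LIP l : ℕ)
    (hx : centralOutputs d nbr l LIP ⊆ S) :
    Cheap S (LIP * ((20 * d.m + 60) * ((Fintype.card (CVar nbr) + 1) ^ 2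
      * (centralRank d nbr + 1)))) (centralOutputs d nbr (l + 1) LIP) := by
  have hag : ∀ i, HasCoefficients S (fun s : CentralInstance d nbr => s.prob.agent i) :=
    fun i g hg => hS (Or.inl (Or.inl (Or.inl ⟨i, g, hg, rfl⟩)))
  have hc : ∀ e : Edge nbr, Cost S 0 (fun s : CentralInstance d nbr => s.prob.cInter e.1 e.2) :=
    fun e => Cost.of_mem (hS (Or.inl (Or.inl (Or.inr ⟨e, rfl⟩))))
  have ht : ∀ j, Cost S 0 (fun s : CentralInstance d nbr => s.t j) :=
    fun j => Cost.of_mem (hS (Or.inl (Or.inr ⟨j, rfl⟩)))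
  have hinj := fun i => ctrl_index_injective (nbr := nbr) i
  exact linearized_ipm_cheap (m := d.m)
    (P := fun s : CentralInstance d nbr => s.prob.central (s.solve LIP l))
    (xl := fun s => s.solve LIP l) (t := fun s => s.t)
    (rel := fun s q x => Sum.elim (fun q => s.prob.relObs x q.1 q.2.1 q.2.2)
      (fun q => s.prob.relInter x q.1 q.2) q)
    (slack := fun q => Sum.elim (fun q => Sum.inr (Sum.inr (Sum.inl q)))
      (fun q => Sum.inr (Sum.inr (Sum.inr q))) q)
    (Q := fun s => quadHess s.prob.totalCost) (Qi := fun s => s.prob.costInv)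
    (by
      rintro (⟨i, k, o⟩ | ⟨e, k⟩) r
      · exact (((hag i).pos k r).reindex (hinj i)).sub (Tab.of_const ((hag i).center o r))
      · exact (((hag e.1).pos k r).reindex (hinj e.1)).sub (((hag e.2).pos k r).reindex (hinj e.2)))
    (fun v => Cost.of_mem (hx ⟨v, rfl⟩))
    (by
      rintro s (⟨i, k, o⟩ | ⟨e, k⟩)
      · exact ((s.feasible LIP l).obs_pos s.valid i k o).ne'
      · exact ((s.feasible LIP l).inter_pos s.valid e k).ne')
    (by rintro s (⟨i, k, o⟩ | ⟨e, k⟩) <;> rfl)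
    (by
      rintro ⟨i, r⟩
      exact ((((hag i).mean_tight r).reindex (hinj i)).sub
        (Tab.of_const ((hag i).bTight r))).mono (by omega))
    (by
      rintro (⟨i, r⟩ | ⟨i, r⟩ | ⟨i, k, r⟩)
      · exact ((Tab.of_const ((hag i).bLin r)).sub
          (((hag i).mean_lin r).reindex (hinj i))).mono (by omega)
      · exact (Tab.of_const ((hag i).ε r)).mono (by omega)
      · exact Tab.coord _)
    (by
      rintro (⟨i, r⟩ | ⟨i, r⟩ | ⟨i, k, r⟩) z
      · exact (((hag i).dev_lin r z).reindex (hinj i)).mono (by omega)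
      · exact (((hag i).dev_tight r z).reindex (hinj i)).mono (by omega)
      · exact (((hag i).dev_pos k r z).reindex (hinj i)).mono (by omega))
    (by
      rintro (⟨i, k, o⟩ | ⟨e, k⟩)
      · exact ((Tab.coord (k := 0) _).sub (Tab.of_const ((hag i).cObs o))).mono (by omega)
      · exact ((Tab.coord (k := 0) _).sub (Tab.of_const (hc e))).mono (by omega))
    (by
      rintro (⟨i, k, o⟩ | ⟨e, k⟩) r
      · exact Tab.coord _
      · exact ((Tab.coord (k := 0) _).add (Tab.coord (k := 0) _)).mono (by omega))
    { hess := fun u v => by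
        simp only [Problem.quadHess_totalCost]
        split_ifs
        · exact (hag u.1).hess u.2 v.2
        · exact Cost.const 0
      hess_inv := fun u v => by
        simp only [Problem.costInv]
        split_ifs
        · exact (hag u.1).hess_inv u.2 v.2
        · exact Cost.const 0
      shift := fun j => j.elim
      weight := fun j => j.elim
      dir := fun j => j.elim
      inv := fun s => Problem.totalCost_mul_inv s.valid }
    (fun s => Problem.central_regular s.valid _) ht (fun s => s.t_pos)
    (fun s => (s.feasible LIP l).interior) LIP

theorem solve_cheap (LIP l : ℕ) :
    Cheap (centralInputs d nbr) (l * (LIP * ((20 * d.m + 60) * ((Fintype.card (CVar nbr) + 1) ^ 2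
      * (centralRank d nbr + 1))))) (centralOutputs d nbr l LIP) := by
  induction l with
  | zero => exact Cheap.of_inputs Set.subset_union_right
  | succ l ih =>
    rw [Nat.succ_mul]
    exact ih.trans (solve_succ_cheap Set.subset_union_left LIP l Set.subset_union_right)

end CentralCost

/-! ### Derivatives of the augmented Lagrangian terms -/

section Penalty

open Matrix

variable {V : Type} [DecidableEq V]

theorem quadGrad_add (f g : (V → ℝ) → ℝ) (x : V → ℝ) (v : V) :
    quadGrad (fun x => f x + g x) x v = quadGrad f x v + quadGrad g x v := by
  simp only [quadGrad]; ring

theorem quadGrad_sum {ι : Type} [Fintype ι] (f : ι → (V → ℝ) → ℝ) (x : V → ℝ) (v : V) :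
    quadGrad (fun x => ∑ i, f i x) x v = ∑ i, quadGrad (f i) x v := by
  simp only [quadGrad, ← Finset.sum_sub_distrib, Finset.sum_div]

theorem quadHess_add (f g : (V → ℝ) → ℝ) :
    quadHess (fun x => f x + g x) = quadHess f + quadHess g := by
  ext u v
  simp only [quadHess, Matrix.add_apply]; ring

theorem quadHess_sum {ι : Type} [Fintype ι] (f : ι → (V → ℝ) → ℝ) :
    quadHess (fun x => ∑ i, f i x) = ∑ i, quadHess (f i) := by
  ext u v
  simp only [quadHess, Matrix.sum_apply, ← Finset.sum_sub_distrib, ← Finset.sum_add_distrib]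

variable [Fintype V]

theorem linPart_single (f : (V → ℝ) → ℝ) (v : V) : linPart f (Pi.single v 1) = slope f v := by
  simp [linPart, Pi.single_apply]

/-- This is the form required by `Regular`, with direction `slope μ`, weight `ρ` and shift `y + ρ *
(μ 0 - ν)`: each penalty term costs just one more rank-one update. -/
theorem quadGrad_penalty {μ : (V → ℝ) → ℝ} (h : IsAff μ) (y ρ ν : ℝ) (x : V → ℝ) (v : V) :
    quadGrad (fun x => y * (μ x - ν) + ρ / 2 * (μ x - ν) ^ 2) x v
      = (y + ρ * (μ 0 - ν) + ρ * ∑ u, slope μ u * x u) * slope μ v := by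
  have h1 : μ (x - Pi.single v 1) = μ x - slope μ v := by
    have := h.add_smul x (Pi.single v 1) (-1)
    rw [linPart_single] at this
    rw [sub_eq_add_neg, ← neg_one_smul ℝ (Pi.single v 1 : V → ℝ), this]
    ring
  have h2 : ∑ u, slope μ u * x u = μ x - μ 0 := by
    rw [h.eval x]
    simp [linPart]
  simp only [quadGrad, h1, h2, h.add_vec, linPart_single]
  ring

theorem quadHess_penalty {μ : (V → ℝ) → ℝ} (h : IsAff μ) (y ρ ν : ℝ) :
    quadHess (fun x => y * (μ x - ν) + ρ / 2 * (μ x - ν) ^ 2)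
      = ρ • vecMulVec (slope μ) (slope μ) := by
  ext u v
  have hs : ∀ v, μ (Pi.single v 1) = μ 0 + slope μ v := fun v => by
    rw [h.eval (Pi.single v 1), linPart_single]
  simp only [quadHess, h.add_vec, linPart_single, hs, Matrix.smul_apply, vecMulVec_apply,
    smul_eq_mul]
  ring

end Penalty

/-! ### The local subproblems: regularity and feasibility -/

section LocalFacts

open Matrix

variable {d : Dims} {nb : Finset (Fin d.N)}

/-- Index type of the penalty terms. -/
abbrev PenaltyIdx (nb : Finset (Fin d.N)) : Type :=
  (Option nb × d.Time × Fin d.m) ⊕ (Option nb × d.Time × Fin d.m)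

/-- The quantities that occur in the penalty terms. -/
noncomputable def penalized (a : Agent d) : PenaltyIdx nb → (LVar nb → ℝ) → ℝ
  | .inl q => fun x => LVar.sharedPos a x q.1 q.2.1 q.2.2
  | .inr q => fun x => LVar.sharedDev x q.1 q.2.1 q.2.2

/-- Families for the position terms and the deviation terms, joined. -/
def joined (fU fD : Option nb → d.Time → Fin d.m → ℝ) : PenaltyIdx nb → ℝ
  | .inl q => fU q.1 q.2.1 q.2.2
  | .inr q => fD q.1 q.2.1 q.2.2

theorem LVar.isAff_ctrl {f : (d.Ctrl → ℝ) → ℝ} (hf : IsAff f) :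
    IsAff (fun x : LVar nb → ℝ => f (LVar.ctrl x)) :=
  hf.reindex (fun c => (Sum.inl c : LVar nb))

theorem isAff_penalized (a : Agent d) (j : PenaltyIdx nb) : IsAff (penalized a j) := by
  rcases j with ⟨_ | j, k, r⟩ | ⟨_ | j, k, r⟩
  · exact LVar.isAff_ctrl (a.isAff_pos k r)
  · exact IsAff.coord _
  · exact IsAff.coord _
  · exact IsAff.coord _

namespace Agent

/-- The factors of the penalty gradients at the origin. -/
noncomputable def penaltyShift (a : Agent d) (ρU ρD : ℝ)
    (dualU dualD νU νD : Option nb → d.Time → Fin d.m → ℝ) (j : PenaltyIdx nb) : ℝ :=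
  joined dualU dualD j + joined (fun _ _ _ => ρU) (fun _ _ _ => ρD) j
    * (penalized a j 0 - joined νU νD j)

variable (a : Agent d) (cI : nb → ℝ) (ρU ρD : ℝ)
  (dualU dualD νU νD : Option nb → d.Time → Fin d.m → ℝ) (xl : LVar nb → ℝ)

theorem local_obj : (a.local nb cI ρU ρD dualU dualD νU νD xl).obj = fun x =>
    a.cost (fun c => x (Sum.inl c)) + ∑ j : PenaltyIdx nb,
      (joined dualU dualD j * (penalized a j x - joined νU νD j)
        + joined (fun _ _ _ => ρU) (fun _ _ _ => ρD) j / 2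
          * (penalized a j x - joined νU νD j) ^ 2) := by
  funext x
  simp only [Agent.local, penalty, Fintype.sum_sum_type, Fintype.sum_prod_type, joined, penalized,
    add_assoc]
  rfl

theorem local_lin_aff (l) : IsAff ((a.local nb cI ρU ρD dualU dualD νU νD xl).lin l) := by
  rcases l with ⟨k, o⟩ | ⟨j, k⟩
  · exact (isAff_linNrm _ fun r => (LVar.isAff_ctrl (a.isAff_pos k r)).sub (IsAff.const _)).sub
      (IsAff.coord _)
  · exact (isAff_linNrm _ fun r => (LVar.isAff_ctrl (a.isAff_pos k r)).sub (IsAff.coord _)).sub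
      (IsAff.coord _)

theorem local_soc₁_aff (b) : ((a.local nb cI ρU ρD dualU dualD νU νD xl).soc₁ b).Aff := by
  rcases b with r | r | ⟨k, r⟩
  · exact ⟨(IsAff.const _).sub (LVar.isAff_ctrl (a.isAff_dot_mean _)),
      fun z => LVar.isAff_ctrl (a.isAff_dev _ z)⟩
  · exact ⟨IsAff.const _, fun z => LVar.isAff_ctrl (a.isAff_dev _ z)⟩
  · exact ⟨IsAff.coord _, fun z => LVar.isAff_ctrl (a.isAff_dev _ z)⟩

theorem local_soc₂_aff (b) : ((a.local nb cI ρU ρD dualU dualD νU νD xl).soc₂ b).Aff := by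
  rcases b with ⟨k, o⟩ | ⟨j, k⟩
  · exact ⟨(IsAff.coord _).sub (IsAff.const _), fun r => IsAff.coord _⟩
  · exact ⟨(IsAff.coord _).sub (IsAff.const _), fun r => (IsAff.coord _).add (IsAff.coord _)⟩

variable {a}

theorem local_eq_indep (ha : a.Valid) :
    LinearIndependent ℝ (fun e => (a.local nb cI ρU ρD dualU dualD νU νD xl).eqMat e) := by
  rw [Fintype.linearIndependent_iff]
  intro g hg
  refine Fintype.linearIndependent_iff.1 ha.eq_indep g ?_
  ext q
  have h := congrFun hg (Sum.inl (Sum.inl q))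
  rw [Finset.sum_apply] at h ⊢
  refine Eq.trans (Finset.sum_congr rfl fun r _ => ?_) h
  simp only [Pi.smul_apply, smul_eq_mul]
  congr 1
  rw [← Agent.slope_dot_mean,
    ← slope_comp (ι := (Sum.inl : d.Ctrl → LVar nb)) Sum.inl_injective _ (Sum.inl q)]
  simp only [ConicProgram.eqMat, Agent.local, slope]
  exact (sub_sub_sub_cancel_right _ _ _).symm

theorem local_regular (ha : a.Valid) (hU : 0 < ρU) (hD : 0 < ρD) :
    (a.local nb cI ρU ρD dualU dualD νU νD xl).Regular (quadHess a.cost)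
      (a.penaltyShift ρU ρD dualU dualD νU νD)
      (joined (nb := nb) (fun _ _ _ => ρU) (fun _ _ _ => ρD))
      (fun j => slope (penalized a j)) where
  lin_aff := a.local_lin_aff cI ρU ρD dualU dualD νU νD xl
  soc₁_aff := a.local_soc₁_aff cI ρU ρD dualU dualD νU νD xl
  soc₂_aff := a.local_soc₂_aff cI ρU ρD dualU dualD νU νD xl
  Q_pos := ha.symPos_cost
  w_pos := by
    rintro (j | j)
    exacts [hU, hD]
  obj_grad x v := by
    rw [local_obj, quadGrad_add, quadGrad_sum]
    congr 1
    · exact quadGrad_comp_inl a.isQuad_cost x v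
    · exact Finset.sum_congr rfl fun j _ => quadGrad_penalty (isAff_penalized a j) _ _ _ x v
  obj_hess := by
    rw [local_obj, quadHess_add, quadHess_sum, quadHess_comp_inl]
    congr 1
    exact Finset.sum_congr rfl fun j _ => quadHess_penalty (isAff_penalized a j) _ _ _
  -- The copies of the neighbors' variables are controlled only by the penalties; the inter-agent
  -- slacks follow from the linearized constraints after the copied positions are known to vanish.
  definite z h1 hp h2 h3 := by
    have hctrl : LVar.ctrl z = LVar.ctrl (0 : LVar nb → ℝ) := funext h1
    have hpen : ∀ j, penalized a j z = penalized a j 0 := fun j => by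
      have h4 : linPart (penalized a j) z = 0 := hp j
      rw [(isAff_penalized a j).eval z, h4, add_zero]
    ext (c | ⟨k, r⟩ | ⟨k, o⟩ | ⟨j, k⟩ | ⟨j, k, r⟩ | ⟨j, k, r⟩)
    · exact h1 c
    · exact h3 (Sum.inr (Sum.inr (k, r)))
    · have := h2 (Sum.inl (k, o))
      simp only [Agent.local, hctrl] at this
      simpa [LVar.slackObs] using this
    · have h5 : LVar.copyPos z j k = LVar.copyPos 0 j k :=
        funext fun r => hpen (Sum.inl (some j, k, r))
      have := h2 (Sum.inr (j, k))
      simp only [Agent.local, hctrl, h5] at this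
      simpa [LVar.slackInter] using this
    · exact hpen (Sum.inl (some j, k, r))
    · exact hpen (Sum.inr (some j, k, r))
  eq_indep := local_eq_indep cI ρU ρD dualU dualD νU νD xl ha

/-- Strict feasibility for the inequality constraints of the nonconvex local problem. -/
structure LocalFeasible (a : Agent d) (nb : Finset (Fin d.N)) (cI : nb → ℝ)
    (x : LVar nb → ℝ) : Prop where
  obs : ∀ k o, LVar.slackObs x k o < nrm (a.pos (LVar.ctrl x) k - a.center o)
  inter : ∀ j k, LVar.slackInter x j k < nrm (a.pos (LVar.ctrl x) k - LVar.copyPos x j k)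
  -- The penalty parameters, dual and global variables are placeholders here: the cone constraints
  -- do not involve them.
  soc₁ : ∀ b, ((a.local nb cI 1 1 0 0 0 0 x).soc₁ b).Interior x
  soc₂ : ∀ b, ((a.local nb cI 1 1 0 0 0 0 x).soc₂ b).Interior x

variable {cI} {xl}

theorem LocalFeasible.obs_pos (ha : a.Valid) {x : LVar nb → ℝ} (h : a.LocalFeasible nb cI x)
    (k o) : 0 < nrm (a.pos (LVar.ctrl x) k - a.center o) := by
  have h1 : 0 < LVar.slackObs x k o - a.cObs o := (h.soc₂ (Sum.inl (k, o))).1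
  linarith [h.obs k o, ha.cObs_nonneg o]

theorem LocalFeasible.inter_pos (hc : ∀ j, 0 ≤ cI j) {x : LVar nb → ℝ}
    (h : a.LocalFeasible nb cI x) (j k) :
    0 < nrm (a.pos (LVar.ctrl x) k - LVar.copyPos x j k) := by
  have h1 : 0 < LVar.slackInter x j k - cI j := (h.soc₂ (Sum.inr (j, k))).1
  linarith [h.inter j k, hc j]

theorem LocalFeasible.interior {x : LVar nb → ℝ} (h : a.LocalFeasible nb cI x) :
    (a.local nb cI ρU ρD dualU dualD νU νD x).Interior x where
  lin := by
    rintro (⟨k, o⟩ | ⟨j, k⟩)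
    · have := h.obs k o
      simp only [Agent.local, linNrm_self]
      linarith
    · have := h.inter j k
      simp only [Agent.local, linNrm_self]
      linarith
  soc₁ := h.soc₁
  soc₂ := h.soc₂

variable {ρU ρD dualU dualD νU νD}

theorem localFeasible_of_interior (ha : a.Valid) (hc : ∀ j, 0 ≤ cI j) {x : LVar nb → ℝ}
    (hl : a.LocalFeasible nb cI xl)
    (h : (a.local nb cI ρU ρD dualU dualD νU νD xl).Interior x) : a.LocalFeasible nb cI x where
  obs k o := by
    have h1 := h.lin (Sum.inl (k, o))
    have h2 := linNrm_le (hl.obs_pos ha k o) (a.pos (LVar.ctrl x) k - a.center o)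
    simp only [Agent.local] at h1
    linarith
  inter j k := by
    have h1 := h.lin (Sum.inr (j, k))
    have h2 := linNrm_le (hl.inter_pos hc j k) (a.pos (LVar.ctrl x) k - LVar.copyPos x j k)
    simp only [Agent.local] at h1
    linarith
  soc₁ := h.soc₁
  soc₂ := h.soc₂

end Agent

variable {nbr : Fin d.N → Finset (Fin d.N)}

theorem AdmmInstance.feasible (s : AdmmInstance d nbr) (LIP l : ℕ) (i : Fin d.N) :
    (s.prob.agent i).LocalFeasible (nbr i) (s.prob.cInter i) ((s.run LIP l).x i) := by
  induction l with
  | zero =>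
    have h := s.start_interior i
    exact ⟨h.obs, h.inter, h.soc₁, h.soc₂⟩
  | succ l ih =>
    exact Agent.localFeasible_of_interior (s.valid.1 i) (s.valid.2 i) ih
      ((Agent.local_regular _ _ _ _ _ _ _ _ (s.valid.1 i) s.ρU_pos s.ρD_pos).interior_ipm s.t_pos
        (ih.interior _ _ _ _ _ _) LIP)

end LocalFacts

/-! ### Cost of the three ADMM updates -/

section LocalCost

variable {d : Dims} {nbr : Fin d.N → Finset (Fin d.N)} {S : Set (AdmmInstance d nbr → ℝ)}

/-- The number of rank-one updates in a Newton step on a local subproblem. -/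
abbrev localRank (d : Dims) (nb : Finset (Fin d.N)) : ℕ :=
  rankCount ((d.Time × Fin d.m) ⊕ (d.Time × Fin d.nobs) ⊕ (nb × d.Time)
    ⊕ (nb × d.Time × Fin d.m) ⊕ (nb × d.Time × Fin d.m))
    ((d.Time × Fin d.nobs) ⊕ (nb × d.Time)) (Fin d.ntight)
    (Fin d.nlin ⊕ Fin d.ntight ⊕ (d.Time × Fin d.m)) d.Zeta
    ((d.Time × Fin d.nobs) ⊕ (nb × d.Time)) (Fin d.m) (PenaltyIdx nb)

theorem agentConstants_coef {i : Fin d.N} (hS : agentConstants nbr i ⊆ S) :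
    HasCoefficients S (fun s : AdmmInstance d nbr => s.prob.agent i) :=
  fun g hg => hS (Or.inl (Or.inl (Or.inl ⟨g, hg, rfl⟩)))

theorem agentConstants_ρU {i : Fin d.N} (hS : agentConstants nbr i ⊆ S) :
    Cost S 0 (fun s : AdmmInstance d nbr => s.ρU) := Cost.of_mem (hS (Or.inr (Or.inl rfl)))

theorem agentConstants_ρD {i : Fin d.N} (hS : agentConstants nbr i ⊆ S) :
    Cost S 0 (fun s : AdmmInstance d nbr => s.ρD) := Cost.of_mem (hS (Or.inr (Or.inr rfl)))

theorem HasCoefficients.penalized {D : Type} {S : Set (D → ℝ)} {ag : D → Agent d}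
    (h : HasCoefficients S ag) {nb : Finset (Fin d.N)} (j : PenaltyIdx nb) :
    Tab S 0 (fun s => RobustMAS.penalized (ag s) j) := by
  rcases j with ⟨_ | j, k, r⟩ | ⟨_ | j, k, r⟩
  · exact (h.pos k r).reindex (ι := (Sum.inl : d.Ctrl → LVar nb)) Sum.inl_injective
  · exact Tab.coord _
  · exact Tab.coord _
  · exact Tab.coord _

theorem localUpdate_cheap (LIP l : ℕ) (hLIP : 1 ≤ LIP) (i : Fin d.N)
    (hS : agentConstants nbr i ∪ localVars nbr LIP l i ∪ dualVars nbr LIP l i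
        ∪ gatheredVars nbr LIP l i ⊆ S) :
    Cheap S (LIP * ((20 * d.m + 63) * ((Fintype.card (LVar (nbr i)) + 1) ^ 2
      * (localRank d (nbr i) + 1)))) (localVars nbr LIP (l + 1) i) := by
  have hA : agentConstants nbr i ⊆ S := fun f hf => hS (Or.inl (Or.inl (Or.inl hf)))
  have hag := agentConstants_coef hA
  have hx : ∀ v, Cost S 0 (fun s : AdmmInstance d nbr => (s.run LIP l).x i v) := fun v =>
    Cost.of_mem (hS (Or.inl (Or.inl (Or.inr ⟨v, rfl⟩))))
  have hc : ∀ j, Cost S 0 (fun s : AdmmInstance d nbr => s.prob.cInter i j) :=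
    fun j => Cost.of_mem (hA (Or.inl (Or.inl (Or.inr ⟨j, rfl⟩))))
  have ht : ∀ j, Cost S 0 (fun s : AdmmInstance d nbr => s.t j) :=
    fun j => Cost.of_mem (hA (Or.inl (Or.inr ⟨j, rfl⟩)))
  have hdual : ∀ j, Cost S 0 (fun s : AdmmInstance d nbr =>
      joined ((s.run LIP l).dualU i) ((s.run LIP l).dualD i) j) := by
    rintro (q | q)
    · exact Cost.of_mem (hS (Or.inl (Or.inr (Or.inl ⟨q, rfl⟩))))
    · exact Cost.of_mem (hS (Or.inl (Or.inr (Or.inr ⟨q, rfl⟩))))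
  have hν : ∀ j : PenaltyIdx (nbr i), Cost S 0 (fun s : AdmmInstance d nbr =>
      joined (gather i (s.run LIP l).νU) (gather i (s.run LIP l).νD) j) := by
    rintro (⟨_ | j, q⟩ | ⟨_ | j, q⟩)
    · exact Cost.of_mem (hS (Or.inr (Or.inl (Or.inl ⟨q, rfl⟩))))
    · exact Cost.of_mem (hS (Or.inr (Or.inr (Set.mem_iUnion.2 ⟨j, Or.inl ⟨q, rfl⟩⟩))))
    · exact Cost.of_mem (hS (Or.inr (Or.inl (Or.inr ⟨q, rfl⟩))))
    · exact Cost.of_mem (hS (Or.inr (Or.inr (Set.mem_iUnion.2 ⟨j, Or.inr ⟨q, rfl⟩⟩))))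
  have hρ : ∀ j : PenaltyIdx (nbr i), Cost S 0 (fun s : AdmmInstance d nbr =>
      joined (fun _ _ _ => s.ρU) (fun _ _ _ => s.ρD) j) := by
    rintro (q | q)
    exacts [agentConstants_ρU hA, agentConstants_ρD hA]
  set n := Fintype.card (LVar (nbr i)) with hn
  set r := localRank d (nbr i) with hr
  -- The penalty shifts depend on the current dual and global variables and are computed once per
  -- ADMM iteration, three operations each. Since `LIP ≥ 1`, they fit into the increase from 60 to
  -- 63.
  refine Cheap.mono (k := Fintype.card (PenaltyIdx (nbr i)) * 3 +
    LIP * ((20 * d.m + 60) * ((n + 1) ^ 2 * (r + 1)))) ?_ ?_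
  · refine Cheap.stage (f := fun j (s : AdmmInstance d nbr) =>
      (s.prob.agent i).penaltyShift s.ρU s.ρD ((s.run LIP l).dualU i) ((s.run LIP l).dualD i)
        (gather i (s.run LIP l).νU) (gather i (s.run LIP l).νD) j) (fun j => ?_) fun S₁ s₁ hα => ?_
    · exact ((hdual j).add ((hρ j).mul ((hag.penalized j).const.sub (hν j)))).mono (by omega)
    have hag' := hag.of_subset s₁
    have hinj : Function.Injective (Sum.inl : d.Ctrl → LVar (nbr i)) := Sum.inl_injective
    exact linearized_ipm_cheap (m := d.m)
      (P := fun s : AdmmInstance d nbr => (s.prob.agent i).local (nbr i) (s.prob.cInter i) s.ρU s.ρD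
        ((s.run LIP l).dualU i) ((s.run LIP l).dualD i)
        (gather i (s.run LIP l).νU) (gather i (s.run LIP l).νD) ((s.run LIP l).x i))
      (xl := fun s => (s.run LIP l).x i) (t := fun s => s.t)
      (rel := fun s q x => Sum.elim
        (fun q => (s.prob.agent i).pos (LVar.ctrl x) q.1 - (s.prob.agent i).center q.2)
        (fun q => (s.prob.agent i).pos (LVar.ctrl x) q.2 - LVar.copyPos x q.1 q.2) q)
      (slack := fun q => Sum.elim (fun q => Sum.inr (Sum.inr (Sum.inl q)))
        (fun q => Sum.inr (Sum.inr (Sum.inr (Sum.inl q)))) q)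
      (Q := fun s => quadHess (s.prob.agent i).cost)
      (Qi := fun s => (quadHess (s.prob.agent i).cost)⁻¹)
      (by
        rintro (⟨k, o⟩ | ⟨j, k⟩) r
        · exact ((hag'.pos k r).reindex hinj).sub (Tab.of_const (hag'.center o r))
        · exact ((hag'.pos k r).reindex hinj).sub (Tab.coord (k := 0) _))
      (fun v => (hx v).of_subset s₁)
      (by
        rintro s (⟨k, o⟩ | ⟨j, k⟩)
        · exact ((s.feasible LIP l i).obs_pos (s.valid.1 i) k o).ne'
        · exact ((s.feasible LIP l i).inter_pos (s.valid.2 i) j k).ne')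
      (by rintro s (⟨k, o⟩ | ⟨j, k⟩) <;> rfl)
      (by
        intro r
        exact (((hag'.mean_tight r).reindex hinj).sub (Tab.of_const (hag'.bTight r))).mono
          (by omega))
      (by
        rintro (r | r | ⟨k, r⟩)
        · exact ((Tab.of_const (hag'.bLin r)).sub ((hag'.mean_lin r).reindex hinj)).mono (by omega)
        · exact (Tab.of_const (hag'.ε r)).mono (by omega)
        · exact Tab.coord _)
      (by
        rintro (r | r | ⟨k, r⟩) z
        · exact ((hag'.dev_lin r z).reindex hinj).mono (by omega)
        · exact ((hag'.dev_tight r z).reindex hinj).mono (by omega)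
        · exact ((hag'.dev_pos k r z).reindex hinj).mono (by omega))
      (by
        rintro (⟨k, o⟩ | ⟨j, k⟩)
        · exact ((Tab.coord (k := 0) _).sub (Tab.of_const (hag'.cObs o))).mono (by omega)
        · exact ((Tab.coord (k := 0) _).sub
            (Tab.of_const ((hc j).of_subset s₁))).mono (by omega))
      (by
        rintro (⟨k, o⟩ | ⟨j, k⟩) r
        · exact Tab.coord _
        · exact ((Tab.coord (k := 0) _).add (Tab.coord (k := 0) _)).mono (by omega))
      { hess := hag'.hess
        hess_inv := hag'.hess_inv
        shift := hα
        weight := fun j => (hρ j).of_subset s₁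
        dir := fun j => (hag'.penalized j).slope
        inv := fun s => (s.valid.1 i).cost_mul_inv }
      (fun s => Agent.local_regular _ _ _ _ _ _ _ _ (s.valid.1 i) s.ρU_pos s.ρD_pos)
      (fun j => (ht j).of_subset s₁) (fun s => s.t_pos)
      (fun s => (s.feasible LIP l i).interior _ _ _ _ _ _) LIP
  · have hJ : Fintype.card (PenaltyIdx (nbr i)) ≤ r := by
      simp only [hr, localRank, rankCount]
      omega
    have e1 : r ≤ LIP * ((n + 1) ^ 2 * (r + 1)) := by
      have h1 : 1 * (1 * r) ≤ LIP * ((n + 1) ^ 2 * (r + 1)) :=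
        Nat.mul_le_mul hLIP (Nat.mul_le_mul (Nat.one_le_pow _ _ (by omega)) (by omega))
      omega
    have e2 : LIP * ((20 * d.m + 63) * ((n + 1) ^ 2 * (r + 1)))
        = LIP * ((20 * d.m + 60) * ((n + 1) ^ 2 * (r + 1)))
          + 3 * (LIP * ((n + 1) ^ 2 * (r + 1))) := by ring
    omega

theorem sharedPos_cost {i : Fin d.N} (hA : agentConstants nbr i ⊆ S) {LIP l : ℕ}
    (hx : localVars nbr LIP l i ⊆ S) (j : Option (nbr i)) (k : d.Time) (r : Fin d.m) :
    Cost S (2 * (Fintype.card (LVar (nbr i)) + 1)) (fun s : AdmmInstance d nbr =>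
      LVar.sharedPos (s.prob.agent i) ((s.run LIP l).x i) j k r) :=
  ((agentConstants_coef hA).penalized (Sum.inl (j, k, r))).eval_of
    fun v => Cost.of_mem (hx ⟨v, rfl⟩)

theorem sharedDev_cost {i : Fin d.N} {LIP l : ℕ}
    (hx : localVars nbr LIP l i ⊆ S) (j : Option (nbr i)) (k : d.Time) (r : Fin d.m) :
    Cost S 0 (fun s : AdmmInstance d nbr => LVar.sharedDev ((s.run LIP l).x i) j k r) := by
  rcases j with _ | j
  · exact Cost.of_mem (hx ⟨Sum.inr (Sum.inl (k, r)), rfl⟩)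
  · exact Cost.of_mem (hx ⟨Sum.inr (Sum.inr (Sum.inr (Sum.inr (Sum.inr (j, k, r))))), rfl⟩)

/-- Only the agent's own mean position has to be evaluated from its controls; the other terms are
received, three operations for each agent that has `i` as a neighbor. The number of such agents is a
constant of the program. -/
theorem globalUpdate_cheap (LIP l : ℕ) (i : Fin d.N)
    (hS : agentConstants nbr i ∪ localVars nbr LIP (l + 1) i ∪ dualVars nbr LIP l i
        ∪ receivedCopies nbr LIP l i ⊆ S) :
    Cheap S (2 * (Fintype.card (d.Time × Fin d.m) * (2 * (Fintype.card (LVar (nbr i)) + 1)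
      + 3 * Fintype.card (Pre nbr i) + 5))) (globalVars nbr LIP (l + 1) i) := by
  have hA : agentConstants nbr i ⊆ S := fun f hf => hS (Or.inl (Or.inl (Or.inl hf)))
  have hx : localVars nbr LIP (l + 1) i ⊆ S := fun f hf => hS (Or.inl (Or.inl (Or.inr hf)))
  have hcard : ∀ s : AdmmInstance d nbr, (Fintype.card (Pre nbr i) + 1 : ℝ) ≠ 0 := fun _ => by
    positivity
  rw [two_mul]
  refine Cheap.union (Cheap.range fun q => ?_) (Cheap.range fun q => ?_)
  · have h1 : Cost S 0 (fun s : AdmmInstance d nbr => (s.run LIP l).dualU i none q.1 q.2) :=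
      Cost.of_mem (hS (Or.inl (Or.inr (Or.inl ⟨(none, q), rfl⟩))))
    have h2 : ∀ j : Pre nbr i, Cost S 0 (fun s : AdmmInstance d nbr =>
        (s.run LIP l).dualU j (some ⟨i, j.2⟩) q.1 q.2) := fun j =>
      Cost.of_mem (hS (Or.inr (Or.inl (Or.inr ⟨(j, q), rfl⟩))))
    have h3 : ∀ j : Pre nbr i, Cost S 0 (fun s : AdmmInstance d nbr =>
        LVar.copyPos ((s.run LIP (l + 1)).x j) ⟨i, j.2⟩ q.1 q.2) := fun j =>
      Cost.of_mem (hS (Or.inr (Or.inl (Or.inl (Or.inl ⟨(j, q), rfl⟩)))))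
    have hρ := agentConstants_ρU hA
    have h0 : ∀ s : AdmmInstance d nbr, s.ρU ≠ 0 := fun s => s.ρU_pos.ne'
    refine ((((h1.div hρ h0).add (sharedPos_cost hA hx none q.1 q.2)).add
      (Cost.sum fun j => ((h2 j).div hρ h0).add (h3 j))).div (Cost.const (k := 0) _)
      hcard).mono ?_
    omega
  · have h1 : Cost S 0 (fun s : AdmmInstance d nbr => (s.run LIP l).dualD i none q.1 q.2) :=
      Cost.of_mem (hS (Or.inl (Or.inr (Or.inr ⟨(none, q), rfl⟩))))
    have h2 : ∀ j : Pre nbr i, Cost S 0 (fun s : AdmmInstance d nbr =>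
        (s.run LIP l).dualD j (some ⟨i, j.2⟩) q.1 q.2) := fun j =>
      Cost.of_mem (hS (Or.inr (Or.inr ⟨(j, q), rfl⟩)))
    have h3 : ∀ j : Pre nbr i, Cost S 0 (fun s : AdmmInstance d nbr =>
        LVar.copyDev ((s.run LIP (l + 1)).x j) ⟨i, j.2⟩ q.1 q.2) := fun j =>
      Cost.of_mem (hS (Or.inr (Or.inl (Or.inl (Or.inr ⟨(j, q), rfl⟩)))))
    have hρ := agentConstants_ρD hA
    have h0 : ∀ s : AdmmInstance d nbr, s.ρD ≠ 0 := fun s => s.ρD_pos.ne'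
    refine ((((h1.div hρ h0).add (sharedDev_cost hx none q.1 q.2)).add
      (Cost.sum fun j => ((h2 j).div hρ h0).add (h3 j))).div (Cost.const (k := 0) _)
      hcard).mono ?_
    omega

theorem dualUpdate_cheap (LIP l : ℕ) (i : Fin d.N)
    (hS : agentConstants nbr i ∪ localVars nbr LIP (l + 1) i ∪ dualVars nbr LIP l i
        ∪ gatheredVars nbr LIP (l + 1) i ⊆ S) :
    Cheap S (2 * (Fintype.card (Option (nbr i) × d.Time × Fin d.m)
      * (2 * (Fintype.card (LVar (nbr i)) + 1) + 3))) (dualVars nbr LIP (l + 1) i) := by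
  have hA : agentConstants nbr i ⊆ S := fun f hf => hS (Or.inl (Or.inl (Or.inl hf)))
  have hx : localVars nbr LIP (l + 1) i ⊆ S := fun f hf => hS (Or.inl (Or.inl (Or.inr hf)))
  rw [two_mul]
  refine Cheap.union (Cheap.range fun q => ?_) (Cheap.range fun q => ?_)
  · have h1 : Cost S 0 (fun s : AdmmInstance d nbr =>
        (s.run LIP l).dualU i q.1 q.2.1 q.2.2) :=
      Cost.of_mem (hS (Or.inl (Or.inr (Or.inl ⟨q, rfl⟩))))
    have h2 : Cost S 0 (fun s : AdmmInstance d nbr =>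
        gather i (s.run LIP (l + 1)).νU q.1 q.2.1 q.2.2) := by
      rcases q with ⟨_ | j, q⟩
      · exact Cost.of_mem (hS (Or.inr (Or.inl (Or.inl ⟨q, rfl⟩))))
      · exact Cost.of_mem (hS (Or.inr (Or.inr (Set.mem_iUnion.2 ⟨j, Or.inl ⟨q, rfl⟩⟩))))
    exact (h1.add ((agentConstants_ρU hA).mul
      ((sharedPos_cost hA hx q.1 q.2.1 q.2.2).sub h2))).mono (by omega)
  · have h1 : Cost S 0 (fun s : AdmmInstance d nbr =>
        (s.run LIP l).dualD i q.1 q.2.1 q.2.2) :=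
      Cost.of_mem (hS (Or.inl (Or.inr (Or.inr ⟨q, rfl⟩))))
    have h2 : Cost S 0 (fun s : AdmmInstance d nbr =>
        gather i (s.run LIP (l + 1)).νD q.1 q.2.1 q.2.2) := by
      rcases q with ⟨_ | j, q⟩
      · exact Cost.of_mem (hS (Or.inr (Or.inl (Or.inr ⟨q, rfl⟩))))
      · exact Cost.of_mem (hS (Or.inr (Or.inr (Set.mem_iUnion.2 ⟨j, Or.inr ⟨q, rfl⟩⟩))))
    exact (h1.add ((agentConstants_ρD hA).mul
      ((sharedDev_cost hx q.1 q.2.1 q.2.2).sub h2))).mono (by omega)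

end LocalCost

/-! ### Counting variables and rank-one terms -/

section Counts

variable {d : Dims} {κ : ℕ}

namespace Dims

/-- The bound, up to a constant, for the number of variables of one agent. -/
def varBound (d : Dims) : ℕ := d.T * d.γ * d.nu * d.nx * (d.ninter + d.nobs)

/-- The bound, up to a constant, for the number of rank-one updates of one agent. -/
def rankBound (d : Dims) : ℕ := d.T ^ 2 * d.nd * (d.ninter + d.nobs)

/-- Sizes are positive and the uncertainty is at least of the order of the state dimension. -/
structure Admissible (d : Dims) (κ : ℕ) : Prop where
  T : 1 ≤ d.T
  nx : 1 ≤ d.nx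
  nu : 1 ≤ d.nu
  nd : 1 ≤ d.nd
  γ : 1 ≤ d.γ
  con : 1 ≤ d.ninter + d.nobs
  nx_le : d.nx ≤ κ * (d.T * d.nd)
  lin_le : d.nlin + d.ntight ≤ κ * d.T

theorem card_window_le (d : Dims) : Fintype.card d.Window ≤ d.T * d.γ := by
  -- A pair `(k, ℓ)` is determined by `k` and the lag `k - ℓ < γ`.
  let f : d.Window → Fin d.T × Fin d.γ := fun q =>
    (q.1.1, ⟨q.1.1.val - q.1.2.val, by have := q.2; omega⟩)
  have hf : Function.Injective f := by
    rintro ⟨⟨k, l⟩, hq⟩ ⟨⟨k', l'⟩, hq'⟩ h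
    simp only [f, Prod.mk.injEq, Fin.mk.injEq] at h
    obtain ⟨rfl, h⟩ := h
    simp only [Subtype.mk.injEq, Prod.mk.injEq, true_and]
    ext
    simp only at hq hq'
    omega
  simpa using Fintype.card_le_of_injective f hf

namespace Admissible

theorem horizon_le (h : d.Admissible κ) : d.T * (d.ninter + d.nobs) ≤ d.varBound := by
  have h1 : 1 * 1 * 1 ≤ d.γ * d.nu * d.nx := Nat.mul_le_mul (Nat.mul_le_mul h.γ h.nu) h.nx
  calc d.T * (d.ninter + d.nobs) = 1 * 1 * 1 * (d.T * (d.ninter + d.nobs)) := by ring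
    _ ≤ d.γ * d.nu * d.nx * (d.T * (d.ninter + d.nobs)) := Nat.mul_le_mul_right _ h1
    _ = d.varBound := by rw [varBound]; ring

theorem horizon_pos (h : d.Admissible κ) : 1 ≤ d.T * (d.ninter + d.nobs) := Nat.mul_pos h.T h.con

theorem varBound_pos (h : d.Admissible κ) : 1 ≤ d.varBound := h.horizon_pos.trans h.horizon_le

theorem horizon_le_rank (h : d.Admissible κ) : d.T * (d.ninter + d.nobs) ≤ d.rankBound := by
  calc d.T * (d.ninter + d.nobs) = 1 * 1 * (d.T * (d.ninter + d.nobs)) := by ring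
    _ ≤ d.T * d.nd * (d.T * (d.ninter + d.nobs)) :=
      Nat.mul_le_mul_right _ (Nat.mul_le_mul h.T h.nd)
    _ = d.rankBound := by rw [rankBound]; ring

theorem rankBound_pos (h : d.Admissible κ) : 1 ≤ d.rankBound := h.horizon_pos.trans h.horizon_le_rank

theorem T_le (h : d.Admissible κ) : d.T ≤ d.T * (d.ninter + d.nobs) := Nat.le_mul_of_pos_right _ h.con

theorem time_mul_le (h : d.Admissible κ) (x : ℕ) : (d.T + 1) * x ≤ 2 * (d.T * x) := by
  have := h.T
  nlinarith [Nat.zero_le x]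

theorem card_ctrl_le (h : d.Admissible κ) : Fintype.card d.Ctrl ≤ 2 * d.varBound := by
  have h1 : d.T * d.nu * 1 * 1 * 1 ≤ d.T * d.nu * d.γ * d.nx * (d.ninter + d.nobs) :=
    Nat.mul_le_mul (Nat.mul_le_mul (Nat.mul_le_mul_left _ h.γ) h.nx) h.con
  have h2 : Fintype.card d.Window * (d.nu * d.nx) * 1
      ≤ d.T * d.γ * (d.nu * d.nx) * (d.ninter + d.nobs) :=
    Nat.mul_le_mul (Nat.mul_le_mul_right _ d.card_window_le) h.con
  have e1 : d.T * d.nu * d.γ * d.nx * (d.ninter + d.nobs) = d.varBound := by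
    rw [varBound]; ring
  have e2 : d.T * d.γ * (d.nu * d.nx) * (d.ninter + d.nobs) = d.varBound := by
    rw [varBound]; ring
  rw [Fintype.card_sum, Fintype.card_prod, Fintype.card_prod, Fintype.card_prod, Fintype.card_fin,
    Fintype.card_fin, Fintype.card_fin]
  omega

/-- The assumption n_x ≤ κ T n_d enters here: the initial disturbance must not dominate the
dimension of the cone constraints. -/
theorem card_zeta_le (h : d.Admissible κ) : Fintype.card d.Zeta + 2 ≤ (κ + 3) * (d.T * d.nd) := by
  have h1 : 1 ≤ d.T * d.nd := Nat.mul_pos h.T h.nd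
  rw [Fintype.card_sum, Fintype.card_prod, Fintype.card_fin, Fintype.card_fin, Fintype.card_fin,
    add_mul]
  have := h.nx_le
  omega

/-- The rank-one terms of the robust constraints of one agent. -/
theorem soc₁_le (h : d.Admissible κ) : (d.nlin + d.ntight + (d.T + 1) * d.m) * (Fintype.card d.Zeta + 2)
    ≤ (κ + 2 * d.m) * (κ + 3) * d.rankBound := by
  have h1 : d.nlin + d.ntight + (d.T + 1) * d.m ≤ (κ + 2 * d.m) * d.T := by
    have h2 := h.lin_le
    have h3 := h.time_mul_le d.m
    have e : (κ + 2 * d.m) * d.T = κ * d.T + 2 * (d.T * d.m) := by ring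
    omega
  calc _ ≤ (κ + 2 * d.m) * d.T * ((κ + 3) * (d.T * d.nd)) := Nat.mul_le_mul h1 h.card_zeta_le
    _ = (κ + 2 * d.m) * (κ + 3) * (d.T ^ 2 * d.nd * 1) := by ring
    _ ≤ _ := Nat.mul_le_mul_left _ (Nat.mul_le_mul_left _ h.con)

/-- The number of penalty terms of one agent. -/
theorem penalty_le (h : d.Admissible κ) :
    (d.ninter + 1) * ((d.T + 1) * d.m) ≤ 4 * d.m * (d.T * (d.ninter + d.nobs)) := by
  have h1 := h.con
  calc (d.ninter + 1) * ((d.T + 1) * d.m)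
      ≤ (2 * (d.ninter + d.nobs)) * (2 * (d.T * d.m)) :=
        Nat.mul_le_mul (by omega) (h.time_mul_le d.m)
    _ = _ := by ring

/-- In multiples of `varBound`: 2 for the controls, 2m for the deviation bounds, 2 for all slacks,
4m for the copies, and 1 for the added unit. -/
theorem card_localVar_le (h : d.Admissible κ) {nb : Finset (Fin d.N)} (hnb : nb.card = d.ninter) :
    Fintype.card (LVar nb) + 1 ≤ (6 * d.m + 5) * d.varBound := by
  have h1 := h.card_ctrl_le
  have h2 := h.time_mul_le d.m
  have h3 := h.time_mul_le d.nobs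
  have h4 := h.time_mul_le d.ninter
  have h5 := h.T_le
  have h6 := h.horizon_le
  have h7 := h.varBound_pos
  have e1 : d.ninter * ((d.T + 1) * d.m) ≤ 2 * (d.m * (d.T * (d.ninter + d.nobs))) := by
    calc d.ninter * ((d.T + 1) * d.m) ≤ (d.ninter + d.nobs) * (2 * (d.T * d.m)) :=
          Nat.mul_le_mul (by omega) h2
      _ = _ := by ring
  have e2 : d.m * (d.T * (d.ninter + d.nobs)) ≤ d.m * d.varBound := Nat.mul_le_mul_left _ h6
  have e3 : d.T * d.m ≤ d.m * (d.T * (d.ninter + d.nobs)) := by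
    rw [mul_comm]; exact Nat.mul_le_mul_left _ h5
  have e4 : d.T * (d.ninter + d.nobs) = d.T * d.ninter + d.T * d.nobs := by ring
  have e5 : (6 * d.m + 5) * d.varBound = 6 * (d.m * d.varBound) + 5 * d.varBound := by ring
  have e6 : d.ninter * (d.T + 1) = (d.T + 1) * d.ninter := mul_comm _ _
  rw [e5]
  simp only [Fintype.card_sum (α := d.Ctrl), Fintype.card_sum (β := nb × d.Time × Fin d.m),
    Fintype.card_sum (α := d.Time × Fin d.m), Fintype.card_sum (α := d.Time × Fin d.nobs),
    Fintype.card_sum (α := nb × d.Time),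
    Fintype.card_prod, Fintype.card_coe, Fintype.card_fin, hnb]
  omega

/-- The robust cone constraints dominate: order T of them, of dimension order T n_d. In multiples of
`rankBound`, the rest is 2 for the linear constraints, κ for the equalities, 2m + 4 for the second
cone family, 8m for the penalties, 6m + 2 for the auxiliary identity, and 1. -/
theorem localRank_le (h : d.Admissible κ) {nb : Finset (Fin d.N)} (hnb : nb.card = d.ninter) :
    localRank d nb + 1 ≤ ((κ + 2 * d.m) * (κ + 3) + κ + 16 * d.m + 9) * d.rankBound := by
  have h0 := h.soc₁_le
  have h1 := h.penalty_le
  have h2 := h.time_mul_le d.m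
  have h3 := h.time_mul_le d.nobs
  have h4 := h.time_mul_le d.ninter
  have h5 := h.T_le
  have h6 := h.horizon_le_rank
  have h7 := h.rankBound_pos
  have h8 := h.lin_le
  have e1 : d.ninter * ((d.T + 1) * d.m) ≤ 2 * (d.m * (d.T * (d.ninter + d.nobs))) := by
    calc d.ninter * ((d.T + 1) * d.m) ≤ (d.ninter + d.nobs) * (2 * (d.T * d.m)) :=
          Nat.mul_le_mul (by omega) h2
      _ = _ := by ring
  have e2 : d.m * (d.T * (d.ninter + d.nobs)) ≤ d.m * d.rankBound := Nat.mul_le_mul_left _ h6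
  have e3 : d.T * d.m ≤ d.m * (d.T * (d.ninter + d.nobs)) := by
    rw [mul_comm]; exact Nat.mul_le_mul_left _ h5
  have e4 : d.T * (d.ninter + d.nobs) = d.T * d.ninter + d.T * d.nobs := by ring
  have e5 : ((κ + 2 * d.m) * (κ + 3) + κ + 16 * d.m + 9) * d.rankBound
      = (κ + 2 * d.m) * (κ + 3) * d.rankBound + κ * d.rankBound + 16 * (d.m * d.rankBound)
        + 9 * d.rankBound := by ring
  have e6 : d.ninter * (d.T + 1) = (d.T + 1) * d.ninter := mul_comm _ _
  have e7 : κ * d.T ≤ κ * d.rankBound := Nat.mul_le_mul_left _ (h5.trans h6)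
  have e8 : ((d.T + 1) * d.nobs + d.ninter * (d.T + 1)) * (d.m + 2)
      ≤ 2 * (d.m * d.rankBound) + 4 * d.rankBound := by
    calc ((d.T + 1) * d.nobs + d.ninter * (d.T + 1)) * (d.m + 2)
        ≤ 2 * d.rankBound * (d.m + 2) := Nat.mul_le_mul_right _ (by omega)
      _ = _ := by ring
  have e9 : 4 * d.m * (d.T * (d.ninter + d.nobs)) = 4 * (d.m * (d.T * (d.ninter + d.nobs))) := by
    ring
  have e10 : (d.nlin + (d.ntight + (d.T + 1) * d.m)) * (Fintype.card d.Zeta + 2)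
      = (d.nlin + d.ntight + (d.T + 1) * d.m) * (Fintype.card d.Zeta + 2) := by ring
  rw [e5]
  simp only [localRank, rankCount, Fintype.card_sum (β := nb × d.Time × Fin d.m),
    Fintype.card_sum (α := d.Time × Fin d.m), Fintype.card_sum (α := d.Time × Fin d.nobs),
    Fintype.card_sum (α := nb × d.Time), Fintype.card_sum (α := Fin d.nlin),
    Fintype.card_sum (α := Fin d.ntight),
    Fintype.card_sum (α := Option nb × d.Time × Fin d.m), Fintype.card_option,
    Fintype.card_prod, Fintype.card_coe, Fintype.card_fin, hnb, e10]
  omega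

variable {nbr : Fin d.N → Finset (Fin d.N)}

theorem card_edge (hn : ∀ i, (nbr i).card = d.ninter) :
    Fintype.card (Edge nbr) = d.N * d.ninter := by
  simp [Fintype.card_sigma, hn]

theorem card_centralVar_le (h : d.Admissible κ) (hN : 1 ≤ d.N)
    (hn : ∀ i, (nbr i).card = d.ninter) :
    Fintype.card (CVar nbr) + 1 ≤ (6 * d.m + 5) * (d.N * d.varBound) := by
  have h1 := h.card_ctrl_le
  have h2 := h.time_mul_le d.m
  have h3 := h.time_mul_le d.nobs
  have h4 := h.time_mul_le d.ninter
  have h5 := h.T_le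
  have h6 := h.horizon_le
  have h7 := h.varBound_pos
  have e2 : d.m * (d.T * (d.ninter + d.nobs)) ≤ d.m * d.varBound := Nat.mul_le_mul_left _ h6
  have e3 : d.T * d.m ≤ d.m * (d.T * (d.ninter + d.nobs)) := by
    rw [mul_comm]; exact Nat.mul_le_mul_left _ h5
  have e4 : d.T * (d.ninter + d.nobs) = d.T * d.ninter + d.T * d.nobs := by ring
  have e5 : (6 * d.m + 5) * (d.N * d.varBound)
      = d.N * (6 * (d.m * d.varBound) + 5 * d.varBound) := by ring
  rw [e5]
  have key : Fintype.card (CVar nbr) = d.N * (Fintype.card d.Ctrl + (d.T + 1) * d.m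
      + (d.T + 1) * d.nobs + (d.T + 1) * d.ninter) := by
    rw [Fintype.card_sum, Fintype.card_sum, Fintype.card_sum, Fintype.card_prod (Fin d.N) d.Ctrl]
    simp only [Fintype.card_prod, Fintype.card_fin, card_edge hn]
    ring
  rw [key]
  -- The added unit is bounded by `N`, after which the estimate is `N` times one for a single agent.
  refine (Nat.add_le_add_left hN _).trans ?_
  rw [← Nat.mul_succ]
  exact Nat.mul_le_mul_left _ (by omega)

theorem centralRank_le (h : d.Admissible κ) (hN : 1 ≤ d.N)
    (hn : ∀ i, (nbr i).card = d.ninter) :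
    centralRank d nbr + 1
      ≤ ((κ + 2 * d.m) * (κ + 3) + κ + 16 * d.m + 9) * (d.N * d.rankBound) := by
  have h0 := h.soc₁_le
  have h2 := h.time_mul_le d.m
  have h3 := h.time_mul_le d.nobs
  have h4 := h.time_mul_le d.ninter
  have h5 := h.T_le
  have h6 := h.horizon_le_rank
  have h7 := h.rankBound_pos
  have h8 := h.lin_le
  have e2 : d.m * (d.T * (d.ninter + d.nobs)) ≤ d.m * d.rankBound := Nat.mul_le_mul_left _ h6
  have e3 : d.T * d.m ≤ d.m * (d.T * (d.ninter + d.nobs)) := by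
    rw [mul_comm]; exact Nat.mul_le_mul_left _ h5
  have e4 : d.T * (d.ninter + d.nobs) = d.T * d.ninter + d.T * d.nobs := by ring
  have e5 : ((κ + 2 * d.m) * (κ + 3) + κ + 16 * d.m + 9) * (d.N * d.rankBound)
      = d.N * ((κ + 2 * d.m) * (κ + 3) * d.rankBound + κ * d.rankBound + 16 * (d.m * d.rankBound)
        + 9 * d.rankBound) := by ring
  have e7 : κ * d.T ≤ κ * d.rankBound := Nat.mul_le_mul_left _ (h5.trans h6)
  have e8 : ((d.T + 1) * d.nobs + (d.T + 1) * d.ninter) * (d.m + 2)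
      ≤ 2 * (d.m * d.rankBound) + 4 * d.rankBound := by
    calc ((d.T + 1) * d.nobs + (d.T + 1) * d.ninter) * (d.m + 2)
        ≤ 2 * d.rankBound * (d.m + 2) := Nat.mul_le_mul_right _ (by omega)
      _ = _ := by ring
  have key : centralRank d nbr = d.N * ((d.T + 1) * d.nobs + (d.T + 1) * d.ninter + d.ntight
      + (d.nlin + d.ntight + (d.T + 1) * d.m) * (Fintype.card d.Zeta + 2)
      + ((d.T + 1) * d.nobs + (d.T + 1) * d.ninter) * (d.m + 2)
      + ((d.T + 1) * d.m + (d.T + 1) * d.nobs + (d.T + 1) * d.ninter)) := by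
    simp only [centralRank, rankCount, Fintype.card_sum (α := Fin d.N × d.Time × Fin d.m),
      Fintype.card_sum (α := Fin d.N × d.Time × Fin d.nobs),
      Fintype.card_sum (α := Fin d.N × Fin d.nlin),
      Fintype.card_sum (α := Fin d.N × Fin d.ntight),
      Fintype.card_prod, Fintype.card_fin, card_edge hn, Fintype.card_empty]
    ring
  rw [e5, key]
  refine (Nat.add_le_add_left hN _).trans ?_
  rw [← Nat.mul_succ]
  exact Nat.mul_le_mul_left _ (by omega)

end Admissible

end Dims

end Counts

/-! ### Total costs -/

section Totals

variable {d : Dims} {κ : ℕ} {nbr : Fin d.N → Finset (Fin d.N)}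

/-- The constant of the cost bounds. -/
def costConst (m κ : ℕ) : ℕ :=
  (20 * m + 63) * (6 * m + 5) ^ 2 * ((κ + 2 * m) * (κ + 3) + κ + 16 * m + 9)
    + 4 * m * (2 * (6 * m + 5) + 3 * κ + 5) + 8 * m * (2 * (6 * m + 5) + 3)

theorem Dims.Admissible.central_cost (h : d.Admissible κ) (hn : ∀ i, (nbr i).card = d.ninter)
    (LLin LIP : ℕ) :
    Cheap (centralInputs d nbr) (costConst d.m κ * (LLin * LIP * d.N ^ 3
      * (d.varBound ^ 2 * d.rankBound))) (centralOutputs d nbr LLin LIP) := by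
  -- Without agents the bound is zero, but there are no variables to compute.
  rcases Nat.eq_zero_or_pos d.N with hN | hN
  · have : IsEmpty (Fin d.N) := by rw [hN]; infer_instance
    have : IsEmpty (CVar nbr) := by
      constructor
      rintro (⟨i, -⟩ | ⟨i, -⟩ | ⟨i, -⟩ | ⟨⟨i, -⟩, -⟩) <;> exact isEmptyElim i
    refine Cheap.of_inputs ?_
    rintro _ ⟨v, rfl⟩
    exact isEmptyElim v
  · refine (solve_cheap LIP LLin).mono ?_
    set A := (6 * d.m + 5)
    set B := ((κ + 2 * d.m) * (κ + 3) + κ + 16 * d.m + 9)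
    calc _ ≤ LLin * (LIP * ((20 * d.m + 63) * ((A * (d.N * d.varBound)) ^ 2
          * (B * (d.N * d.rankBound))))) := by
          refine Nat.mul_le_mul_left _ (Nat.mul_le_mul_left _ (Nat.mul_le_mul (by omega)
            (Nat.mul_le_mul (Nat.pow_le_pow_left ?_ 2) ?_)))
          · exact h.card_centralVar_le hN hn
          · exact h.centralRank_le hN hn
      _ = ((20 * d.m + 63) * A ^ 2 * B) * (LLin * LIP * d.N ^ 3
          * (d.varBound ^ 2 * d.rankBound)) := by ring
      _ ≤ _ := by
        -- The first summand of `costConst` suffices; the other two pay for the averaging and dual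
        -- updates of ADMM.
        refine Nat.mul_le_mul_right _ ?_
        rw [costConst, add_assoc]
        exact Nat.le_add_right _ _

theorem Dims.Admissible.distributed_cost (h : d.Admissible κ)
    (hn : ∀ i, (nbr i).card = d.ninter) (hpre : ∀ i, Fintype.card (Pre nbr i) ≤ κ * d.ninter)
    (LADMM LIP : ℕ) (hLIP : 1 ≤ LIP) : ∃ k, DistributedCost nbr LADMM LIP k ∧
      k ≤ costConst d.m κ * (LADMM * LIP * (d.varBound ^ 2 * d.rankBound)) := by
  set a := d.varBound with ha
  set b := d.rankBound with hb
  set A := (6 * d.m + 5) with hA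
  set B := ((κ + 2 * d.m) * (κ + 3) + κ + 16 * d.m + 9) with hB
  have ha1 : 1 ≤ a := h.varBound_pos
  have hb1 : 1 ≤ b := h.rankBound_pos
  have hθ : d.T * (d.ninter + d.nobs) ≤ a := h.horizon_le
  have hT : d.T ≤ a := h.T_le.trans hθ
  have hI : d.ninter ≤ a := by
    refine le_trans ?_ hθ
    have := h.T
    nlinarith [Nat.zero_le d.ninter, Nat.zero_le d.nobs]
  -- Averaging and dual updates are quadratic in `a`; at least one interior-point iteration is
  -- needed to dominate them.
  have hab : a * a ≤ LIP * (a ^ 2 * b) := by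
    calc a * a = 1 * (a ^ 2 * 1) := by ring
      _ ≤ _ := Nat.mul_le_mul hLIP (Nat.mul_le_mul_left _ hb1)
  refine ⟨_, ⟨(20 * d.m + 63) * A ^ 2 * B * (LIP * (a ^ 2 * b)),
    4 * d.m * (2 * A + 3 * κ + 5) * (LIP * (a ^ 2 * b)),
    8 * d.m * (2 * A + 3) * (LIP * (a ^ 2 * b)), rfl, ?_⟩, ?_⟩
  · intro l _ i
    have hv : Fintype.card (LVar (nbr i)) + 1 ≤ A * a := h.card_localVar_le (hn i)
    have htime : Fintype.card (d.Time × Fin d.m) ≤ 2 * (d.T * d.m) := by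
      rw [Fintype.card_prod, Fintype.card_fin, Fintype.card_fin]
      exact h.time_mul_le d.m
    refine ⟨(localUpdate_cheap LIP l hLIP i subset_rfl).mono ?_,
      (globalUpdate_cheap LIP l i subset_rfl).mono ?_,
      (dualUpdate_cheap LIP l i subset_rfl).mono ?_⟩
    · calc _ ≤ LIP * ((20 * d.m + 63) * ((A * a) ^ 2 * (B * b))) :=
            Nat.mul_le_mul_left _ (Nat.mul_le_mul_left _
              (Nat.mul_le_mul (Nat.pow_le_pow_left hv 2) (h.localRank_le (hn i))))
        _ = _ := by ring
    · have h1 : 2 * (Fintype.card (LVar (nbr i)) + 1) + 3 * Fintype.card (Pre nbr i) + 5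
          ≤ (2 * A + 3 * κ + 5) * a := by
        have h2 : κ * d.ninter ≤ κ * a := Nat.mul_le_mul_left _ hI
        have h3 := hpre i
        have e : (2 * A + 3 * κ + 5) * a = 2 * (A * a) + 3 * (κ * a) + 5 * a := by ring
        omega
      calc _ ≤ 2 * (2 * (a * d.m) * ((2 * A + 3 * κ + 5) * a)) :=
            Nat.mul_le_mul_left _ (Nat.mul_le_mul
              (htime.trans (Nat.mul_le_mul_left _ (Nat.mul_le_mul_right _ hT))) h1)
        _ = 4 * d.m * (2 * A + 3 * κ + 5) * (a * a) := by ring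
        _ ≤ _ := Nat.mul_le_mul_left _ hab
    · have h1 : 2 * (Fintype.card (LVar (nbr i)) + 1) + 3 ≤ (2 * A + 3) * a := by
        have e : (2 * A + 3) * a = 2 * (A * a) + 3 * a := by ring
        omega
      have h2 : Fintype.card (Option (nbr i) × d.Time × Fin d.m) ≤ 4 * d.m * a := by
        rw [Fintype.card_prod, Fintype.card_option, Fintype.card_coe, hn i, Fintype.card_prod,
          Fintype.card_fin, Fintype.card_fin]
        exact h.penalty_le.trans (Nat.mul_le_mul_left _ hθ)
      calc _ ≤ 2 * (4 * d.m * a * ((2 * A + 3) * a)) :=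
            Nat.mul_le_mul_left _ (Nat.mul_le_mul h2 h1)
        _ = 8 * d.m * (2 * A + 3) * (a * a) := by ring
        _ ≤ _ := Nat.mul_le_mul_left _ hab
  · refine le_of_eq ?_
    rw [costConst, ← hA, ← hB]
    ring

theorem Dims.bound_eq (d : Dims) : d.varBound ^ 2 * d.rankBound
    = d.T ^ 4 * (d.ninter + d.nobs) ^ 3 * d.nu ^ 2 * d.nx ^ 2 * d.nd * d.γ ^ 2 := by
  rw [Dims.varBound, Dims.rankBound]
  ring

end Totals

end RobustMAS

theorem proposition5 (m κ : ℕ) :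
    ∃ C : ℕ, ∀ (d : RobustMAS.Dims) (nbr : Fin d.N → Finset (Fin d.N)),
      d.m = m → 1 ≤ d.T → 1 ≤ d.nx → 1 ≤ d.nu → 1 ≤ d.nd → 1 ≤ d.γ →
      1 ≤ d.ninter + d.nobs → (∀ i, (nbr i).card = d.ninter) →
      d.nx ≤ κ * (d.T * d.nd) → d.nlin + d.ntight ≤ κ * d.T →
      (∀ LLin LIP : ℕ, ∃ k : ℕ,
        RobustMAS.Computes (RobustMAS.centralInputs d nbr) k
          (RobustMAS.centralOutputs d nbr LLin LIP) ∧
        k ≤ C * (LLin * LIP * d.N ^ 3 * d.T ^ 4 * (d.ninter + d.nobs) ^ 3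
          * d.nu ^ 2 * d.nx ^ 2 * d.nd * d.γ ^ 2)) ∧
      ((∀ i, Fintype.card (RobustMAS.Pre nbr i) ≤ κ * d.ninter) →
        ∀ LADMM LIP : ℕ, 1 ≤ LIP → ∃ k : ℕ,
          RobustMAS.DistributedCost nbr LADMM LIP k ∧
          k ≤ C * (LADMM * LIP * d.T ^ 4 * (d.ninter + d.nobs) ^ 3
            * d.nu ^ 2 * d.nx ^ 2 * d.nd * d.γ ^ 2)) := by
  refine ⟨RobustMAS.costConst m κ, ?_⟩
  intro d nbr hm hT hnx hnu hnd hγ hcon hn hnx_le hlin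
  subst hm
  have h : d.Admissible κ := ⟨hT, hnx, hnu, hnd, hγ, hcon, hnx_le, hlin⟩
  constructor
  · intro LLin LIP
    obtain ⟨k, hk, hc⟩ := h.central_cost hn LLin LIP
    refine ⟨k, hc, hk.trans (le_of_eq ?_)⟩
    rw [d.bound_eq]
    ring
  · intro hpre LADMM LIP hLIP
    obtain ⟨k, hc, hk⟩ := h.distributed_cost hn hpre LADMM LIP hLIP
    refine ⟨k, hc, hk.trans (le_of_eq ?_)⟩
    rw [d.bound_eq]
    ring
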